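/- Let $(M,g)$ be a spacetime: a connected, Hausdorff, second-countable smooth manifold of dimension $n+1$ with $n\ge 2$, with a smooth Lorentz metric of signature $(-,+,\dots,+)$ and a fixed time-orientation. Causal and null vectors are nonzero by convention, and timelike and causal curves are piecewise smooth. For an open set $U\subseteq M$ and $p\in U$, $I^+(p,U)$ is the set of points reached from $p$ by future-directed timelike curves in $U$, and $J^+(p,U)$ consists of $p$ and the points reached from $p$ by future-directed causal curves in $U$. $I^-(A)$ is the set of points of $M$ from which some point of $A$ can be reached by a future-directed timelike curve. For $A\subseteq M$, $A\cap U$ is achronal in $U$ if $y\notin I^+(x,U)$ for all $x,y\in A\cap U$; $A$ is achronal if this holds with $U=M$, and locally achronal if each $x\in A$ has an open neighbourhood $U$ such that $A\cap U$ is achronal in $U$. A set $A$ is future lightlike if it is non-empty, locally achronal, and for each $x\in A$ and each open $U\ni x$ such that $A\cap U$ is achronal in $U$ there is a point $y\in A\cap U$ with $y\in J^+(x,U)\setminus\{x\}$. The future edge of $A$ is $$\varepsilon_+A=\{p\in\overline A : \text{there is an open } U\ni p \text{ with } A\cap J^+(p,U)\subseteq\{p\}\}.$$ A $C^0$ hypersurface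 is a set $S\subseteq M$ such that each $p\in S$ has an open neighbourhood $W$ in $M$ and a homeomorphism of $W$ onto an open subset of $\mathbb R^{n+1}$ taking $S\cap W$ onto the part of the image lying in $\{x_0=0\}$. A future lightlike set $A$ has a future p-horizon if $\partial I^-(A)$ is a non-empty, closed, future lightlike $C^0$ hypersurface. Then: 1. If $A\subseteq M$ is non-empty and locally achronal, then $A$ is future lightlike if and only if $A\cap\varepsilon_+A=\emptyset$. 2. If $A\subseteq M$ is future lightlike, then $\partial I^-(A)\setminus\overline{\varepsilon_+A}$, if non-empty, is an achronal future lightlike $C^0$ hypersurface. 3. If $A\subseteq M$ is future lightlike, $\varepsilon_+A=\emptyset$ and $\partial I^-(A)\neq\emptyset$, then $A$ has a future p-horizon. 4. Suppose $(M,g)$ is strongly causal: for each $p\in M$ and each open $V\ni p$ there is an open $U$ with $p\in U\subseteq V$ such that every future-directed causal curve with endpoints in $U$ lies in $V$. Let $\eta:[0,a)\to M$, $0<a\le+\infty$, be a future-directed, future-inextendible (i.e. $\eta(t)$ has no limit in $M$ as $t\to a$) null geodesic with image $A$. If $\partial I^-(A)\neq\emptyset$, then $A$ is future lightlike and has a future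 p-horizon. -/

import Mathlib

open Set Filter Topology Bundle
open scoped Manifold ContDiff

noncomputable section

/-- The geometric data of a spacetime on an `(n+1)`-dimensional smooth manifold `M`: a smooth
Lorentz metric of signature `(-,+,…,+)` and a time orientation, given by a smooth timelike vector
field. -/
structure SpacetimeStructure (n : ℕ) (M : Type*) [TopologicalSpace M]
    [ChartedSpace (EuclideanSpace ℝ (Fin (n + 1))) M] [IsManifold (𝓡 (n + 1)) ∞ M] where
  /-- The metric tensor. -/
  metric (x : M) :
    TangentSpace (𝓡 (n + 1)) x →L[ℝ] TangentSpace (𝓡 (n + 1)) x →L[ℝ] ℝ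
  metric_symm (x : M) (v w : TangentSpace (𝓡 (n + 1)) x) : metric x v w = metric x w v
  /-- Signature `(-,+,…,+)`: there is a vector `v` with `⟨v,v⟩ < 0` on whose orthogonal
  complement the metric is positive definite. -/
  metric_signature (x : M) : ∃ v : TangentSpace (𝓡 (n + 1)) x, metric x v v < 0 ∧
    ∀ w : TangentSpace (𝓡 (n + 1)) x, metric x v w = 0 → w ≠ 0 → 0 < metric x w w
  metric_smooth : ContMDiff (𝓡 (n + 1))
    ((𝓡 (n + 1)).prod 𝓘(ℝ, EuclideanSpace ℝ (Fin (n + 1)) →L[ℝ]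
      EuclideanSpace ℝ (Fin (n + 1)) →L[ℝ] ℝ)) ∞
    (fun x ↦ TotalSpace.mk' (EuclideanSpace ℝ (Fin (n + 1)) →L[ℝ]
      EuclideanSpace ℝ (Fin (n + 1)) →L[ℝ] ℝ)
      (E := fun x : M ↦ TangentSpace (𝓡 (n + 1)) x →L[ℝ] TangentSpace (𝓡 (n + 1)) x →L[ℝ] ℝ)
      x (metric x))
  /-- The vector field that fixes the time orientation. -/
  timeField (x : M) : TangentSpace (𝓡 (n + 1)) x
  timeField_smooth : ContMDiff (𝓡 (n + 1)) (𝓡 (n + 1)).tangent ∞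
    (fun x ↦ (⟨x, timeField x⟩ : TangentBundle (𝓡 (n + 1)) M))
  timeField_timelike (x : M) : metric x (timeField x) (timeField x) < 0

namespace SpacetimeStructure

variable {n : ℕ} {M : Type*} [TopologicalSpace M]
  [ChartedSpace (EuclideanSpace ℝ (Fin (n + 1))) M] [IsManifold (𝓡 (n + 1)) ∞ M]

/-! ### Causal character of vectors -/

/-- `v` is timelike and future-directed. -/
def FutureTimelike (g : SpacetimeStructure n M) {x : M} (v : TangentSpace (𝓡 (n + 1)) x) : Prop :=
  g.metric x v v < 0 ∧ g.metric x v (g.timeField x) < 0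

/-- `v` is causal (nonspacelike and nonzero) and future-directed. -/
def FutureCausal (g : SpacetimeStructure n M) {x : M} (v : TangentSpace (𝓡 (n + 1)) x) : Prop :=
  v ≠ 0 ∧ g.metric x v v ≤ 0 ∧ g.metric x v (g.timeField x) < 0

/-- `v` is null (in particular nonzero) and future-directed. -/
def FutureNull (g : SpacetimeStructure n M) {x : M} (v : TangentSpace (𝓡 (n + 1)) x) : Prop :=
  v ≠ 0 ∧ g.metric x v v = 0 ∧ g.metric x v (g.timeField x) < 0

/-! ### Curves -/

/-- The velocity at time `t` of a curve `γ` defined on `D ⊆ ℝ` (one-sided at endpoints of `D`). -/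
def velocity (γ : ℝ → M) (D : Set ℝ) (t : ℝ) : TangentSpace (𝓡 (n + 1)) (γ t) :=
  mfderivWithin 𝓘(ℝ, ℝ) (𝓡 (n + 1)) γ D t (1 : ℝ)

/-- `γ` restricted to `[a, b]`, `a < b`, is a smooth future-directed timelike curve. -/
def IsSmoothFutureTimelike (g : SpacetimeStructure n M) (γ : ℝ → M) (a b : ℝ) : Prop :=
  a < b ∧ ContMDiffOn 𝓘(ℝ, ℝ) (𝓡 (n + 1)) ∞ γ (Icc a b) ∧
    ∀ t ∈ Icc a b, g.FutureTimelike (velocity γ (Icc a b) t)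

/-- `γ` restricted to `[a, b]`, `a < b`, is a smooth future-directed causal curve. -/
def IsSmoothFutureCausal (g : SpacetimeStructure n M) (γ : ℝ → M) (a b : ℝ) : Prop :=
  a < b ∧ ContMDiffOn 𝓘(ℝ, ℝ) (𝓡 (n + 1)) ∞ γ (Icc a b) ∧
    ∀ t ∈ Icc a b, g.FutureCausal (velocity γ (Icc a b) t)

/-- `γ` restricted to `[a, b]` is a piecewise smooth future-directed timelike curve: there is a
partition `a = t₀ < t₁ < ⋯ < tₖ = b`, `k ≥ 1`, such that `γ` is smooth, timelike and
future-directed on each `[tᵢ, tᵢ₊₁]`. -/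
def IsFutureTimelikeCurve (g : SpacetimeStructure n M) (γ : ℝ → M) (a b : ℝ) : Prop :=
  Relation.TransGen (g.IsSmoothFutureTimelike γ) a b

/-- `γ` restricted to `[a, b]` is a piecewise smooth future-directed causal curve. -/
def IsFutureCausalCurve (g : SpacetimeStructure n M) (γ : ℝ → M) (a b : ℝ) : Prop :=
  Relation.TransGen (g.IsSmoothFutureCausal γ) a b

/-! ### Causal relations -/

/-- `I⁺(p, U)`: the points reached from `p` by future-directed timelike curves inside `U`. -/
def chronFutureIn (g : SpacetimeStructure n M) (p : M) (U : Set M) : Set M :=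
  {q | ∃ (γ : ℝ → M) (a b : ℝ), g.IsFutureTimelikeCurve γ a b ∧ γ a = p ∧ γ b = q ∧
    ∀ t ∈ Icc a b, γ t ∈ U}

/-- `J⁺(p, U)`, for `p ∈ U`: the point `p` and the points reached from `p` by future-directed
causal curves inside `U`. -/
def causalFutureIn (g : SpacetimeStructure n M) (p : M) (U : Set M) : Set M :=
  {q | q = p ∨ ∃ (γ : ℝ → M) (a b : ℝ), g.IsFutureCausalCurve γ a b ∧ γ a = p ∧ γ b = q ∧
    ∀ t ∈ Icc a b, γ t ∈ U}

/-- `I⁻(A)`: the points `p` with `p ≪ q` (in `M`) for some `q ∈ A`. -/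
def chronPast (g : SpacetimeStructure n M) (A : Set M) : Set M :=
  {p | ∃ q ∈ A, q ∈ g.chronFutureIn p univ}

/-- The set `A ∩ U` is achronal in the spacetime `(U, g|_U)`. -/
def AchronalIn (g : SpacetimeStructure n M) (A U : Set M) : Prop :=
  ∀ x ∈ A ∩ U, ∀ y ∈ A ∩ U, y ∉ g.chronFutureIn x U

/-- `A` is achronal: no two of its points are joined by a timelike curve of `M`. -/
def Achronal (g : SpacetimeStructure n M) (A : Set M) : Prop :=
  g.AchronalIn A univ

/-- `A` is locally achronal. -/
def LocallyAchronal (g : SpacetimeStructure n M) (A : Set M) : Prop :=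
  ∀ x ∈ A, ∃ U : Set M, IsOpen U ∧ x ∈ U ∧ g.AchronalIn A U

/-- Strong causality: every neighbourhood `V` of a point contains a neighbourhood `U` of it such
that every future-directed causal curve with endpoints in `U` lies in `V`. -/
def StronglyCausal (g : SpacetimeStructure n M) : Prop :=
  ∀ (p : M) (V : Set M), IsOpen V → p ∈ V → ∃ U : Set M, IsOpen U ∧ p ∈ U ∧ U ⊆ V ∧
    ∀ (γ : ℝ → M) (a b : ℝ), g.IsFutureCausalCurve γ a b → γ a ∈ U → γ b ∈ U →
      ∀ t ∈ Icc a b, γ t ∈ V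

/-! ### Lightlike sets, future edge, hypersurfaces, p-horizons -/

/-- Future lightlike sets. -/
structure FutureLightlike (g : SpacetimeStructure n M) (A : Set M) : Prop where
  nonempty : A.Nonempty
  locallyAchronal : g.LocallyAchronal A
  exists_future : ∀ x ∈ A, ∀ U : Set M, IsOpen U → x ∈ U → g.AchronalIn A U →
    ∃ y ∈ A ∩ U, y ∈ g.causalFutureIn x U \ {x}

/-- The future edge `ε₊A`. -/
def futureEdge (g : SpacetimeStructure n M) (A : Set M) : Set M :=
  {p | p ∈ closure A ∧ ∃ U : Set M, IsOpen U ∧ p ∈ U ∧ A ∩ g.causalFutureIn p U ⊆ {p}}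

end SpacetimeStructure

/-- `S` is a `C⁰` (topological) hypersurface of the `(n+1)`-manifold `M`: every point of `S` has
an open neighbourhood `W` in `M` with a homeomorphism `φ` of `W` onto an open subset of `ℝⁿ⁺¹`
which takes `S ∩ W` onto `φ(W) ∩ {x₀ = 0}`. -/
def IsC0Hypersurface (n : ℕ) {M : Type*} [TopologicalSpace M] (S : Set M) : Prop :=
  ∀ p ∈ S, ∃ φ : OpenPartialHomeomorph M (EuclideanSpace ℝ (Fin (n + 1))), p ∈ φ.source ∧
    ∀ x ∈ φ.source, x ∈ S ↔ φ x 0 = 0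

namespace SpacetimeStructure

variable {n : ℕ} {M : Type*} [TopologicalSpace M]
  [ChartedSpace (EuclideanSpace ℝ (Fin (n + 1))) M] [IsManifold (𝓡 (n + 1)) ∞ M]

/-- The set `A` is future lightlike and has a future p-horizon: `∂I⁻(A)` is a non-empty closed
future lightlike `C⁰` hypersurface. -/
structure HasFuturePHorizon (g : SpacetimeStructure n M) (A : Set M) : Prop where
  futureLightlike : g.FutureLightlike A
  frontier_nonempty : (frontier (g.chronPast A)).Nonempty
  frontier_futureLightlike : g.FutureLightlike (frontier (g.chronPast A))
  frontier_isClosed : IsClosed (frontier (g.chronPast A))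
  frontier_isC0Hypersurface : IsC0Hypersurface n (frontier (g.chronPast A))

/-! ### Geodesics -/

/-- The metric read in the preferred chart `φ` at `x₀`: the value on coordinate vectors `u, v` at
the point `y` of the image of `φ`. -/
def metricInChart (g : SpacetimeStructure n M) (x₀ : M) (y u v : EuclideanSpace ℝ (Fin (n + 1))) :
    ℝ :=
  g.metric ((extChartAt (𝓡 (n + 1)) x₀).symm y)
    (mfderiv 𝓘(ℝ, EuclideanSpace ℝ (Fin (n + 1))) (𝓡 (n + 1)) (extChartAt (𝓡 (n + 1)) x₀).symm y u)
    (mfderiv 𝓘(ℝ, EuclideanSpace ℝ (Fin (n + 1))) (𝓡 (n + 1)) (extChartAt (𝓡 (n + 1)) x₀).symm y v)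

/-- The Christoffel symbols of the first kind in the chart at `x₀`: for constant coordinate vector
fields `u, v, w` this is `⟨∇_u v, w⟩` at `y`, as given by the Koszul formula. -/
def christoffel (g : SpacetimeStructure n M) (x₀ : M) (y u v w : EuclideanSpace ℝ (Fin (n + 1))) :
    ℝ :=
  (1 / 2 : ℝ) * (fderiv ℝ (fun z ↦ g.metricInChart x₀ z v w) y u
    + fderiv ℝ (fun z ↦ g.metricInChart x₀ z u w) y v
    - fderiv ℝ (fun z ↦ g.metricInChart x₀ z u v) y w)

/-- `γ`, defined on the interval `D`, is a geodesic: it is smooth and satisfies `∇_{γ'} γ' = 0`,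
i.e. at each time `t`, in the coordinates `c = φ ∘ γ` of the chart `φ` at `γ t`,
`⟨c'', w⟩ + ⟨Γ(c', c'), w⟩ = 0` for all `w`. -/
def IsGeodesicOn (g : SpacetimeStructure n M) (γ : ℝ → M) (D : Set ℝ) : Prop :=
  ContMDiffOn 𝓘(ℝ, ℝ) (𝓡 (n + 1)) ∞ γ D ∧
    ∀ t ∈ D, ∀ w : EuclideanSpace ℝ (Fin (n + 1)),
      let c : ℝ → EuclideanSpace ℝ (Fin (n + 1)) := fun s ↦ extChartAt (𝓡 (n + 1)) (γ t) (γ s)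
      g.metricInChart (γ t) (c t) (derivWithin (derivWithin c D) D t) w
        + g.christoffel (γ t) (c t) (derivWithin c D t) (derivWithin c D t) w = 0

/-- `γ`, defined on the interval `D`, is a future-directed null geodesic. -/
def IsFutureNullGeodesicOn (g : SpacetimeStructure n M) (γ : ℝ → M) (D : Set ℝ) : Prop :=
  g.IsGeodesicOn γ D ∧ ∀ t ∈ D, g.FutureNull (velocity γ D t)

end SpacetimeStructure

/-- The interval `[0, a) ⊆ ℝ`, where `a ≤ +∞`. -/
def halfOpenInterval (a : EReal) : Set ℝ :=
  {t | 0 ≤ t ∧ (t : EReal) < a}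

/-- The curve `γ : [0, a) → M` is future-inextendible: it has no future endpoint, i.e. `γ t` does
not converge in `M` as `t → a` from below. -/
def FutureInextendible {M : Type*} [TopologicalSpace M] (γ : ℝ → M) (a : EReal) : Prop :=
  ¬ ∃ p : M, Tendsto γ (comap (fun t : ℝ ↦ (t : EReal)) (𝓝[<] a)) (𝓝 p)

end

noncomputable section

set_option linter.unusedSectionVars false

set_option synthInstance.maxHeartbeats 200000

/-! ### Lorentzian linear algebra -/

/-! Everything is reduced to estimates in a small coordinate ball. By `exists_patch` each point has
a chart ball (`IsLorentzPatch`) with a unit timelike vector T at the centre, its dual linear time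
function ℓ, and constants uniform over the ball. Chart segments whose direction is close to a
timelike vector are timelike there, so I⁺(p) and I⁻(A) are open. A causal curve that ends in I⁻(A)
also starts in it: `mem_chronPast_of_Ioc` lifts the curve along T by an exponentially growing
amount, which makes it timelike while fixing its initial point.

Write F = ∂I⁻(A). If x ≪ y with y in the closure of I⁻(A), then I⁺(x) meets I⁻(A), so x ∈ I⁻(A);
hence F is achronal. In a chart no two points of F differ by a vector of a fixed cone about T, so F
lies on a Lipschitz graph over the directions transverse to T, and F fills the graph because
vertical segments cross it (`isC0Hypersurface_frontier_chronPast`).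

The core of statement 2 is to find, from x₀ ∈ F off the closure of the edge, a causally later point
of F nearby. If x₀ ∈ closure A, the definition of the edge gives a point of A, and it cannot lie in
I⁻(A) because x₀ does not. If x₀ ∉ closure A, a null generator is needed
(`exists_mem_frontier_causalFutureIn`). No limit curve is constructed, only a limit point: timelike
curves from points p_j → x₀ to A must leave the ball, hence cross the level ℓ = ℓ(x₀) + τ, and the
crossing points accumulate at some z in the closure of I⁻(A). It remains to see that z lies on the
light cone of x₀. For small τ a contraction argument places any z that is not well inside the cone
on a transverse line through a null ray from x₀ with direction T + m (`eventually_exists_ray`). If z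
is inside the cone, an explicit timelike curve joins x₀ to z, which forces x₀ ∈ I⁻(A). If z is
outside, the `nullBarrier` of that ray is positive at z; but it strictly decreases along timelike
curves and vanishes at x₀, so in the limit it is at most 0 at z. So z is on the ray, and it lies in
F.

The barrier is the conormal covector of the ray paired with the displacement from the ray, minus a
small quadratic correction. The bicharacteristic equation cancels its first-order error
(`exists_barrier_bound`).

Statement 1 unwinds the definitions, and statement 3 is statement 2 with empty edge. For statement
4, the geodesic equation in momentum form makes a null geodesic locally a null ray
(`exists_momentum_deriv`, `exists_isNullRay`). Its barrier is zero along the geodesic and decreases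
along timelike curves. Strong causality prevents returns to a small neighbourhood, so the image is
locally achronal. Strong causality and inextendibility make the image closed, and then its future
edge is empty. -/

/-- In a space whose symmetric form is negative on `v` and positive definite on the orthogonal
complement of `v`, the form is positive definite on the orthogonal complement of every timelike
vector. -/
theorem pos_of_orthogonal_timelike {E : Type*} [AddCommGroup E] [Module ℝ E]
    (B : E →ₗ[ℝ] E →ₗ[ℝ] ℝ) (hB : ∀ v w, B v w = B w v) {v : E} (hv : B v v < 0)
    (hpos : ∀ w, B v w = 0 → w ≠ 0 → 0 < B w w) {T : E} (hT : B T T < 0) {w : E}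
    (hw : B T w = 0) (hw0 : w ≠ 0) : 0 < B w w := by
  have hv0 : B v v ≠ 0 := hv.ne
  obtain ⟨a, T', hT', rfl⟩ : ∃ (a : ℝ) (T' : E), B v T' = 0 ∧ T = a • v + T' :=
    ⟨B v T / B v v, T - (B v T / B v v) • v, by simp [hv0], by simp⟩
  obtain ⟨b, w', hw', rfl⟩ : ∃ (a : ℝ) (T' : E), B v T' = 0 ∧ w = a • v + T' :=
    ⟨B v w / B v v, w - (B v w / B v v) • v, by simp [hv0], by simp⟩
  have h1 : B T' v = 0 := by rw [hB, hT']
  have h2 : B w' v = 0 := by rw [hB, hw']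
  have h3 : B w' T' = B T' w' := hB _ _
  simp only [map_add, map_smul, LinearMap.add_apply, LinearMap.smul_apply, smul_eq_mul, hT', hw',
    h1, h2, mul_zero, add_zero, zero_add] at hT hw ⊢
  have hnn : ∀ u, B v u = 0 → 0 ≤ B u u := by
    intro u hu
    by_cases h : u = 0
    · simp [h]
    · exact (hpos u hu h).le
  have ha : a ≠ 0 := by
    rintro rfl
    have := hnn T' hT'
    simp at hT
    linarith
  by_cases hw'0 : w' = 0
  · subst hw'0
    simp only [map_zero, add_zero] at hw ⊢
    have hb : b = 0 := by
      simpa [ha, hv0] using hw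
    simp [hb] at hw0
  have hwp := hpos w' hw' hw'0
  have hcs : (B T' w') ^ 2 ≤ B T' T' * B w' w' := by
    have key : B v (T' - (B T' w' / B w' w') • w') = 0 := by simp [hT', hw']
    have := hnn _ key
    simp only [map_sub, map_smul, LinearMap.sub_apply, LinearMap.smul_apply, smul_eq_mul, h3] at this
    have e : B T' T' - B T' w' / B w' w' * B T' w' - B T' w' / B w' w' *
        (B T' w' - B T' w' / B w' w' * B w' w') = B T' T' - (B T' w') ^ 2 / B w' w' := by
      field_simp
      ring
    have h4 : 0 ≤ B T' T' - (B T' w') ^ 2 / B w' w' := by rw [← e]; linarith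
    rw [sub_nonneg, div_le_iff₀ hwp] at h4
    exact h4
  -- Orthogonality of T and w prescribes B T' w'. If B w w ≤ 0, then B T' T' < a²|B v v| and B w' w'
  -- ≤ b²|B v v|, which contradicts the Cauchy–Schwarz inequality `hcs` on the complement of v.
  have hq : B T' w' = -(a * (b * B v v)) := by linarith
  rw [hq] at hcs
  by_contra hcon
  push Not at hcon
  have ha2 : 0 < a ^ 2 := by positivity
  have i1 : B T' T' < a ^ 2 * (- B v v) := by nlinarith
  have i2 : B w' w' ≤ b ^ 2 * (- B v v) := by nlinarith
  have i3 : B T' T' * B w' w' < (a ^ 2 * (- B v v)) * B w' w' := by nlinarith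
  have i4 : (a ^ 2 * (- B v v)) * B w' w' ≤ (a ^ 2 * (- B v v)) * (b ^ 2 * (- B v v)) :=
    mul_le_mul_of_nonneg_left i2 (by nlinarith)
  nlinarith

namespace SpacetimeStructure

variable {n : ℕ} {M : Type*} [TopologicalSpace M]
  [ChartedSpace (EuclideanSpace ℝ (Fin (n + 1))) M] [IsManifold (𝓡 (n + 1)) ∞ M]

/-! ### The metric in a chart -/

/-- The derivative of the inverse of the preferred chart at `x₀`. -/
def chartFrame (x₀ : M) (y : EuclideanSpace ℝ (Fin (n + 1))) :
    EuclideanSpace ℝ (Fin (n + 1)) →L[ℝ] EuclideanSpace ℝ (Fin (n + 1)) :=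
  mfderiv 𝓘(ℝ, EuclideanSpace ℝ (Fin (n + 1))) (𝓡 (n + 1)) (extChartAt (𝓡 (n + 1)) x₀).symm y

/-- The metric at `x`, with the tangent space read as the model space. -/
def modelMetric (g : SpacetimeStructure n M) (x : M) :
    EuclideanSpace ℝ (Fin (n + 1)) →L[ℝ] EuclideanSpace ℝ (Fin (n + 1)) →L[ℝ] ℝ :=
  g.metric x

/-- The time orientation at `x`, with the tangent space read as the model space. -/
def modelTime (g : SpacetimeStructure n M) (x : M) : EuclideanSpace ℝ (Fin (n + 1)) :=
  g.timeField x

/-- The metric in the preferred chart at `x₀`, as a field of bilinear forms. -/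
def chartMetric (g : SpacetimeStructure n M) (x₀ : M) (y : EuclideanSpace ℝ (Fin (n + 1))) :
    EuclideanSpace ℝ (Fin (n + 1)) →L[ℝ] EuclideanSpace ℝ (Fin (n + 1)) →L[ℝ] ℝ :=
  (g.modelMetric ((extChartAt (𝓡 (n + 1)) x₀).symm y)).bilinearComp
    (chartFrame x₀ y) (chartFrame x₀ y)

/-- The covector dual to the time orientation, in the preferred chart at `x₀`. -/
def chartTime (g : SpacetimeStructure n M) (x₀ : M) (y : EuclideanSpace ℝ (Fin (n + 1))) :
    EuclideanSpace ℝ (Fin (n + 1)) →L[ℝ] ℝ :=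
  ((g.modelMetric ((extChartAt (𝓡 (n + 1)) x₀).symm y)).flip
    (g.modelTime ((extChartAt (𝓡 (n + 1)) x₀).symm y))).comp (chartFrame x₀ y)

theorem chartMetric_apply (g : SpacetimeStructure n M) (x₀ : M)
    (y u v : EuclideanSpace ℝ (Fin (n + 1))) :
    g.chartMetric x₀ y u v = g.modelMetric ((extChartAt (𝓡 (n + 1)) x₀).symm y) (chartFrame x₀ y u) (chartFrame x₀ y v) := rfl

theorem metricInChart_eq (g : SpacetimeStructure n M) (x₀ : M)
    (y u v : EuclideanSpace ℝ (Fin (n + 1))) :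
    g.metricInChart x₀ y u v = g.chartMetric x₀ y u v := rfl

theorem chartTime_apply (g : SpacetimeStructure n M) (x₀ : M)
    (y u : EuclideanSpace ℝ (Fin (n + 1))) :
    g.chartTime x₀ y u = g.modelMetric ((extChartAt (𝓡 (n + 1)) x₀).symm y) (chartFrame x₀ y u)
        (g.modelTime ((extChartAt (𝓡 (n + 1)) x₀).symm y)) := rfl

theorem chartMetric_symm (g : SpacetimeStructure n M) (x₀ : M)
    (y u v : EuclideanSpace ℝ (Fin (n + 1))) :
    g.chartMetric x₀ y u v = g.chartMetric x₀ y v u := g.metric_symm _ _ _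

/-- The field is the tangent map of the smooth inverse chart composed with the constant section u.
-/
theorem contMDiffOn_chartFrame (x₀ : M) (u : EuclideanSpace ℝ (Fin (n + 1))) :
    ContMDiffOn 𝓘(ℝ, EuclideanSpace ℝ (Fin (n + 1))) (𝓡 (n + 1)).tangent ∞
      (fun y ↦ (⟨(extChartAt (𝓡 (n + 1)) x₀).symm y, chartFrame x₀ y u⟩ :
        TangentBundle (𝓡 (n + 1)) M)) (extChartAt (𝓡 (n + 1)) x₀).target := by
  have hopen : IsOpen (extChartAt (𝓡 (n + 1)) x₀).target := isOpen_extChartAt_target x₀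
  have h1 := (contMDiffOn_extChartAt_symm (I := 𝓡 (n + 1)) (n := ∞)
    x₀).contMDiffOn_tangentMapWithin (m := ∞) le_rfl hopen.uniqueMDiffOn
  have h2 : ContMDiffOn 𝓘(ℝ, EuclideanSpace ℝ (Fin (n + 1)))
      (𝓘(ℝ, EuclideanSpace ℝ (Fin (n + 1)))).tangent ∞
      (fun y ↦ (⟨y, u⟩ : TangentBundle 𝓘(ℝ, EuclideanSpace ℝ (Fin (n + 1)))
        (EuclideanSpace ℝ (Fin (n + 1))))) (extChartAt (𝓡 (n + 1)) x₀).target := by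
    apply ContMDiff.contMDiffOn
    intro y
    refine (contMDiffAt_section (IB := 𝓘(ℝ, EuclideanSpace ℝ (Fin (n + 1))))
      (F := EuclideanSpace ℝ (Fin (n + 1)))
      (E := TangentSpace 𝓘(ℝ, EuclideanSpace ℝ (Fin (n + 1)))) (s := fun _ ↦ u) y).2 ?_
    simpa using! contMDiffAt_const
  have h3 := h1.comp h2 (fun y hy ↦ hy)
  refine h3.congr fun y hy ↦ ?_
  simp only [Function.comp, tangentMapWithin, chartFrame]
  rw [mfderivWithin_of_isOpen hopen hy]
  rfl

/-- In finite dimension smoothness of a field of forms can be tested on constant vectors, where it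
is the bundle metric applied to the smooth fields of `contMDiffOn_chartFrame`. -/
theorem contDiffOn_chartMetric (g : SpacetimeStructure n M) (x₀ : M) :
    ContDiffOn ℝ ∞ (g.chartMetric x₀) (extChartAt (𝓡 (n + 1)) x₀).target := by
  rw [contDiffOn_clm_apply]
  intro u
  rw [contDiffOn_clm_apply]
  intro v
  rw [← contMDiffOn_iff_contDiffOn]
  have hb := contMDiffOn_extChartAt_symm (I := 𝓡 (n + 1)) (n := ∞) x₀
  have h : ContMDiffOn 𝓘(ℝ, EuclideanSpace ℝ (Fin (n + 1))) ((𝓡 (n + 1)).prod 𝓘(ℝ)) ∞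
      (fun y ↦ TotalSpace.mk' ℝ (E := Bundle.Trivial M ℝ) ((extChartAt (𝓡 (n + 1)) x₀).symm y)
        (g.modelMetric ((extChartAt (𝓡 (n + 1)) x₀).symm y) (chartFrame x₀ y u) (chartFrame x₀ y v)))
      (extChartAt (𝓡 (n + 1)) x₀).target := by
    apply ContMDiffOn.clm_bundle_apply₂ (F₁ := EuclideanSpace ℝ (Fin (n + 1)))
      (F₂ := EuclideanSpace ℝ (Fin (n + 1)))
    · exact g.metric_smooth.comp_contMDiffOn hb
    · exact contMDiffOn_chartFrame x₀ u
    · exact contMDiffOn_chartFrame x₀ v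
  intro y hy
  have := h y hy
  rw [contMDiffWithinAt_totalSpace] at this
  exact this.2

theorem continuousOn_chartTime (g : SpacetimeStructure n M) (x₀ : M) :
    ContinuousOn (g.chartTime x₀) (extChartAt (𝓡 (n + 1)) x₀).target := by
  rw [continuousOn_clm_apply]
  intro u
  have hb := contMDiffOn_extChartAt_symm (I := 𝓡 (n + 1)) (n := ∞) x₀
  have h : ContMDiffOn 𝓘(ℝ, EuclideanSpace ℝ (Fin (n + 1))) ((𝓡 (n + 1)).prod 𝓘(ℝ)) ∞
      (fun y ↦ TotalSpace.mk' ℝ (E := Bundle.Trivial M ℝ) ((extChartAt (𝓡 (n + 1)) x₀).symm y)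
        (g.modelMetric ((extChartAt (𝓡 (n + 1)) x₀).symm y) (chartFrame x₀ y u)
        (g.modelTime ((extChartAt (𝓡 (n + 1)) x₀).symm y))))
      (extChartAt (𝓡 (n + 1)) x₀).target := by
    apply ContMDiffOn.clm_bundle_apply₂ (F₁ := EuclideanSpace ℝ (Fin (n + 1)))
      (F₂ := EuclideanSpace ℝ (Fin (n + 1)))
    · exact g.metric_smooth.comp_contMDiffOn hb
    · exact contMDiffOn_chartFrame x₀ u
    · exact g.timeField_smooth.comp_contMDiffOn hb
  intro y hy
  have := h y hy
  rw [contMDiffWithinAt_totalSpace] at this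
  exact this.2.continuousWithinAt

theorem chartFrame_bijective (x₀ : M) {y : EuclideanSpace ℝ (Fin (n + 1))}
    (hy : y ∈ (extChartAt (𝓡 (n + 1)) x₀).target) : Function.Bijective (chartFrame x₀ y) := by
  have h := isInvertible_mfderivWithin_extChartAt_symm (I := 𝓡 (n + 1)) (x := x₀) hy
  rw [ModelWithCorners.range_eq_univ, mfderivWithin_univ] at h
  exact h.bijective

/-- The chart components of the time orientation. -/
theorem exists_chartTime_eq (g : SpacetimeStructure n M) (x₀ : M)
    {y : EuclideanSpace ℝ (Fin (n + 1))} (hy : y ∈ (extChartAt (𝓡 (n + 1)) x₀).target) :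
    ∃ T, g.chartTime x₀ y = g.chartMetric x₀ y T ∧ g.chartMetric x₀ y T T < 0 ∧
      ∀ w, g.chartMetric x₀ y T w = 0 → w ≠ 0 → 0 < g.chartMetric x₀ y w w := by
  obtain ⟨T, hT⟩ := (chartFrame_bijective x₀ hy).2 (g.timeField _)
  have hTT : g.chartMetric x₀ y T T < 0 := by
    rw [chartMetric_apply, hT]
    exact g.timeField_timelike _
  refine ⟨T, ?_, hTT, ?_⟩
  · ext u
    rw [chartTime_apply, chartMetric_apply, hT]
    exact g.metric_symm _ _ _
  obtain ⟨v', hv', hpos⟩ := g.metric_signature ((extChartAt (𝓡 (n + 1)) x₀).symm y)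
  obtain ⟨v, rfl⟩ := (chartFrame_bijective x₀ hy).2 v'
  let B : EuclideanSpace ℝ (Fin (n + 1)) →ₗ[ℝ] EuclideanSpace ℝ (Fin (n + 1)) →ₗ[ℝ] ℝ :=
    LinearMap.mk₂ ℝ (fun u v ↦ g.chartMetric x₀ y u v) (by simp) (by simp) (by simp) (by simp)
  intro w hw hw0
  refine pos_of_orthogonal_timelike B (fun u v ↦ g.chartMetric_symm x₀ y u v) (v := v) hv' ?_
    hTT hw hw0
  intro w' hw' hw'0
  refine hpos _ hw' fun h ↦ hw'0 ?_
  exact (chartFrame_bijective x₀ hy).1 (h.trans (map_zero _).symm)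

/-! ### Curves in a chart -/

/-- The velocity of a curve, with the tangent space read as the model space. -/
def modelVelocity (γ : ℝ → M) (D : Set ℝ) (t : ℝ) : EuclideanSpace ℝ (Fin (n + 1)) :=
  velocity (n := n) γ D t

theorem modelVelocity_congr {γ γ' : ℝ → M} {D : Set ℝ} {t : ℝ} (h : γ =ᶠ[𝓝[D] t] γ')
    (ht : γ t = γ' t) : modelVelocity (n := n) γ D t = modelVelocity γ' D t := by
  have h1 := h.mfderivWithin_eq (I := 𝓘(ℝ, ℝ)) (I' := 𝓡 (n + 1)) ht
  unfold modelVelocity velocity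
  erw [h1]
  rfl

/-- Chain rule for γ = φ⁻¹ ∘ (φ ∘ γ). It lets the causal character of a curve be read off
`chartMetric` and `chartTime` on coordinate velocities. -/
theorem modelVelocity_eq_chartFrame (x₀ : M) {γ : ℝ → M} {D : Set ℝ}
    {t : ℝ} {v : EuclideanSpace ℝ (Fin (n + 1))} (hD : UniqueDiffWithinAt ℝ D t)
    (hγ : ContinuousWithinAt γ D t) (ht : γ t ∈ (extChartAt (𝓡 (n + 1)) x₀).source)
    (hc : HasDerivWithinAt (fun s ↦ extChartAt (𝓡 (n + 1)) x₀ (γ s)) v D t) :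
    modelVelocity (n := n) γ D t = chartFrame x₀ (extChartAt (𝓡 (n + 1)) x₀ (γ t)) v := by
  have hopen : IsOpen (extChartAt (𝓡 (n + 1)) x₀).target := isOpen_extChartAt_target x₀
  have hmem := (extChartAt (𝓡 (n + 1)) x₀).map_source ht
  have h1 : MDifferentiableAt 𝓘(ℝ, EuclideanSpace ℝ (Fin (n + 1))) (𝓡 (n + 1))
      (extChartAt (𝓡 (n + 1)) x₀).symm (extChartAt (𝓡 (n + 1)) x₀ (γ t)) :=
    ((contMDiffOn_extChartAt_symm (I := 𝓡 (n + 1)) (n := ∞) x₀).contMDiffAt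
      (hopen.mem_nhds hmem)).mdifferentiableAt (by simp)
  have h2 := hc.hasFDerivWithinAt.hasMFDerivWithinAt
  have h3 := HasMFDerivAt.comp_hasMFDerivWithinAt t h1.hasMFDerivAt h2
  have h4 := h3.mfderivWithin hD.uniqueMDiffWithinAt
  have h5 : γ =ᶠ[𝓝[D] t] (extChartAt (𝓡 (n + 1)) x₀).symm ∘
      fun s ↦ extChartAt (𝓡 (n + 1)) x₀ (γ s) := by
    filter_upwards [hγ ((isOpen_extChartAt_source x₀).mem_nhds ht)] with s hs
    exact ((extChartAt (𝓡 (n + 1)) x₀).left_inv hs).symm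
  rw [modelVelocity_congr h5 ((extChartAt (𝓡 (n + 1)) x₀).left_inv ht).symm]
  unfold modelVelocity velocity
  erw [h4]
  change chartFrame x₀ _ ((1 : ℝ) • v) = _
  rw [one_smul]

theorem futureTimelike_velocity_iff (g : SpacetimeStructure n M) (x₀ : M) {γ : ℝ → M} {D : Set ℝ}
    {t : ℝ} {v : EuclideanSpace ℝ (Fin (n + 1))} (hD : UniqueDiffWithinAt ℝ D t)
    (hγ : ContinuousWithinAt γ D t) (ht : γ t ∈ (extChartAt (𝓡 (n + 1)) x₀).source)
    (hc : HasDerivWithinAt (fun s ↦ extChartAt (𝓡 (n + 1)) x₀ (γ s)) v D t) :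
    g.FutureTimelike (velocity γ D t) ↔
      g.chartMetric x₀ (extChartAt (𝓡 (n + 1)) x₀ (γ t)) v v < 0 ∧
        g.chartTime x₀ (extChartAt (𝓡 (n + 1)) x₀ (γ t)) v < 0 := by
  rw [chartMetric_apply, chartTime_apply, (extChartAt (𝓡 (n + 1)) x₀).left_inv ht,
    ← modelVelocity_eq_chartFrame x₀ hD hγ ht hc]
  rfl

theorem futureCausal_velocity_iff (g : SpacetimeStructure n M) (x₀ : M) {γ : ℝ → M} {D : Set ℝ}
    {t : ℝ} {v : EuclideanSpace ℝ (Fin (n + 1))} (hD : UniqueDiffWithinAt ℝ D t)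
    (hγ : ContinuousWithinAt γ D t) (ht : γ t ∈ (extChartAt (𝓡 (n + 1)) x₀).source)
    (hc : HasDerivWithinAt (fun s ↦ extChartAt (𝓡 (n + 1)) x₀ (γ s)) v D t) :
    g.FutureCausal (velocity γ D t) ↔ v ≠ 0 ∧
      g.chartMetric x₀ (extChartAt (𝓡 (n + 1)) x₀ (γ t)) v v ≤ 0 ∧
        g.chartTime x₀ (extChartAt (𝓡 (n + 1)) x₀ (γ t)) v < 0 := by
  have hne : v ≠ 0 ↔ modelVelocity (n := n) γ D t ≠ 0 := by
    rw [modelVelocity_eq_chartFrame x₀ hD hγ ht hc]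
    exact ((map_ne_zero_iff _ (chartFrame_bijective x₀
      ((extChartAt (𝓡 (n + 1)) x₀).map_source ht)).1)).symm
  rw [chartMetric_apply, chartTime_apply, (extChartAt (𝓡 (n + 1)) x₀).left_inv ht, hne,
    ← modelVelocity_eq_chartFrame x₀ hD hγ ht hc]
  rfl

theorem FutureNull.futureCausal {g : SpacetimeStructure n M} {x : M}
    {v : TangentSpace (𝓡 (n + 1)) x} (h : g.FutureNull v) : g.FutureCausal v :=
  ⟨h.1, h.2.1.le, h.2.2⟩

theorem FutureTimelike.futureCausal {g : SpacetimeStructure n M} {x : M}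
    {v : TangentSpace (𝓡 (n + 1)) x} (h : g.FutureTimelike v) : g.FutureCausal v :=
  ⟨fun h0 ↦ by simp [h0, FutureTimelike] at h, h.1.le, h.2⟩

theorem futureNull_velocity_iff (g : SpacetimeStructure n M) (x₀ : M) {γ : ℝ → M} {D : Set ℝ}
    {t : ℝ} {v : EuclideanSpace ℝ (Fin (n + 1))} (hD : UniqueDiffWithinAt ℝ D t)
    (hγ : ContinuousWithinAt γ D t) (ht : γ t ∈ (extChartAt (𝓡 (n + 1)) x₀).source)
    (hc : HasDerivWithinAt (fun s ↦ extChartAt (𝓡 (n + 1)) x₀ (γ s)) v D t) :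
    g.FutureNull (velocity γ D t) ↔ v ≠ 0 ∧
      g.chartMetric x₀ (extChartAt (𝓡 (n + 1)) x₀ (γ t)) v v = 0 ∧
        g.chartTime x₀ (extChartAt (𝓡 (n + 1)) x₀ (γ t)) v < 0 := by
  have hne : v ≠ 0 ↔ modelVelocity (n := n) γ D t ≠ 0 := by
    rw [modelVelocity_eq_chartFrame x₀ hD hγ ht hc]
    exact ((map_ne_zero_iff _ (chartFrame_bijective x₀
      ((extChartAt (𝓡 (n + 1)) x₀).map_source ht)).1)).symm
  rw [chartMetric_apply, chartTime_apply, (extChartAt (𝓡 (n + 1)) x₀).left_inv ht, hne,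
    ← modelVelocity_eq_chartFrame x₀ hD hγ ht hc]
  rfl

theorem contMDiffOn_chart_curve (x₀ : M) {c : ℝ → EuclideanSpace ℝ (Fin (n + 1))} {D : Set ℝ}
    (hc : ContDiffOn ℝ ∞ c D) (hD : MapsTo c D (extChartAt (𝓡 (n + 1)) x₀).target) :
    ContMDiffOn 𝓘(ℝ, ℝ) (𝓡 (n + 1)) ∞ (fun s ↦ (extChartAt (𝓡 (n + 1)) x₀).symm (c s)) D :=
  (contMDiffOn_extChartAt_symm (I := 𝓡 (n + 1)) (n := ∞) x₀).comp hc.contMDiffOn hD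

theorem contDiffOn_extChartAt_comp (x₀ : M) {γ : ℝ → M} {D : Set ℝ}
    (hγ : ContMDiffOn 𝓘(ℝ, ℝ) (𝓡 (n + 1)) ∞ γ D)
    (hD : MapsTo γ D (extChartAt (𝓡 (n + 1)) x₀).source) :
    ContDiffOn ℝ ∞ (fun s ↦ extChartAt (𝓡 (n + 1)) x₀ (γ s)) D := by
  rw [← contMDiffOn_iff_contDiffOn]
  refine (contMDiffOn_extChartAt (I := 𝓡 (n + 1)) (n := ∞) (x := x₀)).comp hγ ?_
  rwa [← extChartAt_source (𝓡 (n + 1)) x₀]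

end SpacetimeStructure

namespace SpacetimeStructure

variable {n : ℕ} {M : Type*} [TopologicalSpace M]
  [ChartedSpace (EuclideanSpace ℝ (Fin (n + 1))) M] [IsManifold (𝓡 (n + 1)) ∞ M]

/-! ### Smooth curves read in a chart -/

theorem hasDerivWithinAt_chart (x₀ : M) {γ : ℝ → M} {D : Set ℝ} {t : ℝ}
    (hγ : ContMDiffOn 𝓘(ℝ, ℝ) (𝓡 (n + 1)) ∞ γ D) (ht : t ∈ D)
    (hs : γ t ∈ (extChartAt (𝓡 (n + 1)) x₀).source) :
    HasDerivWithinAt (fun s ↦ extChartAt (𝓡 (n + 1)) x₀ (γ s))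
      (derivWithin (fun s ↦ extChartAt (𝓡 (n + 1)) x₀ (γ s)) D t) D t := by
  have h1 := (contMDiffAt_extChartAt' (I := 𝓡 (n + 1)) (n := ∞)
    (by rwa [← extChartAt_source (𝓡 (n + 1)) x₀])).comp_contMDiffWithinAt t (hγ t ht)
  rw [contMDiffWithinAt_iff_contDiffWithinAt] at h1
  exact (h1.differentiableWithinAt (by simp)).hasDerivWithinAt

theorem isSmoothFutureTimelike_of_chart (g : SpacetimeStructure n M) (x₀ : M)
    {c : ℝ → EuclideanSpace ℝ (Fin (n + 1))} {a b : ℝ} (hab : a < b)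
    (hc : ContDiffOn ℝ ∞ c (Icc a b)) (hD : MapsTo c (Icc a b) (extChartAt (𝓡 (n + 1)) x₀).target)
    (h : ∀ t ∈ Icc a b, ∃ v, HasDerivWithinAt c v (Icc a b) t ∧
      g.chartMetric x₀ (c t) v v < 0 ∧ g.chartTime x₀ (c t) v < 0) :
    g.IsSmoothFutureTimelike (fun s ↦ (extChartAt (𝓡 (n + 1)) x₀).symm (c s)) a b := by
  have hs := contMDiffOn_chart_curve x₀ hc hD
  refine ⟨hab, hs, fun t ht ↦ ?_⟩
  obtain ⟨v, hv, h1, h2⟩ := h t ht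
  have he : ∀ s ∈ Icc a b, extChartAt (𝓡 (n + 1)) x₀ ((extChartAt (𝓡 (n + 1)) x₀).symm (c s))
      = c s := fun s hs ↦ (extChartAt (𝓡 (n + 1)) x₀).right_inv (hD hs)
  rw [futureTimelike_velocity_iff g x₀ (uniqueDiffOn_Icc hab t ht) (hs.continuousOn t ht)
    ((extChartAt (𝓡 (n + 1)) x₀).map_target (hD ht)) (hv.congr he (he t ht)), he t ht]
  exact ⟨h1, h2⟩

theorem isSmoothFutureCausal_of_chart (g : SpacetimeStructure n M) (x₀ : M)
    {c : ℝ → EuclideanSpace ℝ (Fin (n + 1))} {a b : ℝ} (hab : a < b)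
    (hc : ContDiffOn ℝ ∞ c (Icc a b)) (hD : MapsTo c (Icc a b) (extChartAt (𝓡 (n + 1)) x₀).target)
    (h : ∀ t ∈ Icc a b, ∃ v, HasDerivWithinAt c v (Icc a b) t ∧ v ≠ 0 ∧
      g.chartMetric x₀ (c t) v v ≤ 0 ∧ g.chartTime x₀ (c t) v < 0) :
    g.IsSmoothFutureCausal (fun s ↦ (extChartAt (𝓡 (n + 1)) x₀).symm (c s)) a b := by
  have hs := contMDiffOn_chart_curve x₀ hc hD
  refine ⟨hab, hs, fun t ht ↦ ?_⟩
  obtain ⟨v, hv, h1⟩ := h t ht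
  have he : ∀ s ∈ Icc a b, extChartAt (𝓡 (n + 1)) x₀ ((extChartAt (𝓡 (n + 1)) x₀).symm (c s))
      = c s := fun s hs ↦ (extChartAt (𝓡 (n + 1)) x₀).right_inv (hD hs)
  rw [futureCausal_velocity_iff g x₀ (uniqueDiffOn_Icc hab t ht) (hs.continuousOn t ht)
    ((extChartAt (𝓡 (n + 1)) x₀).map_target (hD ht)) (hv.congr he (he t ht)), he t ht]
  exact h1

theorem IsSmoothFutureTimelike.chart {g : SpacetimeStructure n M} (x₀ : M) {γ : ℝ → M} {a b t : ℝ}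
    (h : g.IsSmoothFutureTimelike γ a b) (ht : t ∈ Icc a b)
    (hs : γ t ∈ (extChartAt (𝓡 (n + 1)) x₀).source) :
    ∃ v, HasDerivWithinAt (fun s ↦ extChartAt (𝓡 (n + 1)) x₀ (γ s)) v (Icc a b) t ∧
      g.chartMetric x₀ (extChartAt (𝓡 (n + 1)) x₀ (γ t)) v v < 0 ∧
        g.chartTime x₀ (extChartAt (𝓡 (n + 1)) x₀ (γ t)) v < 0 := by
  have hd := hasDerivWithinAt_chart x₀ h.2.1 ht hs
  exact ⟨_, hd, (futureTimelike_velocity_iff g x₀ (uniqueDiffOn_Icc h.1 t ht)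
    (h.2.1.continuousOn t ht) hs hd).1 (h.2.2 t ht)⟩

theorem IsSmoothFutureCausal.chart {g : SpacetimeStructure n M} (x₀ : M) {γ : ℝ → M} {a b t : ℝ}
    (h : g.IsSmoothFutureCausal γ a b) (ht : t ∈ Icc a b)
    (hs : γ t ∈ (extChartAt (𝓡 (n + 1)) x₀).source) :
    ∃ v, HasDerivWithinAt (fun s ↦ extChartAt (𝓡 (n + 1)) x₀ (γ s)) v (Icc a b) t ∧ v ≠ 0 ∧
      g.chartMetric x₀ (extChartAt (𝓡 (n + 1)) x₀ (γ t)) v v ≤ 0 ∧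
        g.chartTime x₀ (extChartAt (𝓡 (n + 1)) x₀ (γ t)) v < 0 := by
  have hd := hasDerivWithinAt_chart x₀ h.2.1 ht hs
  exact ⟨_, hd, (futureCausal_velocity_iff g x₀ (uniqueDiffOn_Icc h.1 t ht)
    (h.2.1.continuousOn t ht) hs hd).1 (h.2.2 t ht)⟩

/-! ### Restricting, shifting and joining curves -/

theorem IsSmoothFutureTimelike.isSmoothFutureCausal {g : SpacetimeStructure n M} {γ : ℝ → M}
    {a b : ℝ} (h : g.IsSmoothFutureTimelike γ a b) : g.IsSmoothFutureCausal γ a b :=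
  ⟨h.1, h.2.1, fun t ht ↦ (h.2.2 t ht).futureCausal⟩

theorem futureTimelike_iff_model (g : SpacetimeStructure n M) (γ : ℝ → M) (D : Set ℝ) (t : ℝ) :
    g.FutureTimelike (velocity γ D t) ↔
      g.modelMetric (γ t) (modelVelocity γ D t) (modelVelocity γ D t) < 0 ∧
        g.modelMetric (γ t) (modelVelocity γ D t) (g.modelTime (γ t)) < 0 := Iff.rfl

theorem futureCausal_iff_model (g : SpacetimeStructure n M) (γ : ℝ → M) (D : Set ℝ) (t : ℝ) :
    g.FutureCausal (velocity γ D t) ↔ modelVelocity (n := n) γ D t ≠ 0 ∧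
      g.modelMetric (γ t) (modelVelocity γ D t) (modelVelocity γ D t) ≤ 0 ∧
        g.modelMetric (γ t) (modelVelocity γ D t) (g.modelTime (γ t)) < 0 := Iff.rfl

theorem modelVelocity_subset {γ : ℝ → M} {s D : Set ℝ} {t : ℝ} (hs : s ⊆ D)
    (hu : UniqueDiffWithinAt ℝ s t) (h : ContMDiffOn 𝓘(ℝ, ℝ) (𝓡 (n + 1)) ∞ γ D) (ht : t ∈ D) :
    modelVelocity (n := n) γ s t = modelVelocity γ D t := by
  have h1 := mfderivWithin_subset (I := 𝓘(ℝ, ℝ)) (I' := 𝓡 (n + 1)) hs hu.uniqueMDiffWithinAt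
    ((h t ht).mdifferentiableWithinAt (by simp))
  unfold modelVelocity velocity
  rw [h1]

theorem IsSmoothFutureTimelike.mono {g : SpacetimeStructure n M} {γ : ℝ → M} {a b a' b' : ℝ}
    (h : g.IsSmoothFutureTimelike γ a b) (ha : a ≤ a') (hab : a' < b') (hb : b' ≤ b) :
    g.IsSmoothFutureTimelike γ a' b' := by
  have hs : Icc a' b' ⊆ Icc a b := Icc_subset_Icc ha hb
  refine ⟨hab, h.2.1.mono hs, fun t ht ↦ ?_⟩
  rw [futureTimelike_iff_model, modelVelocity_subset hs (uniqueDiffOn_Icc hab t ht) h.2.1 (hs ht)]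
  exact h.2.2 t (hs ht)

theorem IsSmoothFutureCausal.mono {g : SpacetimeStructure n M} {γ : ℝ → M} {a b a' b' : ℝ}
    (h : g.IsSmoothFutureCausal γ a b) (ha : a ≤ a') (hab : a' < b') (hb : b' ≤ b) :
    g.IsSmoothFutureCausal γ a' b' := by
  have hs : Icc a' b' ⊆ Icc a b := Icc_subset_Icc ha hb
  refine ⟨hab, h.2.1.mono hs, fun t ht ↦ ?_⟩
  rw [futureCausal_iff_model, modelVelocity_subset hs (uniqueDiffOn_Icc hab t ht) h.2.1 (hs ht)]
  exact h.2.2 t (hs ht)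

theorem IsSmoothFutureTimelike.congr {g : SpacetimeStructure n M} {γ γ' : ℝ → M} {a b : ℝ}
    (h : g.IsSmoothFutureTimelike γ a b) (he : EqOn γ' γ (Icc a b)) :
    g.IsSmoothFutureTimelike γ' a b := by
  refine ⟨h.1, h.2.1.congr he, fun t ht ↦ ?_⟩
  rw [futureTimelike_iff_model,
    modelVelocity_congr (eventually_of_mem self_mem_nhdsWithin he) (he ht), he ht]
  exact h.2.2 t ht

theorem IsSmoothFutureTimelike.shift {g : SpacetimeStructure n M} {γ : ℝ → M} {a b : ℝ}
    (h : g.IsSmoothFutureTimelike γ a b) (d : ℝ) :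
    g.IsSmoothFutureTimelike (fun t ↦ γ (t + d)) (a - d) (b - d) := by
  have hmaps : MapsTo (fun t : ℝ ↦ t + d) (Icc (a - d) (b - d)) (Icc a b) := fun t ht ↦
    ⟨by linarith [ht.1], by linarith [ht.2]⟩
  have hsm : ContMDiffOn 𝓘(ℝ, ℝ) 𝓘(ℝ, ℝ) ∞ (fun t : ℝ ↦ t + d) (Icc (a - d) (b - d)) :=
    (contDiff_id.add contDiff_const).contDiffOn.contMDiffOn
  have hab : a - d < b - d := by linarith [h.1]
  refine ⟨hab, h.2.1.comp hsm hmaps, fun t ht ↦ ?_⟩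
  have key : modelVelocity (n := n) (fun t ↦ γ (t + d)) (Icc (a - d) (b - d)) t
      = modelVelocity γ (Icc a b) (t + d) := by
    have h1 : HasMFDerivWithinAt 𝓘(ℝ, ℝ) 𝓘(ℝ, ℝ) (fun t : ℝ ↦ t + d) (Icc (a - d) (b - d)) t
        (ContinuousLinearMap.id ℝ ℝ) :=
      ((hasFDerivAt_id t).add_const d).hasFDerivWithinAt.hasMFDerivWithinAt
    have h2 := ((h.2.1 _ (hmaps ht)).mdifferentiableWithinAt (by simp)).hasMFDerivWithinAt
    have h3 := HasMFDerivWithinAt.comp (f := fun t : ℝ ↦ t + d) (g := γ) t h2 h1 hmaps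
    have h4 := h3.mfderivWithin (uniqueDiffOn_Icc hab t ht).uniqueMDiffWithinAt
    unfold modelVelocity velocity
    erw [h4]
    rfl
  rw [futureTimelike_iff_model, key]
  exact h.2.2 _ (hmaps ht)

theorem IsFutureCausalCurve.lt {g : SpacetimeStructure n M} {γ : ℝ → M} {a b : ℝ}
    (h : g.IsFutureCausalCurve γ a b) : a < b := by
  induction h with
  | single h => exact h.1
  | tail _ h ih => exact ih.trans h.1

theorem IsFutureTimelikeCurve.isFutureCausalCurve {g : SpacetimeStructure n M} {γ : ℝ → M}
    {a b : ℝ} (h : g.IsFutureTimelikeCurve γ a b) : g.IsFutureCausalCurve γ a b :=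
  Relation.TransGen.mono (fun _ _ h ↦ IsSmoothFutureTimelike.isSmoothFutureCausal h) _ _ h

theorem IsFutureTimelikeCurve.lt {g : SpacetimeStructure n M} {γ : ℝ → M} {a b : ℝ}
    (h : g.IsFutureTimelikeCurve γ a b) : a < b :=
  h.isFutureCausalCurve.lt

theorem IsFutureCausalCurve.continuousOn {g : SpacetimeStructure n M} {γ : ℝ → M} {a b : ℝ}
    (h : g.IsFutureCausalCurve γ a b) : ContinuousOn γ (Icc a b) := by
  induction h with
  | single h => exact h.2.1.continuousOn
  | tail h1 h2 ih =>
    rw [← Icc_union_Icc_eq_Icc (IsFutureCausalCurve.lt h1).le h2.1.le]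
    exact ih.union_of_isClosed h2.2.1.continuousOn isClosed_Icc isClosed_Icc

theorem IsFutureTimelikeCurve.congr {g : SpacetimeStructure n M} {γ γ' : ℝ → M} {a b : ℝ}
    (h : g.IsFutureTimelikeCurve γ a b) (he : EqOn γ' γ (Icc a b)) :
    g.IsFutureTimelikeCurve γ' a b := by
  induction h with
  | single h => exact .single (h.congr he)
  | tail h1 h2 ih =>
    have := IsFutureTimelikeCurve.lt h1
    exact .tail (ih (he.mono (Icc_subset_Icc le_rfl h2.1.le)))
      (h2.congr (he.mono (Icc_subset_Icc this.le le_rfl)))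

/-- `q` is reached from `p` by one smooth future-directed timelike curve in `U`. -/
def TimelikeStep (g : SpacetimeStructure n M) (U : Set M) (p q : M) : Prop :=
  ∃ (γ : ℝ → M) (a b : ℝ), g.IsSmoothFutureTimelike γ a b ∧ γ a = p ∧ γ b = q ∧
    ∀ t ∈ Icc a b, γ t ∈ U

/-- Turns concatenation of curves, whose parameter intervals need not match, into transitivity of a
relation between points. -/
theorem mem_chronFutureIn_iff (g : SpacetimeStructure n M) {U : Set M} {p q : M} :
    q ∈ g.chronFutureIn p U ↔ Relation.TransGen (g.TimelikeStep U) p q := by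
  constructor
  · rintro ⟨γ, a, b, h, rfl, rfl, hU⟩
    induction h with
    | single h => exact .single ⟨γ, _, _, h, rfl, rfl, hU⟩
    | tail h1 h2 ih =>
      have := IsFutureTimelikeCurve.lt h1
      exact .tail (ih fun t ht ↦ hU t ⟨ht.1, ht.2.trans h2.1.le⟩)
        ⟨γ, _, _, h2, rfl, rfl, fun t ht ↦ hU t ⟨this.le.trans ht.1, ht.2⟩⟩
  · intro h
    induction h with
    | single h =>
      obtain ⟨γ, a, b, h, h1, h2, h3⟩ := h
      exact ⟨γ, a, b, .single h, h1, h2, h3⟩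
    | tail _ h2 ih =>
      obtain ⟨γ, a, b, h, rfl, hb, hU⟩ := ih
      obtain ⟨σ, c, d, h', hc, rfl, hU'⟩ := h2
      -- The new piece is translated so that its parameter interval starts at b, where the old curve
      -- ends.
      have h'' := h'.shift (c - b)
      have e1 : c - (c - b) = b := by ring
      rw [e1] at h''
      classical
      refine ⟨fun t ↦ if t ≤ b then γ t else σ (t + (c - b)), a, d - (c - b), ?_, ?_, ?_, ?_⟩
      · refine Relation.TransGen.tail (b := b) (h.congr fun t ht ↦ if_pos ht.2)
          (h''.congr fun t ht ↦ ?_)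
        by_cases htb : t ≤ b
        · have : t = b := le_antisymm htb ht.1
          subst this
          simp [hc, hb]
        · simp [htb]
      · simp [h.lt.le]
      · have : ¬ (d - (c - b) ≤ b) := by linarith [h'.1]
        simp [this]
      · intro t ht
        by_cases htb : t ≤ b
        · simpa [htb] using hU t ⟨ht.1, htb⟩
        · simp only [htb, if_false]
          exact hU' _ ⟨by linarith, by linarith [ht.2]⟩

theorem chronFutureIn_trans (g : SpacetimeStructure n M) {U : Set M} {p q r : M}
    (h : q ∈ g.chronFutureIn p U) (h' : r ∈ g.chronFutureIn q U) : r ∈ g.chronFutureIn p U := by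
  rw [mem_chronFutureIn_iff] at *
  exact h.trans h'

theorem chronFutureIn_mono (g : SpacetimeStructure n M) {U V : Set M} (hUV : U ⊆ V) {p q : M}
    (h : q ∈ g.chronFutureIn p U) : q ∈ g.chronFutureIn p V := by
  obtain ⟨γ, a, b, h1, h2, h3, h4⟩ := h
  exact ⟨γ, a, b, h1, h2, h3, fun t ht ↦ hUV (h4 t ht)⟩

theorem causalFutureIn_mono (g : SpacetimeStructure n M) {U V : Set M} (hUV : U ⊆ V) {p q : M}
    (h : q ∈ g.causalFutureIn p U) : q ∈ g.causalFutureIn p V := by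
  rcases h with h | ⟨γ, a, b, h1, h2, h3, h4⟩
  · exact Or.inl h
  · exact Or.inr ⟨γ, a, b, h1, h2, h3, fun t ht ↦ hUV (h4 t ht)⟩

theorem causalFutureIn_subset (g : SpacetimeStructure n M) {U : Set M} {p : M} (hp : p ∈ U) :
    g.causalFutureIn p U ⊆ U := by
  rintro q (rfl | ⟨γ, a, b, h1, -, rfl, h4⟩)
  · exact hp
  · exact h4 b (right_mem_Icc.2 h1.lt.le)

theorem IsSmoothFutureTimelike.mem_chronFutureIn {g : SpacetimeStructure n M} {γ : ℝ → M}
    {a b : ℝ} (h : g.IsSmoothFutureTimelike γ a b) : γ b ∈ g.chronFutureIn (γ a) univ :=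
  ⟨γ, a, b, .single h, rfl, rfl, fun _ _ ↦ mem_univ _⟩

theorem chronPast_of_chronFutureIn (g : SpacetimeStructure n M) {A : Set M} {p q : M}
    (h : q ∈ g.chronFutureIn p univ) (hq : q ∈ g.chronPast A) : p ∈ g.chronPast A := by
  obtain ⟨r, hr, hqr⟩ := hq
  exact ⟨r, hr, g.chronFutureIn_trans h hqr⟩

end SpacetimeStructure

/-! ### Lorentzian patches -/

/-- A field `G` of Lorentzian forms on the ball of radius `r` about `y₀`, time-oriented by the
covector field `θ`, with uniform estimates in terms of a unit timelike vector `T` at `y₀` and the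
dual time function `ℓ`. -/
structure IsLorentzPatch {E : Type*} [NormedAddCommGroup E] [NormedSpace ℝ E]
    (G : E → E →L[ℝ] E →L[ℝ] ℝ) (θ : E → E →L[ℝ] ℝ) (y₀ T : E) (ℓ : E →L[ℝ] ℝ)
    (r c K : ℝ) : Prop where
  r_pos : 0 < r
  c_pos : 0 < c
  K_pos : 0 < K
  smooth : ContDiffOn ℝ ∞ G (Metric.ball y₀ r)
  symm : ∀ y u v, G y u v = G y v u
  unit : G y₀ T T = -1
  time_eq : ∀ v, ℓ v = - G y₀ T v
  timelike : ∀ y ∈ Metric.ball y₀ r, G y T T < 0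
  pos : ∀ y ∈ Metric.ball y₀ r, ∀ w, ℓ w = 0 → c * ‖w‖ ^ 2 ≤ G y w w
  le_time : ∀ y ∈ Metric.ball y₀ r, ∀ v, G y v v ≤ 0 → θ y v < 0 → c * ‖v‖ ≤ ℓ v
  future : ∀ y ∈ Metric.ball y₀ r, ∀ v, G y v v ≤ 0 → 0 < ℓ v → θ y v < 0
  inner_le : ∀ y ∈ Metric.ball y₀ r, ∀ v, G y v v ≤ 0 → 0 < ℓ v → G y v T ≤ -(c * ‖v‖)
  norm_le : ∀ y ∈ Metric.ball y₀ r, ‖G y‖ ≤ K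
  norm_fderiv_le : ∀ y ∈ Metric.ball y₀ r, ∀ w, ‖fderiv ℝ G y w‖ ≤ K * ‖w‖
  lipschitz : ∀ y ∈ Metric.ball y₀ r, ∀ z ∈ Metric.ball y₀ r, ‖G z - G y‖ ≤ K * ‖z - y‖
  taylor : ∀ y ∈ Metric.ball y₀ r, ∀ z ∈ Metric.ball y₀ r,
    ‖G z - G y - fderiv ℝ G y (z - y)‖ ≤ K * ‖z - y‖ ^ 2

namespace IsLorentzPatch

variable {E : Type*} [NormedAddCommGroup E] [NormedSpace ℝ E]
  {G : E → E →L[ℝ] E →L[ℝ] ℝ} {θ : E → E →L[ℝ] ℝ} {y₀ T : E} {ℓ : E →L[ℝ] ℝ} {r c K : ℝ}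

theorem shrink (h : IsLorentzPatch G θ y₀ T ℓ r c K) {r' : ℝ} (hr' : 0 < r') (hr : r' ≤ r) :
    IsLorentzPatch G θ y₀ T ℓ r' c K := by
  have hs : Metric.ball y₀ r' ⊆ Metric.ball y₀ r := Metric.ball_subset_ball hr
  exact ⟨hr', h.c_pos, h.K_pos, h.smooth.mono hs, h.symm, h.unit, h.time_eq,
    fun y hy ↦ h.timelike y (hs hy), fun y hy ↦ h.pos y (hs hy), fun y hy ↦ h.le_time y (hs hy),
    fun y hy ↦ h.future y (hs hy), fun y hy ↦ h.inner_le y (hs hy), fun y hy ↦ h.norm_le y (hs hy),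
    fun y hy ↦ h.norm_fderiv_le y (hs hy), fun y hy z hz ↦ h.lipschitz y (hs hy) z (hs hz),
    fun y hy z hz ↦ h.taylor y (hs hy) z (hs hz)⟩

theorem mem_center (h : IsLorentzPatch G θ y₀ T ℓ r c K) : y₀ ∈ Metric.ball y₀ r :=
  Metric.mem_ball_self h.r_pos

theorem time_T (h : IsLorentzPatch G θ y₀ T ℓ r c K) : ℓ T = 1 := by
  rw [h.time_eq, h.unit, neg_neg]

theorem apply_le (h : IsLorentzPatch G θ y₀ T ℓ r c K) {y : E} (hy : y ∈ Metric.ball y₀ r)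
    (u v : E) : |G y u v| ≤ K * ‖u‖ * ‖v‖ := by
  refine ((G y).le_opNorm₂ u v).trans ?_
  gcongr
  exact h.norm_le y hy

theorem apply_sub_le (h : IsLorentzPatch G θ y₀ T ℓ r c K) {y z : E} (hy : y ∈ Metric.ball y₀ r)
    (hz : z ∈ Metric.ball y₀ r) (u v : E) : |G z u v - G y u v| ≤ K * ‖z - y‖ * ‖u‖ * ‖v‖ := by
  refine ((G z - G y).le_opNorm₂ u v).trans ?_
  gcongr
  exact h.lipschitz y hy z hz

theorem fderiv_apply_le (h : IsLorentzPatch G θ y₀ T ℓ r c K) {y : E} (hy : y ∈ Metric.ball y₀ r)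
    (w u v : E) : |fderiv ℝ G y w u v| ≤ K * ‖w‖ * ‖u‖ * ‖v‖ := by
  refine ((fderiv ℝ G y w).le_opNorm₂ u v).trans ?_
  gcongr
  exact h.norm_fderiv_le y hy w

theorem taylor_apply_le (h : IsLorentzPatch G θ y₀ T ℓ r c K) {y z : E}
    (hy : y ∈ Metric.ball y₀ r) (hz : z ∈ Metric.ball y₀ r) (u v : E) :
    |G z u v - G y u v - fderiv ℝ G y (z - y) u v| ≤ K * ‖z - y‖ ^ 2 * ‖u‖ * ‖v‖ := by
  refine ((G z - G y - fderiv ℝ G y (z - y)).le_opNorm₂ u v).trans ?_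
  gcongr
  exact h.taylor y hy z hz

end IsLorentzPatch

/-! ### Uniform Taylor bounds and the existence of Lorentzian patches. -/

theorem norm_sub_sub_fderiv_le {E F : Type*} [NormedAddCommGroup E] [NormedSpace ℝ E]
    [NormedAddCommGroup F] [NormedSpace ℝ F] {f : E → F} {y₀ : E} {r K : ℝ} (hK : 0 ≤ K)
    (hf : ∀ y ∈ Metric.ball y₀ r, DifferentiableAt ℝ f y)
    (hK' : ∀ y ∈ Metric.ball y₀ r, ∀ z ∈ Metric.ball y₀ r,
      ‖fderiv ℝ f z - fderiv ℝ f y‖ ≤ K * ‖z - y‖) {y z : E} (hy : y ∈ Metric.ball y₀ r)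
    (hz : z ∈ Metric.ball y₀ r) : ‖f z - f y - fderiv ℝ f y (z - y)‖ ≤ K * ‖z - y‖ ^ 2 := by
  have hseg : segment ℝ y z ⊆ Metric.ball y₀ r := (convex_ball y₀ r).segment_subset hy hz
  have := (convex_segment (𝕜 := ℝ) y z).norm_image_sub_le_of_norm_hasFDerivWithin_le'
    (f := f) (f' := fderiv ℝ f) (φ := fderiv ℝ f y) (C := K * ‖z - y‖)
    (fun x hx ↦ (hf x (hseg hx)).hasFDerivAt.hasFDerivWithinAt) ?_ (left_mem_segment ℝ y z)
    (right_mem_segment ℝ y z)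
  · rw [pow_two, ← mul_assoc]
    exact this
  · intro x hx
    refine (hK' y hy x (hseg hx)).trans ?_
    gcongr
    obtain ⟨t, ht, rfl⟩ := (segment_eq_image' ℝ y z ▸ hx :
      x ∈ (fun t : ℝ ↦ y + t • (z - y)) '' Icc 0 1)
    rw [add_sub_cancel_left, norm_smul, Real.norm_eq_abs, abs_of_nonneg ht.1]
    exact mul_le_of_le_one_left (norm_nonneg _) ht.2

/-- Uniform first and second order estimates for a twice continuously differentiable map. -/
theorem exists_taylor_bounds {E F : Type*} [NormedAddCommGroup E] [NormedSpace ℝ E]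
    [NormedAddCommGroup F] [NormedSpace ℝ F] {f : E → F} {y₀ : E} (hf : ContDiffAt ℝ 2 f y₀) :
    ∃ r > 0, ∃ K > 0, (∀ y ∈ Metric.ball y₀ r, ‖f y‖ ≤ K ∧ (∀ w, ‖fderiv ℝ f y w‖ ≤ K * ‖w‖) ∧
      ∀ z ∈ Metric.ball y₀ r, ‖f z - f y‖ ≤ K * ‖z - y‖ ∧
        ‖f z - f y - fderiv ℝ f y (z - y)‖ ≤ K * ‖z - y‖ ^ 2) := by
  have hf' : ContDiffAt ℝ 1 (fderiv ℝ f) y₀ := hf.fderiv_right (m := 1) (by norm_num)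
  obtain ⟨K₁, t₁, ht₁, hK₁⟩ := (hf.of_le (m := 1) (by norm_num)).exists_lipschitzOnWith
  obtain ⟨K₂, t₂, ht₂, hK₂⟩ := hf'.exists_lipschitzOnWith
  have e3 : ∀ᶠ y in 𝓝 y₀, ‖fderiv ℝ f y‖ < ‖fderiv ℝ f y₀‖ + 1 :=
    hf'.continuousAt.norm.eventually (gt_mem_nhds (by linarith))
  have e4 : ∀ᶠ y in 𝓝 y₀, ‖f y‖ < ‖f y₀‖ + 1 :=
    hf.continuousAt.norm.eventually (gt_mem_nhds (by linarith))
  have e5 : ∀ᶠ y in 𝓝 y₀, DifferentiableAt ℝ f y :=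
    (hf.eventually (by simp)).mono fun y hy ↦ hy.differentiableAt (by norm_num)
  obtain ⟨r, hr, hball⟩ := Metric.eventually_nhds_iff_ball.1
    (e3.and (e4.and (e5.and ((show ∀ᶠ y in 𝓝 y₀, y ∈ t₁ from ht₁).and
      (show ∀ᶠ y in 𝓝 y₀, y ∈ t₂ from ht₂)))))
  have k1 := K₁.coe_nonneg
  have k2 := K₂.coe_nonneg
  have k3 := norm_nonneg (fderiv ℝ f y₀)
  have k4 := norm_nonneg (f y₀)
  have hlip : ∀ y ∈ Metric.ball y₀ r, ∀ z ∈ Metric.ball y₀ r,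
      ‖fderiv ℝ f z - fderiv ℝ f y‖ ≤ K₂ * ‖z - y‖ := by
    intro y hy z hz
    have := hK₂.dist_le_mul z (hball z hz).2.2.2.2 y (hball y hy).2.2.2.2
    rwa [dist_eq_norm, dist_eq_norm] at this
  refine ⟨r, hr, K₁ + K₂ + ‖fderiv ℝ f y₀‖ + ‖f y₀‖ + 2, by positivity,
    fun y hy ↦ ⟨?_, fun w ↦ ?_, fun z hz ↦ ⟨?_, ?_⟩⟩⟩
  · linarith [(hball y hy).2.1]
  · refine ((fderiv ℝ f y).le_opNorm w).trans ?_
    gcongr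
    linarith [(hball y hy).1]
  · have := hK₁.dist_le_mul z (hball z hz).2.2.2.1 y (hball y hy).2.2.2.1
    rw [dist_eq_norm, dist_eq_norm] at this
    refine this.trans ?_
    gcongr
    linarith
  · refine (norm_sub_sub_fderiv_le k2 (fun y hy ↦ (hball y hy).2.2.1) hlip hy hz).trans ?_
    gcongr
    linarith

/-- A timelike covector can be normalised to a unit timelike vector with its dual time function. -/
theorem exists_unit_timelike {E : Type*} [NormedAddCommGroup E] [NormedSpace ℝ E]
    (B : E →L[ℝ] E →L[ℝ] ℝ) {S : E} (hSS : B S S < 0)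
    (hpos : ∀ w, B S w = 0 → w ≠ 0 → 0 < B w w) :
    ∃ (T : E) (ℓ : E →L[ℝ] ℝ) (s : ℝ), 0 < s ∧ B T T = -1 ∧ (∀ v, ℓ v = - B T v) ∧
      (∀ v, B S v = -(s * ℓ v)) ∧ ∀ w, ℓ w = 0 → w ≠ 0 → 0 < B w w := by
  obtain ⟨s, hs, hs2⟩ : ∃ s : ℝ, 0 < s ∧ s ^ 2 = - B S S :=
    ⟨√(- B S S), Real.sqrt_pos.2 (by linarith), Real.sq_sqrt (by linarith)⟩
  have hBT : ∀ v, B (s⁻¹ • S) v = s⁻¹ * B S v := fun v ↦ by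
    rw [map_smul, smul_apply, smul_eq_mul]
  refine ⟨s⁻¹ • S, - B (s⁻¹ • S), s, hs, ?_, fun v ↦ rfl, fun v ↦ ?_, fun w hw ↦ ?_⟩
  · rw [hBT, map_smul, smul_eq_mul, show B S S = - s ^ 2 by linarith]
    field_simp
  · change B S v = -(s * (- B (s⁻¹ • S) v))
    rw [hBT]
    field_simp
  · change - B (s⁻¹ • S) w = 0 at hw
    rw [hBT] at hw
    have : s⁻¹ ≠ 0 := inv_ne_zero hs.ne'
    exact hpos w (by simpa [hs.ne'] using hw)

/-- Reversing the sign of the time direction makes the form positive definite: with w = v - ℓ(v)T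
one has B v v + 2ℓ(v)² = ℓ(v)² + B w w. The constant κ is its minimum on the compact unit sphere. -/
theorem exists_euclidean_bound {E : Type*} [NormedAddCommGroup E] [NormedSpace ℝ E]
    [FiniteDimensional ℝ E] (B : E →L[ℝ] E →L[ℝ] ℝ) (hsymm : ∀ u v, B u v = B v u) {T : E}
    {ℓ : E →L[ℝ] ℝ} (hTT : B T T = -1) (hℓ : ∀ v, ℓ v = - B T v)
    (hpos : ∀ w, ℓ w = 0 → w ≠ 0 → 0 < B w w) :
    ∃ κ > 0, ∀ v, κ * ‖v‖ ^ 2 ≤ B v v + 2 * (ℓ v) ^ 2 := by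
  have hQ : ∀ v, v ≠ 0 → 0 < B v v + 2 * (ℓ v) ^ 2 := by
    intro v hv
    have h0 : ℓ (v - ℓ v • T) = 0 := by
      have : ℓ T = 1 := by rw [hℓ, hTT, neg_neg]
      simp [this]
    have e : B (v - ℓ v • T) (v - ℓ v • T) = B v v + (ℓ v) ^ 2 := by
      have h1 : B T v = - ℓ v := by rw [hℓ, neg_neg]
      have h2 : B v T = - ℓ v := by rw [hsymm, h1]
      simp only [map_sub, map_smul, sub_apply, smul_apply, smul_eq_mul, h1, h2, hTT]
      ring
    by_cases hw : v - ℓ v • T = 0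
    · have hl : ℓ v ≠ 0 := by
        intro hl
        rw [hl, zero_smul, sub_zero] at hw
        exact hv hw
      rw [hw, map_zero] at e
      have : 0 < (ℓ v) ^ 2 := by positivity
      linarith
    · have := hpos _ h0 hw
      have := sq_nonneg (ℓ v)
      linarith
  have hcomp : IsCompact (Metric.sphere (0 : E) 1) := isCompact_sphere 0 1
  have hcont : Continuous fun v : E ↦ B v v + 2 * (ℓ v) ^ 2 := by fun_prop
  have hQs : ∃ κ > 0, ∀ v ∈ Metric.sphere (0 : E) 1, κ ≤ B v v + 2 * (ℓ v) ^ 2 := by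
    rcases (Metric.sphere (0 : E) 1).eq_empty_or_nonempty with he | hne
    · exact ⟨1, one_pos, by simp [he]⟩
    · obtain ⟨v, hv, hmin⟩ := hcomp.exists_isMinOn hne hcont.continuousOn
      refine ⟨_, hQ v ?_, fun w hw ↦ hmin hw⟩
      rintro rfl
      simp at hv
  obtain ⟨κ, hκ, h⟩ := hQs
  refine ⟨κ, hκ, fun v ↦ ?_⟩
  by_cases hv : v = 0
  · simp [hv]
  have hn : 0 < ‖v‖ := norm_pos_iff.2 hv
  have := h (‖v‖⁻¹ • v) (by simp [norm_smul, hn.ne'])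
  simp only [map_smul, smul_apply, smul_eq_mul] at this
  have h2 : ‖v‖⁻¹ * (‖v‖⁻¹ * B v v) + 2 * (‖v‖⁻¹ * ℓ v) ^ 2
      = (B v v + 2 * (ℓ v) ^ 2) / ‖v‖ ^ 2 := by field_simp
  rw [h2, le_div_iff₀ (by positivity)] at this
  exact this

theorem abs_apply_sub_apply_le {E : Type*} [NormedAddCommGroup E] [NormedSpace ℝ E]
    {B B' : E →L[ℝ] E →L[ℝ] ℝ} {ε : ℝ} (h : ‖B - B'‖ ≤ ε) (u v : E) :
    |B u v - B' u v| ≤ ε * ‖u‖ * ‖v‖ := by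
  refine ((B - B').le_opNorm₂ u v).trans ?_
  gcongr

theorem exists_isLorentzPatch {E : Type*} [NormedAddCommGroup E] [NormedSpace ℝ E]
    [FiniteDimensional ℝ E] {G : E → E →L[ℝ] E →L[ℝ] ℝ} {θ : E → E →L[ℝ] ℝ} {Ω : Set E}
    (hΩ : IsOpen Ω) (hG : ContDiffOn ℝ ∞ G Ω) (hθ : ContinuousOn θ Ω)
    (hsymm : ∀ y u v, G y u v = G y v u) {y₀ : E} (hy₀ : y₀ ∈ Ω) {S : E} (hS : θ y₀ = G y₀ S)
    (hSS : G y₀ S S < 0) (hpos : ∀ w, G y₀ S w = 0 → w ≠ 0 → 0 < G y₀ w w) :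
    ∃ (T : E) (ℓ : E →L[ℝ] ℝ) (r c K : ℝ), IsLorentzPatch G θ y₀ T ℓ r c K ∧
      Metric.ball y₀ r ⊆ Ω := by
  obtain ⟨T, ℓ, s, hs, hTT, hℓv, hSv, hpos'⟩ := exists_unit_timelike (G y₀) hSS hpos
  have hθ₀ : ∀ v, θ y₀ v = -(s * ℓ v) := fun v ↦ by rw [hS, hSv]
  obtain ⟨κ, hκ, hκQ⟩ := exists_euclidean_bound (G y₀) (hsymm y₀) hTT hℓv hpos'
  -- If v is causal at a point where the metric differs by at most κ/2 from the central one, then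
  -- κ‖v‖² ≤ (κ/2)‖v‖² + 2ℓ(v)², that is c₁‖v‖ ≤ |ℓ v|.
  obtain ⟨c₁, hc₁pos, hc₁2⟩ : ∃ c₁ : ℝ, 0 < c₁ ∧ c₁ ^ 2 = κ / 4 :=
    ⟨√κ / 2, by positivity, by rw [div_pow, Real.sq_sqrt hκ.le]; norm_num⟩
  have hTn : 0 ≤ ‖T‖ := norm_nonneg T
  -- Tolerance for the variation of the metric and of θ over the ball. The four bounds serve, in
  -- order, the causal estimate above and positivity transverse to T, the agreement of θ with -ℓ on
  -- causal vectors, the bound on G(v, T), and G(T, T) < 0.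
  obtain ⟨ε, hεpos, hε1, hε2, hε3, hε4⟩ : ∃ ε : ℝ, 0 < ε ∧ ε ≤ κ / 2 ∧ ε ≤ s * c₁ / 2 ∧
      ε * ‖T‖ ≤ c₁ / 2 ∧ ε * ‖T‖ * ‖T‖ ≤ 1 / 2 := by
    refine ⟨min (min (κ / 2) (s * c₁ / 2))
      (min (c₁ / (2 * (‖T‖ + 1))) (1 / (2 * (‖T‖ + 1) ^ 2))), by positivity,
      (min_le_left _ _).trans (min_le_left _ _), (min_le_left _ _).trans (min_le_right _ _), ?_, ?_⟩
    · calc _ ≤ c₁ / (2 * (‖T‖ + 1)) * (‖T‖ + 1) :=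
            mul_le_mul ((min_le_right _ _).trans (min_le_left _ _)) (by linarith) hTn (by positivity)
        _ = c₁ / 2 := by field_simp
    · calc _ ≤ 1 / (2 * (‖T‖ + 1) ^ 2) * (‖T‖ + 1) * (‖T‖ + 1) :=
            mul_le_mul (mul_le_mul ((min_le_right _ _).trans (min_le_right _ _)) (by linarith) hTn
              (by positivity)) (by linarith) hTn (by positivity)
        _ = 1 / 2 := by field_simp
  have hΩn : Ω ∈ 𝓝 y₀ := hΩ.mem_nhds hy₀
  have hG₀ : ContDiffAt ℝ 2 G y₀ := (hG.contDiffAt hΩn).of_le (by norm_cast)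
  obtain ⟨r₁, hr₁, K, hK, hbounds⟩ := exists_taylor_bounds hG₀
  have e2 : ∀ᶠ y in 𝓝 y₀, ‖θ y - θ y₀‖ < ε := by
    have := (hθ.continuousAt hΩn).eventually (Metric.ball_mem_nhds _ hεpos)
    filter_upwards [this] with y hy
    rwa [← dist_eq_norm]
  obtain ⟨r₂, hr₂, hball⟩ := Metric.eventually_nhds_iff_ball.1
    (e2.and (show ∀ᶠ y in 𝓝 y₀, y ∈ Ω from hΩn))
  obtain ⟨r, hr, hrr₁, hrr₂, hrε⟩ : ∃ r > 0, r ≤ r₁ ∧ r ≤ r₂ ∧ K * r ≤ ε :=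
    ⟨min r₁ (min r₂ (ε / K)), by positivity, min_le_left _ _,
      (min_le_right _ _).trans (min_le_left _ _), by
      calc _ ≤ K * (ε / K) := mul_le_mul_of_nonneg_left
            ((min_le_right _ _).trans (min_le_right _ _)) hK.le
        _ = ε := by field_simp⟩
  have hs₁ : Metric.ball y₀ r ⊆ Metric.ball y₀ r₁ := Metric.ball_subset_ball hrr₁
  have hs₂ : Metric.ball y₀ r ⊆ Metric.ball y₀ r₂ := Metric.ball_subset_ball hrr₂
  have hGε : ∀ y ∈ Metric.ball y₀ r, ∀ u v, |G y u v - G y₀ u v| ≤ ε * ‖u‖ * ‖v‖ := by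
    intro y hy
    refine abs_apply_sub_apply_le ?_
    refine ((hbounds y₀ (Metric.mem_ball_self hr₁)).2.2 y (hs₁ hy)).1.trans (le_trans ?_ hrε)
    rw [← dist_eq_norm]
    exact mul_le_mul_of_nonneg_left (le_of_lt hy) hK.le
  have hθε : ∀ y ∈ Metric.ball y₀ r, ∀ v, |θ y v + s * ℓ v| ≤ ε * ‖v‖ := by
    intro y hy v
    have := ((θ y - θ y₀).le_opNorm v).trans
      (mul_le_mul_of_nonneg_right (hball y (hs₂ hy)).1.le (norm_nonneg v))
    rw [sub_apply, hθ₀, sub_neg_eq_add] at this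
    exact this
  have hcausal : ∀ y ∈ Metric.ball y₀ r, ∀ v, G y v v ≤ 0 → c₁ * ‖v‖ ≤ |ℓ v| := by
    intro y hy v hv
    have h1 := abs_le.1 (hGε y hy v v)
    have h2 := hκQ v
    generalize G y v v = a at *
    generalize G y₀ v v = b at *
    refine abs_le_of_sq_le_sq (a := c₁ * ‖v‖) (b := |ℓ v|) ?_ (abs_nonneg _) |>.trans' (le_abs_self _)
    rw [mul_pow, hc₁2, sq_abs]
    nlinarith [mul_nonneg (norm_nonneg v) (norm_nonneg v)]
  refine ⟨T, ℓ, r, min (κ / 2) (c₁ / 2), K, ⟨hr, by positivity, hK,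
    hG.mono fun y hy ↦ (hball y (hs₂ hy)).2, hsymm, hTT, hℓv, ?_, ?_, ?_, ?_, ?_,
    fun y hy ↦ (hbounds y (hs₁ hy)).1, fun y hy ↦ (hbounds y (hs₁ hy)).2.1,
    fun y hy z hz ↦ ((hbounds y (hs₁ hy)).2.2 z (hs₁ hz)).1,
    fun y hy z hz ↦ ((hbounds y (hs₁ hy)).2.2 z (hs₁ hz)).2⟩,
    fun y hy ↦ (hball y (hs₂ hy)).2⟩
  · intro y hy
    have := abs_le.1 (hGε y hy T T)
    linarith
  · intro y hy w hw
    have h1 := abs_le.1 (hGε y hy w w)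
    have h2 := hκQ w
    rw [hw] at h2
    have h3 : min (κ / 2) (c₁ / 2) ≤ κ / 2 := min_le_left _ _
    generalize G y w w = a at *
    generalize G y₀ w w = b at *
    nlinarith [mul_nonneg (norm_nonneg w) (norm_nonneg w)]
  · intro y hy v hv hv'
    have h1 := hcausal y hy v hv
    have h2 := abs_le.1 (hθε y hy v)
    have h3 : min (κ / 2) (c₁ / 2) ≤ c₁ / 2 := min_le_right _ _
    have h6 := norm_nonneg v
    generalize θ y v = b at *
    rcases abs_cases (ℓ v) with ⟨h4, _⟩ | ⟨h4, h5⟩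
    · nlinarith
    · rw [h4] at h1
      nlinarith
  · intro y hy v hv hv'
    have h1 := hcausal y hy v hv
    have h2 := abs_le.1 (hθε y hy v)
    rw [abs_of_pos hv'] at h1
    have h3 : 0 < ‖v‖ := norm_pos_iff.2 fun h ↦ by simp [h] at hv'
    have : 0 < s * ℓ v := by positivity
    generalize θ y v = b at *
    nlinarith
  · intro y hy v hv hv'
    have h1 := hcausal y hy v hv
    rw [abs_of_pos hv'] at h1
    have h2 := abs_le.1 (hGε y hy v T)
    have h3 : G y₀ v T = - ℓ v := by rw [hsymm, hℓv, neg_neg]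
    rw [h3] at h2
    have h4 : min (κ / 2) (c₁ / 2) ≤ c₁ / 2 := min_le_right _ _
    have h6 := norm_nonneg v
    generalize G y v T = b at *
    nlinarith

namespace SpacetimeStructure

variable {n : ℕ} {M : Type*} [TopologicalSpace M]
  [ChartedSpace (EuclideanSpace ℝ (Fin (n + 1))) M] [IsManifold (𝓡 (n + 1)) ∞ M]

/-- The metric in the preferred chart at `x₀` is a Lorentzian patch near `x₀`. -/
theorem exists_patch (g : SpacetimeStructure n M) (x₀ : M) :
    ∃ T ℓ r c K, IsLorentzPatch (g.chartMetric x₀) (g.chartTime x₀)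
      (extChartAt (𝓡 (n + 1)) x₀ x₀) T ℓ r c K ∧
      Metric.ball (extChartAt (𝓡 (n + 1)) x₀ x₀) r ⊆ (extChartAt (𝓡 (n + 1)) x₀).target := by
  obtain ⟨S, h1, h2, h3⟩ := g.exists_chartTime_eq x₀ (mem_extChartAt_target x₀)
  exact exists_isLorentzPatch (isOpen_extChartAt_target x₀) (g.contDiffOn_chartMetric x₀)
    (g.continuousOn_chartTime x₀) (g.chartMetric_symm x₀) (mem_extChartAt_target x₀) h1 h2 h3

end SpacetimeStructure

namespace SpacetimeStructure

variable {n : ℕ} {M : Type*} [TopologicalSpace M]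
  [ChartedSpace (EuclideanSpace ℝ (Fin (n + 1))) M] [IsManifold (𝓡 (n + 1)) ∞ M]

/-! ### Coordinate segments and openness of the chronological relation -/

/-- Directions near a timelike vector are timelike at all nearby points. -/
theorem exists_cone (g : SpacetimeStructure n M) (x₀ : M) {v : EuclideanSpace ℝ (Fin (n + 1))}
    (hv : g.chartMetric x₀ (extChartAt (𝓡 (n + 1)) x₀ x₀) v v < 0)
    (hv' : g.chartTime x₀ (extChartAt (𝓡 (n + 1)) x₀ x₀) v < 0) :
    ∃ δ > 0, Metric.ball (extChartAt (𝓡 (n + 1)) x₀ x₀) δ ⊆ (extChartAt (𝓡 (n + 1)) x₀).target ∧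
      ∀ y ∈ Metric.ball (extChartAt (𝓡 (n + 1)) x₀ x₀) δ, ∀ u ∈ Metric.ball v δ,
        g.chartMetric x₀ y u u < 0 ∧ g.chartTime x₀ y u < 0 := by
  set y₀ := extChartAt (𝓡 (n + 1)) x₀ x₀ with hy₀
  have hmem : (extChartAt (𝓡 (n + 1)) x₀).target ∈ 𝓝 y₀ := extChartAt_target_mem_nhds x₀
  have c1 : ContinuousAt (fun p : EuclideanSpace ℝ (Fin (n + 1)) × EuclideanSpace ℝ (Fin (n + 1)) ↦
      g.chartMetric x₀ p.1 p.2 p.2) (y₀, v) := by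
    have h : ContinuousAt (fun p : EuclideanSpace ℝ (Fin (n + 1)) ×
        EuclideanSpace ℝ (Fin (n + 1)) ↦ g.chartMetric x₀ p.1) (y₀, v) :=
      ContinuousAt.comp (x := (y₀, v)) (g := g.chartMetric x₀)
        (((g.contDiffOn_chartMetric x₀).continuousOn).continuousAt hmem) continuousAt_fst
    exact (h.clm_apply continuousAt_snd).clm_apply continuousAt_snd
  have c2 : ContinuousAt (fun p : EuclideanSpace ℝ (Fin (n + 1)) × EuclideanSpace ℝ (Fin (n + 1)) ↦
      g.chartTime x₀ p.1 p.2) (y₀, v) := by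
    have h : ContinuousAt (fun p : EuclideanSpace ℝ (Fin (n + 1)) ×
        EuclideanSpace ℝ (Fin (n + 1)) ↦ g.chartTime x₀ p.1) (y₀, v) :=
      ContinuousAt.comp (x := (y₀, v)) (g := g.chartTime x₀)
        ((g.continuousOn_chartTime x₀).continuousAt hmem) continuousAt_fst
    exact h.clm_apply continuousAt_snd
  have e1 := c1.eventually (gt_mem_nhds hv)
  have e2 := c2.eventually (gt_mem_nhds hv')
  obtain ⟨δ₁, hδ₁, h₁⟩ := Metric.eventually_nhds_iff_ball.1 (e1.and e2)
  obtain ⟨δ₂, hδ₂, h₂⟩ := Metric.mem_nhds_iff.1 hmem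
  refine ⟨min δ₁ δ₂, lt_min hδ₁ hδ₂, (Metric.ball_subset_ball (min_le_right _ _)).trans h₂,
    fun y hy u hu ↦ h₁ (y, u) ?_⟩
  rw [← ball_prod_same]
  exact ⟨Metric.ball_subset_ball (min_le_left _ _) hy, Metric.ball_subset_ball (min_le_left _ _) hu⟩

theorem mem_chronFutureIn_segment (g : SpacetimeStructure n M) (x₀ : M)
    {y u : EuclideanSpace ℝ (Fin (n + 1))} {s : ℝ} (hs : 0 < s) {U : Set M}
    (hseg : ∀ t ∈ Icc 0 s, y + t • u ∈ (extChartAt (𝓡 (n + 1)) x₀).target ∧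
      (extChartAt (𝓡 (n + 1)) x₀).symm (y + t • u) ∈ U)
    (h : ∀ t ∈ Icc 0 s, g.chartMetric x₀ (y + t • u) u u < 0 ∧ g.chartTime x₀ (y + t • u) u < 0) :
    (extChartAt (𝓡 (n + 1)) x₀).symm (y + s • u) ∈
      g.chronFutureIn ((extChartAt (𝓡 (n + 1)) x₀).symm y) U := by
  refine ⟨fun t ↦ (extChartAt (𝓡 (n + 1)) x₀).symm (y + t • u), 0, s, .single ?_, by simp, rfl,
    fun t ht ↦ (hseg t ht).2⟩
  refine g.isSmoothFutureTimelike_of_chart x₀ hs (by fun_prop) (fun t ht ↦ (hseg t ht).1)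
    fun t ht ↦ ⟨u, ?_, h t ht⟩
  have := ((hasDerivAt_id t).smul_const u).const_add y
  simpa using this.hasDerivWithinAt

/-- Two points of a small ball whose difference is close in direction to a timelike vector are
chronologically related. -/
theorem exists_cone_chron (g : SpacetimeStructure n M) (x₀ : M)
    {v : EuclideanSpace ℝ (Fin (n + 1))}
    (hv : g.chartMetric x₀ (extChartAt (𝓡 (n + 1)) x₀ x₀) v v < 0)
    (hv' : g.chartTime x₀ (extChartAt (𝓡 (n + 1)) x₀ x₀) v < 0) :
    ∃ δ > 0, Metric.ball (extChartAt (𝓡 (n + 1)) x₀ x₀) δ ⊆ (extChartAt (𝓡 (n + 1)) x₀).target ∧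
      ∀ y ∈ Metric.ball (extChartAt (𝓡 (n + 1)) x₀ x₀) δ, ∀ s > (0 : ℝ), ∀ u ∈ Metric.ball v δ,
        y + s • u ∈ Metric.ball (extChartAt (𝓡 (n + 1)) x₀ x₀) δ →
        (extChartAt (𝓡 (n + 1)) x₀).symm (y + s • u) ∈
          g.chronFutureIn ((extChartAt (𝓡 (n + 1)) x₀).symm y) univ := by
  obtain ⟨δ, hδ, hsub, h⟩ := g.exists_cone x₀ hv hv'
  refine ⟨δ, hδ, hsub, fun y hy s hs u hu hyu ↦ ?_⟩
  have hseg : ∀ t ∈ Icc 0 s, y + t • u ∈ Metric.ball (extChartAt (𝓡 (n + 1)) x₀ x₀) δ := by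
    intro t ht
    refine (convex_ball _ δ).segment_subset hy hyu ?_
    rw [segment_eq_image']
    refine ⟨t / s, ⟨div_nonneg ht.1 hs.le, (div_le_one hs).2 ht.2⟩, ?_⟩
    simp only [add_sub_cancel_left, smul_smul, div_mul_cancel₀ _ hs.ne']
  exact g.mem_chronFutureIn_segment x₀ hs (fun t ht ↦ ⟨hsub (hseg t ht), mem_univ _⟩)
    fun t ht ↦ h _ (hseg t ht) u hu

theorem chart_mem_nhds (x₀ : M) {N : Set (EuclideanSpace ℝ (Fin (n + 1)))}
    (hN : N ∈ 𝓝 (extChartAt (𝓡 (n + 1)) x₀ x₀)) :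
    {x | x ∈ (extChartAt (𝓡 (n + 1)) x₀).source ∧ extChartAt (𝓡 (n + 1)) x₀ x ∈ N} ∈ 𝓝 x₀ :=
  inter_mem (extChartAt_source_mem_nhds x₀) ((continuousAt_extChartAt x₀) hN)

/-- Secant slopes approximate the one-sided derivative, and for fixed t the slope depends
continuously on the base point. So a short chord from any point near c(a) to the curve still has
direction close to v. -/
theorem exists_slope_mem_ball {E : Type*} [NormedAddCommGroup E] [NormedSpace ℝ E] {c : ℝ → E}
    {v : E} {D : Set ℝ} {a : ℝ} (hc : HasDerivWithinAt c v D a) (ha : a ∉ D) [NeBot (𝓝[D] a)]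
    {δ : ℝ} (hδ : 0 < δ) {P : ℝ → Prop} (hP : ∀ᶠ t in 𝓝[D] a, P t) :
    ∃ t ∈ D, P t ∧ c t ∈ Metric.ball (c a) δ ∧
      ∀ᶠ y in 𝓝 (c a), (t - a)⁻¹ • (c t - y) ∈ Metric.ball v δ := by
  have h1 := (hasDerivWithinAt_iff_tendsto_slope' ha).1 hc
  have h2 := h1.eventually (Metric.ball_mem_nhds v hδ)
  have h3 := hc.continuousWithinAt.eventually (Metric.ball_mem_nhds (c a) hδ)
  obtain ⟨t, ⟨⟨ht1, ht2⟩, ht4⟩, ht3⟩ := (((h2.and h3).and hP).and self_mem_nhdsWithin).exists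
  refine ⟨t, ht3, ht4, ht2, ?_⟩
  have h4 : ContinuousAt (fun y ↦ (t - a)⁻¹ • (c t - y)) (c a) := by fun_prop
  exact h4.eventually (Metric.isOpen_ball.mem_nhds ht1)

/-- Starting points near γ(a) can be joined to a slightly later point γ(t) by a chart segment. Its
direction is close to the timelike initial velocity, so it is timelike. -/
theorem isOpen_chronPast (g : SpacetimeStructure n M) (A : Set M) : IsOpen (g.chronPast A) := by
  rw [isOpen_iff_mem_nhds]
  rintro x₀ ⟨q, hq, hpq⟩
  rw [mem_chronFutureIn_iff, Relation.TransGen.head'_iff] at hpq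
  obtain ⟨p', ⟨γ, a, b, hγ, rfl, rfl, -⟩, hrest⟩ := hpq
  have haI : a ∈ Icc a b := left_mem_Icc.2 hγ.1.le
  obtain ⟨v, hv, hv1, hv2⟩ := hγ.chart (γ a) haI (mem_extChartAt_source _)
  obtain ⟨δ, hδ, hsub, hcone⟩ := g.exists_cone_chron (γ a) hv1 hv2
  have : NeBot (𝓝[Ioo a b] a) := left_nhdsWithin_Ioo_neBot hγ.1
  have hs : ∀ᶠ t in 𝓝[Ioo a b] a, γ t ∈ (extChartAt (𝓡 (n + 1)) (γ a)).source :=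
    ((hγ.2.1.continuousOn a haI).mono Ioo_subset_Icc_self) (extChartAt_source_mem_nhds (γ a))
  obtain ⟨t, ht, ht0, ht1, ht2⟩ :=
    exists_slope_mem_ball (hv.mono Ioo_subset_Icc_self) left_notMem_Ioo hδ hs
  have hpos : 0 < t - a := sub_pos.2 ht.1
  filter_upwards [chart_mem_nhds (γ a) (inter_mem ht2 (Metric.ball_mem_nhds _ hδ))] with x hx
  obtain ⟨hx1, hx2, hx3⟩ := hx
  have key := hcone _ hx3 (t - a) hpos _ hx2
  rw [smul_smul, mul_inv_cancel₀ hpos.ne', one_smul, add_sub_cancel] at key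
  have key := key ht1
  rw [(extChartAt (𝓡 (n + 1)) (γ a)).left_inv ht0, (extChartAt (𝓡 (n + 1)) (γ a)).left_inv hx1]
    at key
  refine ⟨q, hq, g.chronFutureIn_trans key ?_⟩
  rw [mem_chronFutureIn_iff, Relation.TransGen.head'_iff]
  exact ⟨γ b, ⟨γ, t, b, hγ.mono ht.1.le ht.2 le_rfl, rfl, rfl, fun _ _ ↦ mem_univ _⟩, hrest⟩

theorem isOpen_chronFutureIn (g : SpacetimeStructure n M) (p : M) :
    IsOpen (g.chronFutureIn p univ) := by
  rw [isOpen_iff_mem_nhds]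
  intro x₀ hpq
  rw [mem_chronFutureIn_iff, Relation.TransGen.tail'_iff] at hpq
  obtain ⟨p', hrest, ⟨γ, a, b, hγ, rfl, rfl, -⟩⟩ := hpq
  have hbI : b ∈ Icc a b := right_mem_Icc.2 hγ.1.le
  obtain ⟨v, hv, hv1, hv2⟩ := hγ.chart (γ b) hbI (mem_extChartAt_source _)
  obtain ⟨δ, hδ, hsub, hcone⟩ := g.exists_cone_chron (γ b) hv1 hv2
  have : NeBot (𝓝[Ioo a b] b) := right_nhdsWithin_Ioo_neBot hγ.1
  have hs : ∀ᶠ t in 𝓝[Ioo a b] b, γ t ∈ (extChartAt (𝓡 (n + 1)) (γ b)).source :=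
    ((hγ.2.1.continuousOn b hbI).mono Ioo_subset_Icc_self) (extChartAt_source_mem_nhds (γ b))
  obtain ⟨t, ht, ht0, ht1, ht2⟩ :=
    exists_slope_mem_ball (hv.mono Ioo_subset_Icc_self) right_notMem_Ioo hδ hs
  have hpos : 0 < b - t := sub_pos.2 ht.2
  filter_upwards [chart_mem_nhds (γ b) (inter_mem ht2 (Metric.ball_mem_nhds _ hδ))] with x hx
  obtain ⟨hx1, hx2, hx3⟩ := hx
  have key := hcone _ ht1 (b - t) hpos _ hx2
  rw [smul_smul, ← neg_sub b t, inv_neg, mul_neg, mul_inv_cancel₀ hpos.ne', neg_one_smul, neg_sub,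
    add_sub_cancel] at key
  have key := key hx3
  rw [(extChartAt (𝓡 (n + 1)) (γ b)).left_inv ht0, (extChartAt (𝓡 (n + 1)) (γ b)).left_inv hx1]
    at key
  refine g.chronFutureIn_trans ?_ key
  rw [mem_chronFutureIn_iff, Relation.TransGen.tail'_iff]
  exact ⟨γ a, hrest, ⟨γ, a, t, hγ.mono le_rfl ht.1 ht.2.le, rfl, rfl, fun _ _ ↦ mem_univ _⟩⟩

theorem subset_closure_chronPast (g : SpacetimeStructure n M) (A : Set M) :
    A ⊆ closure (g.chronPast A) := by
  intro p hp
  obtain ⟨T, h1, h2, -⟩ := g.exists_chartTime_eq p (mem_extChartAt_target p)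
  obtain ⟨δ, hδ, hsub, hcone⟩ := g.exists_cone_chron p h2 (by rw [h1]; exact h2)
  set y₀ := extChartAt (𝓡 (n + 1)) p p with hy₀
  have hcont : Tendsto (fun s : ℝ ↦ y₀ - s • T) (𝓝[>] 0) (𝓝 y₀) := by
    have : Continuous fun s : ℝ ↦ y₀ - s • T := by fun_prop
    have := this.tendsto 0
    rw [zero_smul, sub_zero] at this
    exact this.mono_left nhdsWithin_le_nhds
  have hsymm : Tendsto (fun s : ℝ ↦ (extChartAt (𝓡 (n + 1)) p).symm (y₀ - s • T)) (𝓝[>] 0) (𝓝 p) := by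
    have h := (continuousAt_extChartAt_symm (I := 𝓡 (n + 1)) p).tendsto
    rw [extChartAt_to_inv] at h
    exact h.comp hcont
  refine mem_closure_of_tendsto hsymm ?_
  filter_upwards [hcont (Metric.ball_mem_nhds y₀ hδ), self_mem_nhdsWithin] with s hs hs0
  have := hcone _ hs s hs0 T (Metric.mem_ball_self hδ)
  rw [sub_add_cancel] at this
  have := this (Metric.mem_ball_self hδ)
  rw [hy₀, extChartAt_to_inv] at this
  exact ⟨p, hp, this⟩

theorem notMem_chronPast_of_mem_frontier (g : SpacetimeStructure n M) {A : Set M} {x : M}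
    (hx : x ∈ frontier (g.chronPast A)) : x ∉ g.chronPast A := by
  rw [(g.isOpen_chronPast A).frontier_eq] at hx
  exact hx.2

/-- The open set I⁺(x) contains y, hence meets I⁻(A). -/
theorem mem_chronPast_of_mem_closure (g : SpacetimeStructure n M) {A : Set M} {x y : M}
    (hxy : y ∈ g.chronFutureIn x univ) (hy : y ∈ closure (g.chronPast A)) : x ∈ g.chronPast A := by
  obtain ⟨z, hz, hzA⟩ := mem_closure_iff.1 hy _ (g.isOpen_chronFutureIn x) hxy
  exact g.chronPast_of_chronFutureIn hz hzA

theorem achronal_frontier_chronPast (g : SpacetimeStructure n M) (A : Set M) :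
    g.Achronal (frontier (g.chronPast A)) := fun _ hx _ hy hxy ↦
  g.notMem_chronPast_of_mem_frontier hx.1
    (g.mem_chronPast_of_mem_closure hxy (frontier_subset_closure hy.1))

theorem Achronal.mono {g : SpacetimeStructure n M} {A B : Set M} (h : g.Achronal A)
    (hB : B ⊆ A) : g.Achronal B := fun x hx y hy ↦ h x ⟨hB hx.1, hx.2⟩ y ⟨hB hy.1, hy.2⟩

/-! ### Pushing up causal curves -/

/-- Displacing the base point by kT spoils G(v, v) by at most K‖T‖Ck‖v‖, while adding k'T to the
velocity contributes 2k'G(v, T) ≤ -ck'‖v‖ up to the smallness of k. In the application k' is the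
derivative of k, so a sufficiently fast growth rate of k wins. -/
theorem _root_.IsLorentzPatch.perturb {E : Type*} [NormedAddCommGroup E] [NormedSpace ℝ E]
    {G : E → E →L[ℝ] E →L[ℝ] ℝ} {θ : E → E →L[ℝ] ℝ} {y₀ T : E} {ℓ : E →L[ℝ] ℝ} {r c K : ℝ}
    (h : IsLorentzPatch G θ y₀ T ℓ r c K) {y v : E} {k k' C : ℝ} (hy : y ∈ Metric.ball y₀ r)
    (hz : y + k • T ∈ Metric.ball y₀ r) (hv0 : v ≠ 0) (hv : G y v v ≤ 0) (hℓ : 0 < ℓ v)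
    (hC : ‖v‖ ≤ C) (hk : 0 ≤ k) (hk' : K * ‖T‖ * C * k < c * k')
    (hk2 : K * k * ‖T‖ * ‖T‖ ≤ c / 2) :
    G (y + k • T) (v + k' • T) (v + k' • T) < 0 ∧ θ (y + k • T) (v + k' • T) < 0 := by
  have hK := h.K_pos
  have hc := h.c_pos
  have hn : 0 < ‖v‖ := norm_pos_iff.2 hv0
  have hT := norm_nonneg T
  have hk'0 : 0 < k' := by
    have : 0 ≤ K * ‖T‖ * C * k := by
      have := hn.le.trans hC
      positivity
    exact (mul_pos_iff_of_pos_left hc).1 (this.trans_lt hk')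
  have e1 := (abs_le.1 (h.apply_sub_le hy hz v v)).2
  have e2 := (abs_le.1 (h.apply_sub_le hy hz v T)).2
  have e3 := h.inner_le y hy v hv hℓ
  have e4 := h.timelike _ hz
  have e5 := h.symm (y + k • T) T v
  have hkT : ‖y + k • T - y‖ = k * ‖T‖ := by
    rw [add_sub_cancel_left, norm_smul, Real.norm_eq_abs, abs_of_nonneg hk]
  rw [hkT] at e1 e2
  have main : G (y + k • T) (v + k' • T) (v + k' • T) < 0 := by
    simp only [map_add, map_smul, add_apply, smul_apply, smul_eq_mul, e5]
    generalize G (y + k • T) v v = a1 at *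
    generalize G (y + k • T) v T = a2 at *
    generalize G (y + k • T) T T = a3 at *
    generalize G y v v = a4 at *
    generalize G y v T = a5 at *
    have i1 : a2 ≤ -(c / 2 * ‖v‖) := by
      have : K * (k * ‖T‖) * ‖v‖ * ‖T‖ ≤ c / 2 * ‖v‖ := by nlinarith
      linarith
    have i2 : a1 ≤ K * ‖T‖ * C * k * ‖v‖ := by
      have : K * (k * ‖T‖) * ‖v‖ * ‖v‖ ≤ K * (k * ‖T‖) * ‖v‖ * C := by gcongr
      nlinarith
    have i3 : K * ‖T‖ * C * k * ‖v‖ < c * k' * ‖v‖ := mul_lt_mul_of_pos_right hk' hn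
    have i4 : k' * a2 ≤ k' * -(c / 2 * ‖v‖) := mul_le_mul_of_nonneg_left i1 hk'0.le
    have i5 : k' * (k' * a3) < 0 := mul_neg_of_pos_of_neg hk'0 (mul_neg_of_pos_of_neg hk'0 e4)
    linarith
  refine ⟨main, h.future _ hz _ main.le ?_⟩
  rw [map_add, map_smul, h.time_T, smul_eq_mul, mul_one]
  linarith

/-- A smooth causal curve whose points after the initial one all lie in `I⁻(A)` starts in
`I⁻(A)`. -/
theorem mem_chronPast_of_Ioc (g : SpacetimeStructure n M) {A : Set M} {γ : ℝ → M} {a b : ℝ}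
    (hγ : g.IsSmoothFutureCausal γ a b) (hF : ∀ t ∈ Ioc a b, γ t ∈ g.chronPast A) :
    γ a ∈ g.chronPast A := by
  obtain ⟨T, ℓ, r, c, K, h, hsub⟩ := g.exists_patch (γ a)
  set φ := extChartAt (𝓡 (n + 1)) (γ a) with hφ
  have haI : a ∈ Icc a b := left_mem_Icc.2 hγ.1.le
  have hev : ∀ᶠ t in 𝓝[Icc a b] a, γ t ∈ φ.source ∧ φ (γ t) ∈ Metric.ball (φ (γ a)) (r / 2) :=
    (hγ.2.1.continuousOn a haI) (chart_mem_nhds (γ a) (Metric.ball_mem_nhds _ (half_pos h.r_pos)))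
  rw [nhdsWithin_Icc_eq_nhdsGE hγ.1] at hev
  obtain ⟨t₁, ht₁, ht₁s⟩ : ∃ t₁ ∈ Ioc a b, ∀ t ∈ Icc a t₁,
      γ t ∈ φ.source ∧ φ (γ t) ∈ Metric.ball (φ (γ a)) (r / 2) := by
    obtain ⟨u, hu, hus⟩ := mem_nhdsGE_iff_exists_Icc_subset.1 hev
    exact ⟨min u b, ⟨lt_min hu hγ.1, min_le_right _ _⟩,
      fun t ht ↦ hus ⟨ht.1, ht.2.trans (min_le_left _ _)⟩⟩
  have hγ' := hγ.mono le_rfl ht₁.1 ht₁.2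
  have hcd : ContDiffOn ℝ ∞ (fun t ↦ φ (γ t)) (Icc a t₁) :=
    contDiffOn_extChartAt_comp (γ a) hγ'.2.1 fun t ht ↦ (ht₁s t ht).1
  obtain ⟨C, hC⟩ := isCompact_Icc.exists_bound_of_continuousOn
    (hcd.continuousOn_derivWithin (uniqueDiffOn_Icc ht₁.1) (by simp))
  have hder : ∀ t ∈ Icc a t₁, HasDerivWithinAt (fun t ↦ φ (γ t))
      (derivWithin (fun t ↦ φ (γ t)) (Icc a t₁) t) (Icc a t₁) t := fun t ht ↦
    (hcd.differentiableOn (by simp) t ht).hasDerivWithinAt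
  have hC0 : 0 ≤ C := (norm_nonneg _).trans (hC a (left_mem_Icc.2 ht₁.1.le))
  have hK := h.K_pos
  have hc := h.c_pos
  -- The displacement k(t) = ε(exp(L(t - a)) - 1) vanishes at a and satisfies k' > Lk, so this L
  -- meets the growth condition of `perturb`. Afterwards ε is taken small enough to stay in the ball
  -- and to end in the open set I⁻(A).
  obtain ⟨L, hL, hLK⟩ : ∃ L : ℝ, 0 < L ∧ K * ‖T‖ * C < c * L := by
    refine ⟨K * ‖T‖ * C / c + 1, by positivity, ?_⟩
    rw [mul_add, mul_one, mul_div_cancel₀ _ hc.ne']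
    linarith
  set E₁ : ℝ := Real.exp (L * (t₁ - a)) with hE₁
  have hsm : ∀ B : ℝ, 0 < B → ∀ C : ℝ, ∀ᶠ ε in 𝓝[>] (0 : ℝ), ε * C < B := by
    intro B hB C
    have : Tendsto (fun ε : ℝ ↦ ε * C) (𝓝[>] 0) (𝓝 (0 * C)) :=
      ((continuous_id.mul continuous_const).tendsto 0).mono_left nhdsWithin_le_nhds
    rw [zero_mul] at this
    exact this.eventually (gt_mem_nhds hB)
  have hend : ∀ᶠ ε in 𝓝[>] (0 : ℝ), φ.symm (φ (γ t₁) + (ε * (E₁ - 1)) • T) ∈ g.chronPast A := by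
    have h1 : Tendsto (fun ε : ℝ ↦ φ (γ t₁) + (ε * (E₁ - 1)) • T) (𝓝[>] 0) (𝓝 (φ (γ t₁))) := by
      have : Continuous fun ε : ℝ ↦ φ (γ t₁) + (ε * (E₁ - 1)) • T := by fun_prop
      have := this.tendsto 0
      rw [zero_mul, zero_smul, add_zero] at this
      exact this.mono_left nhdsWithin_le_nhds
    have ht₁m := ht₁s _ (right_mem_Icc.2 ht₁.1.le)
    have h2 : ContinuousAt φ.symm (φ (γ t₁)) :=
      continuousAt_extChartAt_symm'' (φ.map_source ht₁m.1)
    have h3 : Tendsto φ.symm (𝓝 (φ (γ t₁))) (𝓝 (γ t₁)) := by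
      have := h2.tendsto
      rwa [φ.left_inv ht₁m.1] at this
    exact (h3.comp h1) ((g.isOpen_chronPast A).mem_nhds (hF t₁ ht₁))
  obtain ⟨ε, ⟨⟨hε1, hε2⟩, hε3⟩, hε0⟩ := ((((hsm (r / 2) (half_pos h.r_pos) (E₁ * ‖T‖)).and
    (hsm (c / 2) (half_pos hc) (K * E₁ * ‖T‖ * ‖T‖))).and hend).and self_mem_nhdsWithin).exists
  have hε0 : 0 < ε := hε0
  refine g.chronPast_of_chronFutureIn ?_ hε3
  have hk : ∀ t ∈ Icc a t₁, 0 ≤ ε * (Real.exp (L * (t - a)) - 1) ∧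
      ε * (Real.exp (L * (t - a)) - 1) ≤ ε * E₁ := by
    intro t ht
    have h1 : 1 ≤ Real.exp (L * (t - a)) := Real.one_le_exp (by have := ht.1; nlinarith)
    have h2 : Real.exp (L * (t - a)) ≤ E₁ := Real.exp_le_exp.2 (by have := ht.2; nlinarith)
    exact ⟨mul_nonneg hε0.le (by linarith), mul_le_mul_of_nonneg_left (by linarith) hε0.le⟩
  have hball : ∀ t ∈ Icc a t₁, φ (γ t) + (ε * (Real.exp (L * (t - a)) - 1)) • T ∈
      Metric.ball (φ (γ a)) r := by
    intro t ht
    have h1 := (ht₁s t ht).2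
    rw [mem_ball_iff_norm] at h1 ⊢
    calc _ = ‖(φ (γ t) - φ (γ a)) + (ε * (Real.exp (L * (t - a)) - 1)) • T‖ := by congr 1; abel
      _ ≤ ‖φ (γ t) - φ (γ a)‖ + ‖(ε * (Real.exp (L * (t - a)) - 1)) • T‖ := norm_add_le _ _
      _ < r / 2 + r / 2 := by
        refine add_lt_add_of_lt_of_le h1 ?_
        rw [norm_smul, Real.norm_eq_abs, abs_of_nonneg (hk t ht).1]
        refine le_trans ?_ hε1.le
        rw [← mul_assoc]
        exact mul_le_mul_of_nonneg_right (hk t ht).2 (norm_nonneg _)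
      _ = r := add_halves r
  have hsmooth := g.isSmoothFutureTimelike_of_chart (γ a)
    (c := fun t ↦ φ (γ t) + (ε * (Real.exp (L * (t - a)) - 1)) • T) ht₁.1
    (hcd.add (by fun_prop)) (fun t ht ↦ hsub (hball t ht)) ?_
  · have := hsmooth.mem_chronFutureIn
    simp only [sub_self, mul_zero, Real.exp_zero, zero_smul, add_zero] at this
    rwa [extChartAt_to_inv] at this
  · intro t ht
    have hexp : HasDerivAt (fun t ↦ ε * (Real.exp (L * (t - a)) - 1))
        (ε * (Real.exp (L * (t - a)) * L)) t := by
      have h1 : HasDerivAt (fun t ↦ L * (t - a)) L t := by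
        simpa using ((hasDerivAt_id t).sub_const a).const_mul L
      exact ((h1.exp).sub_const 1).const_mul ε
    refine ⟨_, (hder t ht).add (hexp.smul_const T).hasDerivWithinAt, ?_⟩
    obtain ⟨v, hv, hv0, hv1, hv2⟩ := hγ'.chart (γ a) ht (ht₁s t ht).1
    have hvd := hv.derivWithin (uniqueDiffOn_Icc ht₁.1 t ht)
    rw [hvd]
    have hmem : φ (γ t) ∈ Metric.ball (φ (γ a)) r :=
      Metric.ball_subset_ball (by linarith [h.r_pos]) (ht₁s t ht).2
    have hvC := hC t ht
    rw [hvd] at hvC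
    have hvpos : 0 < ‖v‖ := norm_pos_iff.2 hv0
    have hle := h.le_time _ hmem v hv1 hv2
    refine h.perturb hmem (hball t ht) hv0 hv1 (by nlinarith) hvC (hk t ht).1 ?_ ?_
    · have hp : 0 < Real.exp (L * (t - a)) := Real.exp_pos _
      have h0 : 0 ≤ K * ‖T‖ * C := by positivity
      calc K * ‖T‖ * C * (ε * (Real.exp (L * (t - a)) - 1))
          ≤ K * ‖T‖ * C * (ε * Real.exp (L * (t - a))) := by gcongr; linarith
        _ < c * L * (ε * Real.exp (L * (t - a))) := by gcongr
        _ = _ := by ring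
    · calc K * (ε * (Real.exp (L * (t - a)) - 1)) * ‖T‖ * ‖T‖ ≤ K * (ε * E₁) * ‖T‖ * ‖T‖ := by
            have := (hk t ht).2
            gcongr
        _ = ε * (K * E₁ * ‖T‖ * ‖T‖) := by ring
        _ ≤ c / 2 := hε2.le

/-- If γ(a) were outside I⁻(A), there would be a last parameter s with γ(s) outside, since I⁻(A) is
open. All later points lie in I⁻(A), and `mem_chronPast_of_Ioc` applied from s gives a
contradiction. -/
theorem IsSmoothFutureCausal.mem_chronPast {g : SpacetimeStructure n M} {A : Set M} {γ : ℝ → M}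
    {a b : ℝ} (hγ : g.IsSmoothFutureCausal γ a b) (hb : γ b ∈ g.chronPast A) :
    γ a ∈ g.chronPast A := by
  by_contra ha
  have hcl : IsClosed (Icc a b ∩ γ ⁻¹' (g.chronPast A)ᶜ) :=
    hγ.2.1.continuousOn.preimage_isClosed_of_isClosed isClosed_Icc
      (g.isOpen_chronPast A).isClosed_compl
  have hcp : IsCompact (Icc a b ∩ γ ⁻¹' (g.chronPast A)ᶜ) :=
    isCompact_Icc.of_isClosed_subset hcl inter_subset_left
  obtain ⟨s, ⟨hs, hsF⟩, hmax⟩ := hcp.exists_isGreatest ⟨a, left_mem_Icc.2 hγ.1.le, ha⟩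
  have hsb : s < b := lt_of_le_of_ne hs.2 fun h ↦ hsF (h ▸ hb)
  refine hsF (g.mem_chronPast_of_Ioc (hγ.mono hs.1 hsb le_rfl) fun t ht ↦ ?_)
  by_contra hcon
  exact absurd (hmax ⟨⟨hs.1.trans ht.1.le, ht.2⟩, hcon⟩) (not_le.2 ht.1)

theorem mem_chronPast_of_causalFutureIn (g : SpacetimeStructure n M) {A U : Set M} {x y : M}
    (hxy : y ∈ g.causalFutureIn x U) (hy : y ∈ g.chronPast A) : x ∈ g.chronPast A := by
  rcases hxy with rfl | ⟨γ, a, b, h, rfl, rfl, -⟩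
  · exact hy
  · induction h with
    | single h => exact h.mem_chronPast hy
    | tail _ h2 ih => exact ih (h2.mem_chronPast hy)

end SpacetimeStructure

/-! ### Frontiers of past sets are topological hypersurfaces -/

theorem IsC0Hypersurface.diff_isClosed {n : ℕ} {M : Type*} [TopologicalSpace M] {S C : Set M}
    (hS : IsC0Hypersurface n S) (hC : IsClosed C) : IsC0Hypersurface n (S \ C) := by
  intro p hp
  obtain ⟨φ, hφ, h⟩ := hS p hp.1
  refine ⟨φ.restrOpen Cᶜ hC.isOpen_compl, ⟨hφ, hp.2⟩, fun x hx ↦ ?_⟩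
  rw [OpenPartialHomeomorph.restrOpen_source] at hx
  rw [OpenPartialHomeomorph.coe_restrOpen, ← h x hx.1]
  exact ⟨fun h ↦ h.1, fun h ↦ ⟨h, hx.2⟩⟩

theorem exists_mem_frontier_of_isPreconnected {X : Type*} [TopologicalSpace X] {O C : Set X}
    (hO : IsOpen O) (hC : IsPreconnected C) (h1 : (C ∩ O).Nonempty)
    (h2 : (C ∩ (closure O)ᶜ).Nonempty) : ∃ x ∈ C, x ∈ frontier O := by
  by_contra! hcon
  obtain ⟨x, -, hx1, hx2⟩ := hC O (closure O)ᶜ hO isClosed_closure.isOpen_compl (fun x hx ↦ by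
    by_cases hxO : x ∈ O
    · exact .inl hxO
    · exact .inr fun hcl ↦ hcon x hx (hO.frontier_eq ▸ ⟨hcl, hxO⟩)) h1 h2
  exact hx2 (subset_closure hx1)

/-- The homeomorphism of `ℝⁿ⁺¹` that straightens the graph `ℓ w = f (w - ℓ w • T)` to the
hyperplane `x₀ = 0`. -/
theorem exists_homeomorph_straighten {n : ℕ} {T : EuclideanSpace ℝ (Fin (n + 1))}
    {ℓ : EuclideanSpace ℝ (Fin (n + 1)) →L[ℝ] ℝ} (hT : ℓ T = 1)
    {f : EuclideanSpace ℝ (Fin (n + 1)) → ℝ} (hf : Continuous f) :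
    ∃ Φ : EuclideanSpace ℝ (Fin (n + 1)) ≃ₜ EuclideanSpace ℝ (Fin (n + 1)),
      ∀ w, Φ w 0 = ℓ w - f (w - ℓ w • T) := by
  have hT0 : T ≠ 0 := by
    rintro rfl
    simp at hT
  obtain ⟨L, hL⟩ := SeparatingDual.exists_continuousLinearEquiv_apply_eq (R := ℝ) hT0
    (y := EuclideanSpace.single (0 : Fin (n + 1)) (1 : ℝ)) (by
      intro h
      simpa using congrArg (fun v : EuclideanSpace ℝ (Fin (n + 1)) ↦ v 0) h)
  -- The straightening is a shear w ↦ w + k(w)T followed by a linear map L with L T = e₀. The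
  -- coefficient k is invariant under translations along T, which makes w ↦ w - k(w)T the inverse
  -- shear.
  set k : EuclideanSpace ℝ (Fin (n + 1)) → ℝ := fun w ↦ ℓ w - L w 0 - f (w - ℓ w • T) with hk
  have hLT : L T 0 = 1 := by rw [hL]; simp
  have hkT : ∀ (w : EuclideanSpace ℝ (Fin (n + 1))) (s : ℝ), k (w + s • T) = k w := by
    intro w s
    have h1 : w + s • T - (ℓ w + s * 1) • T = w - ℓ w • T := by rw [mul_one, add_smul]; abel
    simp only [hk, map_add, map_smul, hT, smul_eq_mul, PiLp.add_apply, PiLp.smul_apply, hLT, h1]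
    ring
  have hkc : Continuous k := by
    have : Continuous fun w ↦ L w 0 :=
      (EuclideanSpace.proj (𝕜 := ℝ) (0 : Fin (n + 1))).continuous.comp L.continuous
    fun_prop
  let Ψ : EuclideanSpace ℝ (Fin (n + 1)) ≃ₜ EuclideanSpace ℝ (Fin (n + 1)) :=
    { toFun := fun w ↦ w + k w • T
      invFun := fun w ↦ w - k w • T
      left_inv := fun w ↦ by
        change w + k w • T - k (w + k w • T) • T = w
        rw [hkT, add_sub_cancel_right]
      right_inv := fun w ↦ by
        change w - k w • T + k (w - k w • T) • T = w
        rw [sub_eq_add_neg, ← neg_smul, hkT, neg_smul, neg_add_cancel_right]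
      continuous_toFun := by fun_prop
      continuous_invFun := by fun_prop }
  refine ⟨Ψ.trans L.toHomeomorph, fun w ↦ ?_⟩
  change L (w + k w • T) 0 = _
  rw [map_add, map_smul, PiLp.add_apply, PiLp.smul_apply, hLT, smul_eq_mul, mul_one]
  simp only [hk]
  ring

/-- A set on which `ℓ` is controlled by the component transverse to `T` is a Lipschitz graph. -/
theorem exists_lipschitz_graph {E : Type*} [NormedAddCommGroup E] [NormedSpace ℝ E] {T : E}
    {ℓ : E →L[ℝ] ℝ} {S : Set E} {δ : ℝ} (hδ : 0 < δ)
    (hS : ∀ y ∈ S, ∀ z ∈ S, 0 < ℓ (z - y) → δ * ℓ (z - y) ≤ ‖z - y - ℓ (z - y) • T‖) :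
    ∃ f : E → ℝ, Continuous f ∧ ∀ y ∈ S, f (y - ℓ y • T) = ℓ y := by
  have hS' : ∀ y ∈ S, ∀ z ∈ S, |ℓ z - ℓ y| ≤ δ⁻¹ * ‖(z - ℓ z • T) - (y - ℓ y • T)‖ := by
    intro y hy z hz
    rw [← div_eq_inv_mul, le_div_iff₀ hδ, mul_comm]
    have e : z - ℓ z • T - (y - ℓ y • T) = z - y - ℓ (z - y) • T := by
      rw [map_sub, sub_smul]
      abel
    have e' : y - ℓ y • T - (z - ℓ z • T) = y - z - ℓ (y - z) • T := by
      rw [map_sub, sub_smul]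
      abel
    rcases lt_trichotomy (ℓ y) (ℓ z) with h | h | h
    · have := hS y hy z hz (by rw [map_sub]; linarith)
      rw [e, abs_of_pos (by linarith), ← map_sub]
      exact this
    · rw [h, sub_self, abs_zero, mul_zero]
      positivity
    · have := hS z hz y hy (by rw [map_sub]; linarith)
      rw [norm_sub_rev, e', abs_sub_comm, abs_of_pos (by linarith), ← map_sub]
      exact this
  set prj : E → E := fun y ↦ y - ℓ y • T with hprj
  have hinv : ∀ u ∈ prj '' S, Function.invFunOn prj S u ∈ S ∧ prj (Function.invFunOn prj S u) = u :=
    fun u hu ↦ ⟨Function.invFunOn_mem hu, Function.invFunOn_eq hu⟩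
  have hlip : LipschitzOnWith (Real.toNNReal δ⁻¹) (fun u ↦ ℓ (Function.invFunOn prj S u))
      (prj '' S) := by
    refine LipschitzOnWith.of_dist_le_mul fun u hu v hv ↦ ?_
    obtain ⟨h1, h2⟩ := hinv u hu
    obtain ⟨h3, h4⟩ := hinv v hv
    have := hS' _ h3 _ h1
    change _ ≤ δ⁻¹ * ‖prj _ - prj _‖ at this
    rw [h2, h4] at this
    rwa [Real.dist_eq, dist_eq_norm, Real.coe_toNNReal _ (inv_pos.2 hδ).le]
  -- On S the height ℓ is a Lipschitz function of the projection along T. A Lipschitz extension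
  -- makes the graph function global.
  obtain ⟨f, hf, hfS⟩ := hlip.extend_real
  refine ⟨f, hf.continuous, fun y hy ↦ ?_⟩
  obtain ⟨h1, h2⟩ := hinv _ (mem_image_of_mem prj hy)
  have h3 := hS' _ hy _ h1
  change _ ≤ δ⁻¹ * ‖prj _ - prj _‖ at h3
  rw [h2, sub_self, norm_zero, mul_zero, abs_nonpos_iff, sub_eq_zero] at h3
  exact (hfS (mem_image_of_mem prj hy)).symm.trans h3

namespace SpacetimeStructure

variable {n : ℕ} {M : Type*} [TopologicalSpace M]
  [ChartedSpace (EuclideanSpace ℝ (Fin (n + 1))) M] [IsManifold (𝓡 (n + 1)) ∞ M]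

/-- Achronality forbids two nearby frontier points to differ by a vector in the cone about T, so the
frontier lies on a Lipschitz graph. Each short segment in direction T runs from I⁻(A) to the
exterior of its closure, so it meets the frontier, and every point of the graph near x is attained.
-/
theorem isC0Hypersurface_frontier_chronPast (g : SpacetimeStructure n M) (A : Set M) :
    IsC0Hypersurface n (frontier (g.chronPast A)) := by
  intro x hx
  have hFo := g.isOpen_chronPast A
  obtain ⟨T, ℓ, r, c, K, h, -⟩ := g.exists_patch x
  have hTT : g.chartMetric x (extChartAt (𝓡 (n + 1)) x x) T T < 0 := h.timelike _ h.mem_center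
  obtain ⟨δ, hδ, hsub, hcone⟩ := g.exists_cone_chron x hTT
    (h.future _ h.mem_center _ hTT.le (by rw [h.time_T]; exact one_pos))
  set φ := extChartAt (𝓡 (n + 1)) x with hφ
  set y₀ := φ x with hy₀
  have hsymm : ContinuousOn φ.symm (Metric.ball y₀ δ) :=
    (continuousOn_extChartAt_symm x).mono hsub
  set S : Set (EuclideanSpace ℝ (Fin (n + 1))) :=
    {y | y ∈ Metric.ball y₀ δ ∧ φ.symm y ∈ frontier (g.chronPast A)} with hSdef
  obtain ⟨f, hfc, hfS⟩ := exists_lipschitz_graph (T := T) (ℓ := ℓ) (S := S) hδ (by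
    intro y hy z hz hpos
    by_contra! hlt
    have hu : (ℓ (z - y))⁻¹ • (z - y) ∈ Metric.ball T δ := by
      rw [mem_ball_iff_norm]
      have : (ℓ (z - y))⁻¹ • (z - y) - T = (ℓ (z - y))⁻¹ • (z - y - ℓ (z - y) • T) := by
        rw [smul_sub _ _ (ℓ (z - y) • T), smul_smul, inv_mul_cancel₀ hpos.ne', one_smul]
      rw [this, norm_smul, Real.norm_eq_abs, abs_of_pos (inv_pos.2 hpos), inv_mul_lt_iff₀ hpos]
      linarith
    have key := hcone y hy.1 _ hpos _ hu
    rw [smul_smul, mul_inv_cancel₀ hpos.ne', one_smul, add_sub_cancel] at key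
    exact g.notMem_chronPast_of_mem_frontier hy.2
      (g.mem_chronPast_of_mem_closure (key hz.1) (frontier_subset_closure hz.2)))
  obtain ⟨Φ, hΦ⟩ := exists_homeomorph_straighten h.time_T hfc
  obtain ⟨a, ha, haδ⟩ : ∃ a > (0 : ℝ), ∀ t ∈ Icc (-a) a, y₀ + t • T ∈ Metric.ball y₀ (δ / 2) := by
    have hc : Continuous fun t : ℝ ↦ y₀ + t • T := by fun_prop
    have h0 : (fun t : ℝ ↦ y₀ + t • T) ⁻¹' Metric.ball y₀ (δ / 2) ∈ 𝓝 (0 : ℝ) :=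
      hc.continuousAt.preimage_mem_nhds (by
        rw [zero_smul, add_zero]
        exact Metric.ball_mem_nhds _ (half_pos hδ))
    obtain ⟨a, ha, hs⟩ := Metric.nhds_basis_closedBall.mem_iff.1 h0
    refine ⟨a, ha, fun t ht ↦ hs ?_⟩
    rwa [Real.closedBall_eq_Icc, zero_sub, zero_add]
  have haδ' : ∀ t ∈ Icc (-a) a, y₀ + t • T ∈ Metric.ball y₀ δ := fun t ht ↦
    Metric.ball_subset_ball (by linarith) (haδ t ht)
  have hx0 : φ.symm y₀ = x := extChartAt_to_inv x
  have hlow : φ.symm (y₀ + (-a) • T) ∈ g.chronPast A := by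
    refine g.mem_chronPast_of_mem_closure (y := x) ?_ (frontier_subset_closure hx)
    have := hcone _ (haδ' (-a) ⟨le_rfl, by linarith⟩) a ha T (Metric.mem_ball_self hδ)
    rw [neg_smul, neg_add_cancel_right, hx0] at this
    rw [neg_smul]
    exact this (Metric.mem_ball_self hδ)
  have hhigh : φ.symm (y₀ + a • T) ∈ (closure (g.chronPast A))ᶜ := by
    intro hcl
    refine g.notMem_chronPast_of_mem_frontier hx (g.mem_chronPast_of_mem_closure ?_ hcl)
    have := hcone y₀ (Metric.mem_ball_self hδ) a ha T (Metric.mem_ball_self hδ)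
      (haδ' a ⟨by linarith, le_rfl⟩)
    rwa [hx0] at this
  have hev : ∀ s ∈ Icc (-a) a, ∀ O : Set M, IsOpen O → φ.symm (y₀ + s • T) ∈ O →
      ∀ᶠ y in 𝓝 y₀, φ.symm (y + s • T) ∈ O := by
    intro s hs O hO hmem
    have h1 : ContinuousAt φ.symm (y₀ + s • T) :=
      hsymm.continuousAt (Metric.isOpen_ball.mem_nhds (haδ' s hs))
    have h2 : ContinuousAt (fun y ↦ y + s • T) y₀ := by fun_prop
    exact (ContinuousAt.comp (x := y₀) (g := φ.symm) h1 h2) (hO.mem_nhds hmem)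
  have hN : ∀ᶠ y in 𝓝 y₀, y ∈ Metric.ball y₀ (δ / 2) ∧
      φ.symm (y + (-a) • T) ∈ g.chronPast A ∧
      φ.symm (y + a • T) ∈ (closure (g.chronPast A))ᶜ :=
    (show ∀ᶠ y in 𝓝 y₀, y ∈ Metric.ball y₀ (δ / 2) from
      Metric.ball_mem_nhds _ (half_pos hδ)).and
      ((hev (-a) ⟨le_rfl, by linarith⟩ _ hFo hlow).and
        (hev a ⟨by linarith, le_rfl⟩ _ isClosed_closure.isOpen_compl hhigh))
  obtain ⟨W, hWs, hWo, hxW⟩ := mem_nhds_iff.1 (chart_mem_nhds x hN)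
  refine ⟨((chartAt (EuclideanSpace ℝ (Fin (n + 1))) x).trans
    Φ.toOpenPartialHomeomorph).restrOpen W hWo, ?_, fun z hz ↦ ?_⟩
  · simp [hxW]
  have hzW : z ∈ W := hz.2
  have hval : (((chartAt (EuclideanSpace ℝ (Fin (n + 1))) x).trans
      Φ.toOpenPartialHomeomorph).restrOpen W hWo) z = Φ (φ z) := rfl
  rw [hval, hΦ, sub_eq_zero]
  obtain ⟨hz1, hz2, hz3, hz4⟩ := hWs hzW
  have hball : ∀ t ∈ Icc (-a) a, φ z + t • T ∈ Metric.ball y₀ δ := by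
    intro t ht
    have h1 := haδ t ht
    rw [mem_ball_iff_norm, add_sub_cancel_left] at h1
    rw [mem_ball_iff_norm] at hz2 ⊢
    calc _ = ‖(φ z - y₀) + t • T‖ := by congr 1; abel
      _ ≤ _ := norm_add_le _ _
      _ < δ := by linarith
  constructor
  · intro hzF
    refine (hfS (φ z) ⟨Metric.ball_subset_ball (by linarith) hz2, ?_⟩).symm
    rwa [φ.left_inv hz1]
  · intro hzf
    have hcont : ContinuousOn (fun t : ℝ ↦ φ.symm (φ z + t • T)) (Icc (-a) a) :=
      hsymm.comp (by fun_prop) hball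
    -- The vertical segment through a graph point meets the frontier at height shift t. That point
    -- lies over the same transverse position on the same graph, which forces t = 0.
    obtain ⟨_, ⟨t, ht, rfl⟩, hF⟩ := exists_mem_frontier_of_isPreconnected hFo
      (isPreconnected_Icc.image _ hcont)
      ⟨_, mem_image_of_mem _ (left_mem_Icc.2 (by linarith)), hz3⟩
      ⟨_, mem_image_of_mem _ (right_mem_Icc.2 (by linarith)), hz4⟩
    have h1 := hfS _ (show φ z + t • T ∈ S from ⟨hball t ht, hF⟩)
    have h2 : φ z + t • T - ℓ (φ z + t • T) • T = φ z - ℓ (φ z) • T := by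
      rw [map_add, map_smul, h.time_T, smul_eq_mul, mul_one, add_smul]
      abel
    rw [h2, ← hzf, map_add, map_smul, h.time_T, smul_eq_mul, mul_one] at h1
    have ht0 : t = 0 := by linarith
    simp only [ht0, zero_smul, add_zero, φ.left_inv hz1] at hF
    exact hF

end SpacetimeStructure

/-! ### Barriers along null curves -/

namespace IsLorentzPatch

variable {E : Type*} [NormedAddCommGroup E] [NormedSpace ℝ E]
  {G : E → E →L[ℝ] E →L[ℝ] ℝ} {θ : E → E →L[ℝ] ℝ} {y₀ T : E} {ℓ : E →L[ℝ] ℝ} {r c K : ℝ}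

/-- The last line is the derivative, per unit of ℓ, of the barrier along a curve of velocity u + X
at displacement w = z - y from a null ray of velocity u. Expanding G_z(u + X, u + X) < 0 about y,
and using G_y(u, u) = 0, shows that ∂G(w)(u, u) + 2G_y(u, X) is less than errors quadratic in (w, X)
minus c‖X‖². The term with k absorbs the errors in w, and c‖X‖² absorbs those in X. -/
theorem exists_barrier_bound (h : IsLorentzPatch G θ y₀ T ℓ r c K) {C κ₀ κ₁ : ℝ} (hC : 0 ≤ C)
    (hκ₀ : 0 < κ₀) (hκ₁ : 0 ≤ κ₁) :
    ∃ k > (0 : ℝ), ∃ τ > (0 : ℝ), ∀ y ∈ Metric.ball y₀ r, ∀ z ∈ Metric.ball y₀ r, ∀ (u X : E)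
      (κ s : ℝ), |s| ≤ τ → ℓ (z - y) = 0 → ℓ X = 0 → ‖u‖ ≤ C → G y u u = 0 → κ₀ ≤ κ → κ ≤ κ₁ →
      G z (u + X) (u + X) < 0 →
      κ / 2 * fderiv ℝ G y (z - y) u u + κ * G y u X - k / 2 * G y₀ (z - y) (z - y)
        - k * s * G y₀ (z - y) X < 0 := by
  have hc := h.c_pos
  have hK := h.K_pos
  -- A is the coefficient of ‖w‖² once the mixed term 2KC‖w‖‖X‖ has been split with half of c‖X‖².
  -- Then k is chosen so that kc/2 exceeds κ₁A by c/2.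
  set A : ℝ := K * C ^ 2 + 2 * K ^ 2 * C ^ 2 / c with hA
  have hA0 : 0 ≤ A := by positivity
  set k : ℝ := 2 * κ₁ * A / c + 1 with hk
  have hk0 : 0 < k := by positivity
  have hkc : k * c / 2 = κ₁ * A + c / 2 := by rw [hk]; field_simp
  -- The term k s G(w, X) is the price of differentiating the quadratic correction. For |s| ≤ τ it
  -- splits between the remaining ‖X‖² term and the spare c/2 · ‖w‖².
  obtain ⟨τ, hτ, hτ2⟩ : ∃ τ > (0 : ℝ), (k * τ * K) ^ 2 ≤ κ₀ * c * (c / 2) := by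
    refine ⟨min 1 (κ₀ * c * (c / 2) / (k * K) ^ 2), by positivity, ?_⟩
    set τ := min 1 (κ₀ * c * (c / 2) / (k * K) ^ 2) with hτ
    have h0 : 0 ≤ τ := by positivity
    have h1 : τ ≤ 1 := min_le_left _ _
    calc (k * τ * K) ^ 2 = (k * K) ^ 2 * (τ * τ) := by ring
      _ ≤ (k * K) ^ 2 * (τ * 1) := by gcongr
      _ ≤ (k * K) ^ 2 * (κ₀ * c * (c / 2) / (k * K) ^ 2) := by
        rw [mul_one]
        gcongr
        exact min_le_right _ _
      _ = _ := by field_simp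
  refine ⟨k, hk0, τ, hτ, fun y hy z hz u X κ s hs hw hX hu hnull hκ hκ' hneg ↦ ?_⟩
  set w := z - y with hwdef
  have e1 := (abs_le.1 (h.taylor_apply_le hy hz u u)).1
  have e2 := (abs_le.1 (h.apply_sub_le hy hz u X)).1
  have e3 := h.pos z hz X hX
  have e4 := h.pos y₀ h.mem_center w hw
  have e5 := (abs_le.1 (h.apply_le h.mem_center w X))
  have e6 := h.symm z X u
  rw [← hwdef] at e1 e2
  simp only [map_add, add_apply, e6] at hneg
  have hC1 : K * ‖w‖ ^ 2 * ‖u‖ * ‖u‖ ≤ K * ‖w‖ ^ 2 * C * C := by gcongr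
  have hC2 : K * ‖w‖ * ‖u‖ * ‖X‖ ≤ K * ‖w‖ * C * ‖X‖ := by gcongr
  have hs5 : -(k * s * G y₀ w X) ≤ k * τ * (K * ‖w‖ * ‖X‖) := by
    have : |k * s * G y₀ w X| ≤ k * τ * (K * ‖w‖ * ‖X‖) := by
      rw [abs_mul, abs_mul, abs_of_pos hk0]
      have := h.apply_le h.mem_center w X
      gcongr
    exact (neg_le_abs _).trans this
  have ha := norm_nonneg w
  have hx := norm_nonneg X
  generalize ‖w‖ = a at *
  generalize ‖X‖ = x at *
  generalize fderiv ℝ G y w u u = D at *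
  generalize G y u X = g at *
  generalize G y₀ w w = B at *
  generalize G y₀ w X = B' at *
  generalize G z u u = g1 at *
  generalize G z u X = g2 at *
  generalize G z X X = g3 at *
  rw [hnull] at e1
  have s1 : D + 2 * g < K * C ^ 2 * a ^ 2 + 2 * (K * a * C * x) - c * x ^ 2 := by nlinarith
  have s2 : 2 * (K * a * C * x) ≤ c / 2 * x ^ 2 + 2 * K ^ 2 * C ^ 2 / c * a ^ 2 := by
    have : c / 2 * x ^ 2 + 2 * K ^ 2 * C ^ 2 / c * a ^ 2 - 2 * (K * a * C * x)
        = (c * x - 2 * K * C * a) ^ 2 / (2 * c) := by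
      field_simp
      ring
    have h2 : 0 ≤ (c * x - 2 * K * C * a) ^ 2 / (2 * c) := by positivity
    linarith
  have s3 : D + 2 * g < A * a ^ 2 - c / 2 * x ^ 2 := by
    have : A * a ^ 2 = K * C ^ 2 * a ^ 2 + 2 * K ^ 2 * C ^ 2 / c * a ^ 2 := by rw [hA]; ring
    linarith
  have hκpos : 0 < κ / 2 := by linarith
  have s4 : κ / 2 * (D + 2 * g) < κ / 2 * (A * a ^ 2 - c / 2 * x ^ 2) :=
    mul_lt_mul_of_pos_left s3 hκpos
  have s5 : κ / 2 * (A * a ^ 2) ≤ κ₁ / 2 * (A * a ^ 2) := by gcongr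
  have s6 : κ₀ / 2 * (c / 2 * x ^ 2) ≤ κ / 2 * (c / 2 * x ^ 2) := by gcongr
  have s7 : k / 2 * (c * a ^ 2) ≤ k / 2 * B := by gcongr
  have s8 : k * τ * (K * a * x) ≤ κ₀ * c / 4 * x ^ 2 + (k * τ * K) ^ 2 / (κ₀ * c) * a ^ 2 := by
    have : κ₀ * c / 4 * x ^ 2 + (k * τ * K) ^ 2 / (κ₀ * c) * a ^ 2 - k * τ * (K * a * x)
        = (κ₀ * c * x - 2 * (k * τ * K) * a) ^ 2 / (4 * (κ₀ * c)) := by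
      field_simp
      ring
    have h2 : 0 ≤ (κ₀ * c * x - 2 * (k * τ * K) * a) ^ 2 / (4 * (κ₀ * c)) := by positivity
    linarith
  have s9 : (k * τ * K) ^ 2 / (κ₀ * c) * a ^ 2 ≤ c / 2 * a ^ 2 := by
    refine mul_le_mul_of_nonneg_right ?_ (sq_nonneg a)
    rw [div_le_iff₀ (by positivity)]
    linarith
  have s10 : k / 2 * (c * a ^ 2) = κ₁ * (A * a ^ 2) + c / 2 * a ^ 2 := by
    calc _ = k * c / 2 * a ^ 2 := by ring
      _ = _ := by rw [hkc]; ring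
  have s11 : 0 ≤ κ₁ * (A * a ^ 2) := by positivity
  linarith

end IsLorentzPatch

/-- A null curve `c`, parametrised over `D` by the time function `ℓ - ℓ y₀`, with a conormal
covector field `P` satisfying the bicharacteristic equation. -/
structure IsNullRay {E : Type*} [NormedAddCommGroup E] [NormedSpace ℝ E]
    (G : E → E →L[ℝ] E →L[ℝ] ℝ) (y₀ : E) (ℓ : E →L[ℝ] ℝ) (r : ℝ) (D : Set ℝ) (c c' : ℝ → E)
    (P P' : ℝ → E →L[ℝ] ℝ) (κ : ℝ → ℝ) (C κ₀ κ₁ : ℝ) : Prop where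
  mem : ∀ s ∈ D, c s ∈ Metric.ball y₀ r
  deriv : ∀ s ∈ D, HasDerivWithinAt c (c' s) D s
  time : ∀ s ∈ D, ℓ (c s) = ℓ y₀ + s
  time_deriv : ∀ s ∈ D, ℓ (c' s) = 1
  null : ∀ s ∈ D, G (c s) (c' s) (c' s) = 0
  conormal : ∀ s ∈ D, ∀ v, P s v = κ s * G (c s) (c' s) v
  deriv_conormal : ∀ s ∈ D, HasDerivWithinAt P (P' s) D s
  deriv_conormal_apply : ∀ s ∈ D, ∀ w, P' s w = κ s / 2 * fderiv ℝ G (c s) w (c' s) (c' s)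
  le_factor : ∀ s ∈ D, κ₀ ≤ κ s
  factor_le : ∀ s ∈ D, κ s ≤ κ₁
  norm_deriv_le : ∀ s ∈ D, ‖c' s‖ ≤ C

/-- The barrier function of a null ray. -/
def nullBarrier {E : Type*} [NormedAddCommGroup E] [NormedSpace ℝ E]
    (G : E → E →L[ℝ] E →L[ℝ] ℝ) (y₀ : E) (ℓ : E →L[ℝ] ℝ) (c : ℝ → E) (P : ℝ → E →L[ℝ] ℝ) (k : ℝ)
    (z : E) : ℝ :=
  P (ℓ z - ℓ y₀) (z - c (ℓ z - ℓ y₀)) -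
    k / 2 * ((ℓ z - ℓ y₀) * G y₀ (z - c (ℓ z - ℓ y₀)) (z - c (ℓ z - ℓ y₀)))

namespace IsLorentzPatch

variable {E : Type*} [NormedAddCommGroup E] [NormedSpace ℝ E]
  {G : E → E →L[ℝ] E →L[ℝ] ℝ} {θ : E → E →L[ℝ] ℝ} {y₀ T : E} {ℓ : E →L[ℝ] ℝ} {r c K : ℝ}

/-- The barrier function of a null ray decreases along timelike curves. -/
theorem exists_nullBarrier_lt (h : IsLorentzPatch G θ y₀ T ℓ r c K) {C κ₀ κ₁ : ℝ} (hC : 0 ≤ C)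
    (hκ₀ : 0 < κ₀) (hκ₁ : 0 ≤ κ₁) :
    ∃ k > (0 : ℝ), ∃ τ > (0 : ℝ), ∀ (D : Set ℝ) (x x' : ℝ → E) (P P' : ℝ → E →L[ℝ] ℝ) (κ : ℝ → ℝ),
      IsNullRay G y₀ ℓ r D x x' P P' κ C κ₀ κ₁ → (∀ s ∈ D, |s| ≤ τ) →
      ∀ (σ : ℝ → E) (a b : ℝ), a < b → (∀ t ∈ Icc a b, σ t ∈ Metric.ball y₀ r) →
        (∀ t ∈ Icc a b, ℓ (σ t) - ℓ y₀ ∈ D) →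
        (∀ t ∈ Icc a b, ∃ v, HasDerivWithinAt σ v (Icc a b) t ∧ G (σ t) v v < 0 ∧ θ (σ t) v < 0) →
        nullBarrier G y₀ ℓ x P k (σ b) < nullBarrier G y₀ ℓ x P k (σ a) := by
  obtain ⟨k, hk, τ, hτ, hbar⟩ := h.exists_barrier_bound hC hκ₀ hκ₁
  refine ⟨k, hk, τ, hτ, fun D x x' P P' κ hx hD σ a b hab hσ hσD hder ↦ ?_⟩
  have key : ∀ t ∈ Icc a b, ∃ d < (0 : ℝ),
      HasDerivWithinAt (fun t ↦ nullBarrier G y₀ ℓ x P k (σ t)) d (Icc a b) t := by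
    intro t ht
    obtain ⟨v, hv, hv1, hv2⟩ := hder t ht
    have hℓv : 0 < ℓ v := by
      have hv0 : v ≠ 0 := by
        rintro rfl
        simp at hv1
      have := h.le_time _ (hσ t ht) v hv1.le hv2
      have := mul_pos h.c_pos (norm_pos_iff.2 hv0)
      linarith
    set s := ℓ (σ t) - ℓ y₀ with hs
    have hsD : s ∈ D := hσD t ht
    have hsder : HasDerivWithinAt (fun t ↦ ℓ (σ t) - ℓ y₀) (ℓ v) (Icc a b) t :=
      (ℓ.hasFDerivAt.comp_hasDerivWithinAt t hv).sub_const _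
    have hxder : HasDerivWithinAt (fun t ↦ x (ℓ (σ t) - ℓ y₀)) (ℓ v • x' s) (Icc a b) t :=
      (hx.deriv s hsD).scomp t hsder hσD
    have hPder : HasDerivWithinAt (fun t ↦ P (ℓ (σ t) - ℓ y₀)) (ℓ v • P' s) (Icc a b) t :=
      HasDerivWithinAt.scomp (g₁ := P) (h := fun t ↦ ℓ (σ t) - ℓ y₀) t
        (hx.deriv_conormal s hsD) hsder hσD
    have hwder : HasDerivWithinAt (fun t ↦ σ t - x (ℓ (σ t) - ℓ y₀)) (v - ℓ v • x' s)
      (Icc a b) t := hv.sub hxder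
    set w := σ t - x s with hw
    -- With the velocity rescaled to unit time rate, X is its deviation from the ray velocity. It is
    -- transverse because both have ℓ = 1.
    set X := (ℓ v)⁻¹ • v - x' s with hX
    have hvX : v - ℓ v • x' s = ℓ v • X := by
      rw [hX, smul_sub, smul_smul, mul_inv_cancel₀ hℓv.ne', one_smul]
    rw [hvX] at hwder
    have hGder : HasDerivWithinAt (fun t ↦ G y₀ (σ t - x (ℓ (σ t) - ℓ y₀))
        (σ t - x (ℓ (σ t) - ℓ y₀))) (G y₀ (ℓ v • X) w + G y₀ w (ℓ v • X)) (Icc a b) t :=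
      ((G y₀).hasFDerivAt.comp_hasDerivWithinAt t hwder).clm_apply hwder
    have htot := (hPder.clm_apply hwder).sub ((hsder.mul hGder).const_mul (k / 2))
    refine ⟨_, ?_, htot⟩
    have hℓw : ℓ w = 0 := by
      rw [hw, map_sub, hx.time s hsD, hs]
      ring
    have hℓX : ℓ X = 0 := by
      rw [hX, map_sub, map_smul, hx.time_deriv s hsD, smul_eq_mul, inv_mul_cancel₀ hℓv.ne',
        sub_self]
    have hneg : G (σ t) (x' s + X) (x' s + X) < 0 := by
      have : x' s + X = (ℓ v)⁻¹ • v := by rw [hX]; abel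
      rw [this]
      simp only [map_smul, smul_apply, smul_eq_mul]
      have : 0 < (ℓ v)⁻¹ := inv_pos.2 hℓv
      exact mul_neg_of_pos_of_neg this (mul_neg_of_pos_of_neg this hv1)
    have hfin := hbar (x s) (hx.mem s hsD) (σ t) (hσ t ht) (x' s) X (κ s) s (hD s hsD) hℓw hℓX
      (hx.norm_deriv_le s hsD) (hx.null s hsD) (hx.le_factor s hsD) (hx.factor_le s hsD) hneg
    rw [← hw] at hfin
    have e1 := hx.deriv_conormal_apply s hsD w
    have e2 := hx.conormal s hsD X
    have e3 := h.symm y₀ X w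
    have := mul_neg_of_pos_of_neg hℓv hfin
    change (ℓ v • P' s) w + P s (ℓ v • X) - k / 2 * (ℓ v * G y₀ w w
      + s * (G y₀ (ℓ v • X) w + G y₀ w (ℓ v • X))) < 0
    simp only [smul_apply, map_smul, smul_eq_mul, e1, e2, e3]
    linarith
  choose! d hd hder' using key
  have hanti : StrictAntiOn (fun t ↦ nullBarrier G y₀ ℓ x P k (σ t)) (Icc a b) := by
    refine strictAntiOn_of_hasDerivWithinAt_neg (convex_Icc a b)
      (fun t ht ↦ (hder' t ht).continuousWithinAt)
      (fun t ht ↦ (hder' t (interior_subset ht)).mono interior_subset)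
      fun t ht ↦ hd t (interior_subset ht)
  exact hanti (left_mem_Icc.2 hab.le) (right_mem_Icc.2 hab.le) hab

end IsLorentzPatch

/-! ### Flows with uniform Taylor estimates -/

/-- The mean value inequality is applied twice, without seeking the optimal factor 1/2. -/
theorem norm_le_mul_sq_of_second_deriv {Z : Type*} [NormedAddCommGroup Z] [NormedSpace ℝ Z]
    {f f' f'' : ℝ → Z} {τ B : ℝ} (hf : ∀ t ∈ Icc (-τ) τ, HasDerivWithinAt f (f' t) (Icc (-τ) τ) t)
    (hf' : ∀ t ∈ Icc (-τ) τ, HasDerivWithinAt f' (f'' t) (Icc (-τ) τ) t) (h0 : f 0 = 0)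
    (h0' : f' 0 = 0) (hB : ∀ t ∈ Icc (-τ) τ, ‖f'' t‖ ≤ B) {t : ℝ} (ht : t ∈ Icc (-τ) τ) :
    ‖f' t‖ ≤ B * |t| ∧ ‖f t‖ ≤ B * t ^ 2 := by
  have h0τ : (0 : ℝ) ∈ Icc (-τ) τ := ⟨by linarith [ht.1, ht.2], by linarith [ht.1, ht.2]⟩
  have hB0 : 0 ≤ B := (norm_nonneg _).trans (hB 0 h0τ)
  have h1 : ∀ s ∈ Icc (-τ) τ, ‖f' s‖ ≤ B * |s| := by
    intro s hs
    have := (convex_Icc (-τ) τ).norm_image_sub_le_of_norm_hasDerivWithin_le hf' hB h0τ hs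
    rwa [h0', sub_zero, sub_zero, Real.norm_eq_abs] at this
  have hsub : Icc (-|t|) |t| ⊆ Icc (-τ) τ := by
    have : |t| ≤ τ := abs_le.2 ht
    exact Icc_subset_Icc (by linarith) this
  have h2 := (convex_Icc (-|t|) |t|).norm_image_sub_le_of_norm_hasDerivWithin_le (f := f)
    (f' := f') (C := B * |t|) (fun s hs ↦ (hf s (hsub hs)).mono hsub)
    (fun s hs ↦ (h1 s (hsub hs)).trans (mul_le_mul_of_nonneg_left (abs_le.2 hs) hB0))
    (x := 0) (y := t) ⟨by simp, by simp⟩ ⟨neg_abs_le t, le_abs_self t⟩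
  rw [h0, sub_zero, sub_zero, Real.norm_eq_abs, mul_assoc, abs_mul_abs_self, ← pow_two] at h2
  exact ⟨h1 t ht, h2⟩

/-- Compact support makes V and F = DV·V globally bounded and Lipschitz, so the flow exists on all
of [-1, 1]. The second time derivative of a trajectory is F along it, which gives the quadratic
Taylor bounds. The last one also uses the Lipschitz dependence of the flow on initial data: the
remainder is Lipschitz in the starting point with constant O(t²). -/
theorem exists_flow_taylor_of_hasCompactSupport {Z : Type*} [NormedAddCommGroup Z]
    [NormedSpace ℝ Z] [CompleteSpace Z] {V : Z → Z} (hV : ContDiff ℝ ∞ V)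
    (hVc : HasCompactSupport V) (R : ℝ) :
    ∃ B > (0 : ℝ), ∃ α : Z → ℝ → Z, ∀ z ∈ Metric.closedBall (0 : Z) R,
      α z 0 = z ∧ (∀ t ∈ Icc (-1 : ℝ) 1, HasDerivWithinAt (α z) (V (α z t)) (Icc (-1) 1) t ∧
        ‖α z t - z‖ ≤ B * |t| ∧ ‖V (α z t) - V z‖ ≤ B * |t| ∧
        ‖α z t - z - t • V z‖ ≤ B * t ^ 2 ∧
        ∀ w ∈ Metric.closedBall (0 : Z) R,
          ‖(α z t - z - t • V z) - (α w t - w - t • V w)‖ ≤ B * ‖z - w‖ * t ^ 2) ∧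
      ContDiffOn ℝ ∞ (α z) (Icc (-1) 1) := by
  set F : Z → Z := fun z ↦ fderiv ℝ V z (V z) with hF
  have hFd : ContDiff ℝ ∞ F := (hV.fderiv_right (m := ∞) (by simp)).clm_apply hV
  have hFc : HasCompactSupport F := hVc.mono fun z hz hz0 ↦ hz (by
    rw [hF]
    simp only
    rw [show V z = 0 from hz0, map_zero])
  obtain ⟨K, hK⟩ := hV.lipschitzWith_of_hasCompactSupport hVc (by simp)
  obtain ⟨K', hK'⟩ := hFd.lipschitzWith_of_hasCompactSupport hFc (by simp)
  obtain ⟨L, hL⟩ := hV.continuous.bounded_above_of_compact_support hVc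
  obtain ⟨L', hL'⟩ := hFd.continuous.bounded_above_of_compact_support hFc
  have hL0 : 0 ≤ L := (norm_nonneg _).trans (hL 0)
  have hL0' : 0 ≤ L' := (norm_nonneg _).trans (hL' 0)
  have hpic : IsPicardLindelof (fun _ ↦ V) (tmin := -1) (tmax := 1) ⟨0, by simp⟩ (0 : Z)
      (R.toNNReal + L.toNNReal) R.toNNReal L.toNNReal K := by
    refine .of_time_independent (fun x _ ↦ ?_) hK.lipschitzOnWith ?_
    · rw [Real.coe_toNNReal _ hL0]
      exact hL x
    · simp
  obtain ⟨α, hα, Λ, hΛ⟩ := hpic.exists_forall_mem_closedBall_eq_hasDerivWithinAt_lipschitzOnWith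
  have hsub : Metric.closedBall (0 : Z) R ⊆ Metric.closedBall 0 R.toNNReal :=
    Metric.closedBall_subset_closedBall (Real.le_coe_toNNReal R)
  refine ⟨L + L' + K' * Λ + 1, by positivity, α, fun z hz ↦ ?_⟩
  have h01 : (0 : ℝ) ∈ Icc (-1 : ℝ) 1 := by simp
  have hαV : ∀ z ∈ Metric.closedBall (0 : Z) R, ∀ t ∈ Icc (-1 : ℝ) 1,
      HasDerivWithinAt (fun t ↦ V (α z t)) (F (α z t)) (Icc (-1) 1) t := fun z hz t ht ↦
    ((hV.differentiable (by simp)) _).hasFDerivAt.comp_hasDerivWithinAt t ((hα z (hsub hz)).2 t ht)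
  have hrem : ∀ z ∈ Metric.closedBall (0 : Z) R, ∀ t ∈ Icc (-1 : ℝ) 1,
      HasDerivWithinAt (fun t ↦ α z t - z - t • V z) (V (α z t) - V z) (Icc (-1) 1) t := by
    intro z hz t ht
    have h1 : HasDerivWithinAt (fun t : ℝ ↦ t • V z) (V z) (Icc (-1) 1) t := by
      simpa using ((hasDerivAt_id t).smul_const (V z)).hasDerivWithinAt
    exact (((hα z (hsub hz)).2 t ht).sub_const z).sub h1
  have hα0 : ∀ z ∈ Metric.closedBall (0 : Z) R, α z 0 = z := fun z hz ↦ (hα z (hsub hz)).1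
  refine ⟨hα0 z hz, fun t ht ↦ ⟨(hα z (hsub hz)).2 t ht, ?_, ?_, ?_, fun w hw ↦ ?_⟩, ?_⟩
  · have := (convex_Icc (-1 : ℝ) 1).norm_image_sub_le_of_norm_hasDerivWithin_le
      (hα z (hsub hz)).2 (fun s _ ↦ hL _) h01 ht
    rw [hα0 z hz, sub_zero, Real.norm_eq_abs] at this
    refine this.trans ?_
    gcongr
    have : 0 ≤ (K' : ℝ) * Λ := by positivity
    linarith
  · refine (norm_le_mul_sq_of_second_deriv (hrem z hz)
      (fun s hs ↦ (hαV z hz s hs).sub_const (V z)) ?_ ?_ (fun s _ ↦ hL' _) ht).1.trans ?_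
    · rw [hα0 z hz, zero_smul, sub_self, sub_zero]
    · rw [hα0 z hz, sub_self]
    · gcongr
      have : 0 ≤ (K' : ℝ) * Λ := by positivity
      linarith
  · refine (norm_le_mul_sq_of_second_deriv (hrem z hz)
      (fun s hs ↦ (hαV z hz s hs).sub_const (V z)) ?_ ?_ (fun s _ ↦ hL' _) ht).2.trans ?_
    · rw [hα0 z hz, zero_smul, sub_self, sub_zero]
    · rw [hα0 z hz, sub_self]
    · gcongr
      have : 0 ≤ (K' : ℝ) * Λ := by positivity
      linarith
  · refine (norm_le_mul_sq_of_second_deriv (B := K' * Λ * ‖z - w‖)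
      (fun s hs ↦ (hrem z hz s hs).sub (hrem w hw s hs))
      (fun s hs ↦ ((hαV z hz s hs).sub_const (V z)).sub ((hαV w hw s hs).sub_const (V w)))
      ?_ ?_ (fun s hs ↦ ?_) ht).2.trans ?_
    · simp only [Pi.sub_apply]
      rw [hα0 z hz, hα0 w hw, zero_smul, zero_smul, sub_self, sub_zero, sub_self, sub_zero,
        sub_self]
    · rw [hα0 z hz, hα0 w hw, sub_self, sub_self, sub_self]
    · have h1 := hK'.dist_le_mul (α z s) (α w s)
      have h2 := (hΛ s hs).dist_le_mul z (hsub hz) w (hsub hw)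
      rw [dist_eq_norm, dist_eq_norm] at h1 h2
      calc _ ≤ _ := h1
        _ ≤ K' * (Λ * ‖z - w‖) := by gcongr
        _ = _ := by ring
    · gcongr
      linarith
  · exact ODE.contDiffOn_enat_Icc_of_hasDerivWithinAt (f := fun _ ↦ V) (u := univ) (n := ⊤)
      ((hV.comp contDiff_snd).contDiffOn) (hα z (hsub hz)).2 (mapsTo_univ _ _)

/-- V is cut off by a function that equals 1 near S. Over a short time the trajectories from S stay
where nothing was changed. -/
theorem exists_flow_taylor {Z : Type*} [NormedAddCommGroup Z] [NormedSpace ℝ Z]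
    [FiniteDimensional ℝ Z] {V : Z → Z} {Ω S : Set Z} (hΩ : IsOpen Ω) (hV : ContDiffOn ℝ ∞ V Ω)
    (hS : IsCompact S) (hSΩ : S ⊆ Ω) :
    ∃ B > (0 : ℝ), ∃ τ > (0 : ℝ), ∃ α : Z → ℝ → Z, ∀ z ∈ S,
      α z 0 = z ∧ (∀ t ∈ Icc (-τ) τ, α z t ∈ Ω ∧
        HasDerivWithinAt (α z) (V (α z t)) (Icc (-τ) τ) t ∧
        ‖α z t - z‖ ≤ B * |t| ∧ ‖V (α z t) - V z‖ ≤ B * |t| ∧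
        ‖α z t - z - t • V z‖ ≤ B * t ^ 2 ∧
        ∀ w ∈ S, ‖(α z t - z - t • V z) - (α w t - w - t • V w)‖ ≤ B * ‖z - w‖ * t ^ 2) ∧
      ContDiffOn ℝ ∞ (α z) (Icc (-τ) τ) := by
  have : CompleteSpace Z := FiniteDimensional.complete ℝ Z
  have : ProperSpace Z := FiniteDimensional.proper ℝ Z
  obtain ⟨δ, hδ, hδΩ⟩ := hS.exists_cthickening_subset_open hΩ hSΩ
  obtain ⟨χ, hχ, -, hχs, hχ1⟩ := exists_contMDiff_support_eq_eq_one_iff 𝓘(ℝ, Z) (n := ⊤)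
    (Metric.isOpen_thickening (δ := δ) (E := S)) (Metric.isClosed_cthickening (δ := δ / 2) (E := S))
    (Metric.cthickening_subset_thickening' hδ (by linarith) S)
  have hχ : ContDiff ℝ ∞ χ := hχ.contDiff
  have hts : tsupport χ ⊆ Metric.cthickening δ S := by
    rw [tsupport, hχs]
    exact Metric.closure_thickening_subset_cthickening δ S
  have hχc : HasCompactSupport χ :=
    (hS.isBounded.cthickening.isCompact_closure.of_isClosed_subset (isClosed_tsupport χ)
      (hts.trans subset_closure))
  have hW : ContDiff ℝ ∞ fun z ↦ χ z • V z := by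
    rw [contDiff_iff_contDiffAt]
    intro z
    by_cases hz : z ∈ tsupport χ
    · exact hχ.contDiffAt.smul (hV.contDiffAt (hΩ.mem_nhds (hδΩ (hts hz))))
    · refine (contDiffAt_const (c := (0 : Z))).congr_of_eventuallyEq ?_
      filter_upwards [(isClosed_tsupport χ).isOpen_compl.mem_nhds hz] with y hy
      rw [image_eq_zero_of_notMem_tsupport hy, zero_smul]
  obtain ⟨R, hR⟩ := hS.isBounded.subset_closedBall 0
  obtain ⟨B, hB, α, hα⟩ := exists_flow_taylor_of_hasCompactSupport hW hχc.smul_right R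
  have heq : ∀ z ∈ Metric.cthickening (δ / 2) S, χ z • V z = V z := fun z hz ↦ by
    rw [(hχ1 z).1 hz, one_smul]
  have hsub : Metric.cthickening (δ / 2) S ⊆ Ω :=
    (Metric.cthickening_mono (by linarith) S).trans hδΩ
  have hSs : S ⊆ Metric.cthickening (δ / 2) S := Metric.self_subset_cthickening S
  obtain ⟨τ, hτ, hτ1, hτB⟩ : ∃ τ > (0 : ℝ), τ ≤ 1 ∧ B * τ ≤ δ / 2 :=
    ⟨min 1 (δ / 2 / B), by positivity, min_le_left _ _,
      (mul_le_mul_of_nonneg_left (min_le_right _ _) hB.le).trans (mul_div_cancel₀ _ hB.ne').le⟩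
  have hI : Icc (-τ) τ ⊆ Icc (-1 : ℝ) 1 := Icc_subset_Icc (by linarith) hτ1
  refine ⟨B, hB, τ, hτ, α, fun z hz ↦ ?_⟩
  obtain ⟨h1, h2, h3⟩ := hα z (hR hz)
  refine ⟨h1, fun t ht ↦ ?_, h3.mono hI⟩
  obtain ⟨k1, k2, k5, k3, k4⟩ := h2 t (hI ht)
  have hmem : α z t ∈ Metric.cthickening (δ / 2) S := by
    refine Metric.mem_cthickening_of_dist_le _ z _ _ hz ?_
    rw [dist_eq_norm]
    refine k2.trans (le_trans ?_ hτB)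
    gcongr
    exact abs_le.2 ht
  rw [heq _ hmem] at k1 k5
  simp only [heq _ (hSs hz)] at k3 k4 k5
  refine ⟨hsub hmem, k1.mono hI, k2, k5, k3, fun w hw ↦ ?_⟩
  have := k4 w (hR hw)
  rwa [heq _ (hSs hw)] at this

/-! ### Existence of null rays -/

/-- A family of null rays from `y₀` in all null directions `T + m`, with uniform Taylor
estimates. -/
def IsNullRayFamily {E : Type*} [NormedAddCommGroup E] [NormedSpace ℝ E]
    (G : E → E →L[ℝ] E →L[ℝ] ℝ) (y₀ T : E) (ℓ : E →L[ℝ] ℝ) (r : ℝ) (x x' : E → ℝ → E)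
    (P P' : E → ℝ → E →L[ℝ] ℝ) (κ : E → ℝ → ℝ) (C B τ : ℝ) : Prop :=
  ∀ m, ℓ m = 0 → G y₀ m m = 1 →
    IsNullRay G y₀ ℓ r (Icc (-τ) τ) (x m) (x' m) (P m) (P' m) (κ m) C (1 / 2) 2 ∧
    x m 0 = y₀ ∧ ContDiffOn ℝ ∞ (x m) (Icc (-τ) τ) ∧
    ∀ t ∈ Icc (-τ) τ, ‖x' m t - (T + m)‖ ≤ B * |t| ∧
      ‖x m t - y₀ - t • (T + m)‖ ≤ B * t ^ 2 ∧
      ∀ m', ℓ m' = 0 → G y₀ m' m' = 1 →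
        ‖(x m t - t • m) - (x m' t - t • m')‖ ≤ B * ‖m - m'‖ * t ^ 2

namespace IsLorentzPatch

variable {E : Type*} [NormedAddCommGroup E] [NormedSpace ℝ E] [FiniteDimensional ℝ E]
  {G : E → E →L[ℝ] E →L[ℝ] ℝ} {θ : E → E →L[ℝ] ℝ} {y₀ T : E} {ℓ : E →L[ℝ] ℝ} {r c K : ℝ}

/-- If u = aT + w is in the kernel, testing on w and T gives G(w, w) = a²G(T, T). The left side is
nonnegative and the right side nonpositive, so w = 0 and a = 0. Equality of dimensions does the
rest. -/
theorem isInvertible (h : IsLorentzPatch G θ y₀ T ℓ r c K) {y : E} (hy : y ∈ Metric.ball y₀ r) :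
    (G y).IsInvertible := by
  have hinj : Function.Injective (G y : E →ₗ[ℝ] E →L[ℝ] ℝ) := by
    rw [← LinearMap.ker_eq_bot, LinearMap.ker_eq_bot']
    intro u hu
    have hu : ∀ v, G y u v = 0 := fun v ↦ by
      have : G y u = 0 := hu
      rw [this, zero_apply]
    set a := ℓ u
    set w := u - a • T with hw
    have hℓw : ℓ w = 0 := by
      rw [hw, map_sub, map_smul, h.time_T, smul_eq_mul, mul_one, sub_self]
    have huw : u = a • T + w := by rw [hw]; abel
    have h1 := hu w
    have h2 := hu T
    have h3 := h.pos y hy w hℓw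
    have h4 := h.timelike y hy
    have h5 := h.symm y w T
    rw [huw] at h1 h2
    simp only [map_add, map_smul, add_apply, smul_apply, smul_eq_mul] at h1 h2
    rw [h5] at h2
    have h6 : G y w w = a ^ 2 * G y T T := by linear_combination h1 - a * h2
    have h7 : a ^ 2 * G y T T ≤ 0 := mul_nonpos_of_nonneg_of_nonpos (sq_nonneg a) h4.le
    have hw0 : w = 0 := by
      have : c * ‖w‖ ^ 2 ≤ 0 := by linarith
      have h8 : ‖w‖ ^ 2 ≤ 0 := nonpos_of_mul_nonpos_right this h.c_pos
      have h9 : ‖w‖ = 0 := by nlinarith [norm_nonneg w]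
      exact norm_eq_zero.1 h9
    have ha : a = 0 := by
      rw [hw0, map_zero] at h6
      have := (mul_eq_zero.1 h6.symm).resolve_right h4.ne
      exact pow_eq_zero_iff two_ne_zero |>.1 this
    rw [huw, hw0, ha, zero_smul, zero_add]
  have hrank : Module.finrank ℝ E = Module.finrank ℝ (E →L[ℝ] ℝ) := by
    rw [← (LinearMap.toContinuousLinearMap : (E →ₗ[ℝ] ℝ) ≃ₗ[ℝ] E →L[ℝ] ℝ).finrank_eq]
    exact (Subspace.dual_finrank_eq (K := ℝ) (V := E)).symm
  exact ⟨(LinearEquiv.ofInjectiveOfFinrankEq _ hinj hrank).toContinuousLinearEquiv, by ext; rfl⟩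

theorem smooth_at (h : IsLorentzPatch G θ y₀ T ℓ r c K) {y : E} (hy : y ∈ Metric.ball y₀ r) :
    ContDiffAt ℝ ∞ G y :=
  h.smooth.contDiffAt (Metric.isOpen_ball.mem_nhds hy)

theorem hasFDerivAt (h : IsLorentzPatch G θ y₀ T ℓ r c K) {y : E} (hy : y ∈ Metric.ball y₀ r) :
    HasFDerivAt G (fderiv ℝ G y) y :=
  ((h.smooth_at hy).differentiableAt (by simp)).hasFDerivAt

theorem fderiv_apply_apply (h : IsLorentzPatch G θ y₀ T ℓ r c K) {y : E}
    (hy : y ∈ Metric.ball y₀ r) (u v w : E) :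
    fderiv ℝ (fun z ↦ G z u v) y w = fderiv ℝ G y w u v := by
  have h1 : HasFDerivAt (fun z ↦ G z u) _ y := (h.hasFDerivAt hy).clm_apply (hasFDerivAt_const u y)
  have h2 := h1.clm_apply (hasFDerivAt_const v y)
  rw [h2.fderiv]
  simp

/-- The vector dual to a covector. -/
theorem contDiffAt_inverse (h : IsLorentzPatch G θ y₀ T ℓ r c K) {z : E × (E →L[ℝ] ℝ)}
    (hz : z.1 ∈ Metric.ball y₀ r) :
    ContDiffAt ℝ ∞ (fun z : E × (E →L[ℝ] ℝ) ↦ (G z.1).inverse z.2) z := by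
  have : CompleteSpace E := FiniteDimensional.complete ℝ E
  have h1 : ContDiffAt ℝ ∞ (fun z : E × (E →L[ℝ] ℝ) ↦ G z.1) z :=
    ContDiffAt.comp z (g := G) (h.smooth_at hz) contDiffAt_fst
  have h2 : ContDiffAt ℝ ∞ (fun z : E × (E →L[ℝ] ℝ) ↦ (G z.1).inverse) z :=
    ContDiffAt.comp z (g := ContinuousLinearMap.inverse)
      (h.isInvertible hz).contDiffAt_map_inverse h1
  exact h2.clm_apply contDiffAt_snd

/-- This is the Hamiltonian field of the geodesic flow on the cotangent space, with U the vector
dual to the covector, divided by ℓ(U) so that trajectories are parametrized by the time function. -/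
theorem contDiffAt_geodesicField (h : IsLorentzPatch G θ y₀ T ℓ r c K) {z : E × (E →L[ℝ] ℝ)}
    (hz : z.1 ∈ Metric.ball y₀ r) (hz' : ℓ ((G z.1).inverse z.2) ≠ 0) :
    ContDiffAt ℝ ∞ (fun z : E × (E →L[ℝ] ℝ) ↦
      ((ℓ ((G z.1).inverse z.2))⁻¹ • (G z.1).inverse z.2,
        (2 * ℓ ((G z.1).inverse z.2))⁻¹ •
          fderiv ℝ (fun y ↦ G y ((G z.1).inverse z.2) ((G z.1).inverse z.2)) z.1)) z := by
  have hU := h.contDiffAt_inverse hz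
  have hℓ : ContDiffAt ℝ ∞ (fun z : E × (E →L[ℝ] ℝ) ↦ ℓ ((G z.1).inverse z.2)) z :=
    ℓ.contDiff.contDiffAt.comp z hU
  refine ((hℓ.inv hz').smul hU).prodMk
    (((contDiffAt_const.mul hℓ).inv (mul_ne_zero two_ne_zero hz')).smul ?_)
  refine ContDiffAt.fderiv (n := ∞) (f := fun (z : E × (E →L[ℝ] ℝ)) (y : E) ↦
    G y ((G z.1).inverse z.2) ((G z.1).inverse z.2)) ?_ contDiffAt_fst (by simp)
  have h1 : ContDiffAt ℝ ∞ (fun q : (E × (E →L[ℝ] ℝ)) × E ↦ G q.2) (z, z.1) :=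
    ContDiffAt.comp (z, z.1) (g := G) (h.smooth_at hz) contDiffAt_snd
  have h2 : ContDiffAt ℝ ∞ (fun q : (E × (E →L[ℝ] ℝ)) × E ↦ (G q.1.1).inverse q.1.2) (z, z.1) :=
    ContDiffAt.comp (z, z.1) (f := Prod.fst) hU contDiffAt_fst
  exact (h1.clm_apply h2).clm_apply h2

theorem norm_le_of_unit (h : IsLorentzPatch G θ y₀ T ℓ r c K) {m : E} (hm : ℓ m = 0)
    (hm' : G y₀ m m = 1) : ‖m‖ ≤ 1 / c + 1 := by
  have h1 := h.pos y₀ h.mem_center m hm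
  have hc := h.c_pos
  rw [hm', mul_comm, ← le_div_iff₀ hc] at h1
  nlinarith [norm_nonneg m]

theorem center_apply_T (h : IsLorentzPatch G θ y₀ T ℓ r c K) (v : E) : G y₀ T v = - ℓ v := by
  rw [h.time_eq, neg_neg]

theorem center_apply_T' (h : IsLorentzPatch G θ y₀ T ℓ r c K) (v : E) : G y₀ v T = - ℓ v := by
  rw [h.symm, h.center_apply_T]

/-- There are null rays from `y₀` in all null directions. -/
theorem exists_null_rays (h : IsLorentzPatch G θ y₀ T ℓ r c K) :
    ∃ C > (0 : ℝ), ∃ B > (0 : ℝ), ∃ τ > (0 : ℝ), ∃ (x x' : E → ℝ → E) (P P' : E → ℝ → E →L[ℝ] ℝ)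
      (κ : E → ℝ → ℝ), IsNullRayFamily G y₀ T ℓ r x x' P P' κ C B τ := by
  have : ProperSpace E := FiniteDimensional.proper ℝ E
  set U : E × (E →L[ℝ] ℝ) → E := fun z ↦ (G z.1).inverse z.2 with hU
  have hGU : ∀ z : E × (E →L[ℝ] ℝ), z.1 ∈ Metric.ball y₀ r → G z.1 (U z) = z.2 := fun z hz ↦
    (h.isInvertible hz).self_apply_inverse z.2
  set V : E × (E →L[ℝ] ℝ) → E × (E →L[ℝ] ℝ) := fun z ↦
    ((ℓ (U z))⁻¹ • U z, (2 * ℓ (U z))⁻¹ • fderiv ℝ (fun y ↦ G y (U z) (U z)) z.1) with hV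
  set N : Set E := {m | ℓ m = 0 ∧ G y₀ m m = 1} with hN
  set z₀ : E → E × (E →L[ℝ] ℝ) := fun m ↦ (y₀, G y₀ (T + m)) with hz₀
  have hUz₀ : ∀ m, U (z₀ m) = T + m := fun m ↦
    (h.isInvertible h.mem_center).inverse_apply_eq.2 rfl
  set C₀ : ℝ := ‖T‖ + (1 / c + 1) + 1 with hC₀
  have hc := h.c_pos
  have hC₀pos : 0 < C₀ := by positivity
  -- The flow estimate keeps trajectories in Ω, so the inequalities in its definition become the
  -- uniform bounds of the null rays: κ = ℓ(U) between 1/2 and 2, and velocity U/ℓ(U) of norm at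
  -- most 2C₀.
  set Ω : Set (E × (E →L[ℝ] ℝ)) := {z | z.1 ∈ Metric.ball y₀ r} ∩
    {z | U z ∈ {u | 1 / 2 < ℓ u ∧ ℓ u < 2 ∧ ‖u‖ < C₀}} with hΩdef
  have hUc : ContinuousOn U {z : E × (E →L[ℝ] ℝ) | z.1 ∈ Metric.ball y₀ r} := fun z hz ↦
    (h.contDiffAt_inverse hz).continuousAt.continuousWithinAt
  have hΩ : IsOpen Ω := by
    refine hUc.isOpen_inter_preimage (Metric.isOpen_ball.preimage continuous_fst) ?_
    exact (isOpen_lt continuous_const ℓ.continuous).inter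
      ((isOpen_lt ℓ.continuous continuous_const).inter (isOpen_lt continuous_norm continuous_const))
  have hVs : ContDiffOn ℝ ∞ V Ω := fun z hz ↦
    (h.contDiffAt_geodesicField hz.1 (by have := hz.2.1; change ℓ (U z) ≠ 0; linarith)
      ).contDiffWithinAt
  have hNc : IsCompact N := by
    refine Metric.isCompact_of_isClosed_isBounded ?_ ?_
    · exact (isClosed_eq ℓ.continuous continuous_const).inter
        (isClosed_eq (by fun_prop) continuous_const)
    · refine (Metric.isBounded_closedBall (x := (0 : E)) (r := 1 / c + 1)).subset fun m hm ↦ ?_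
      rw [mem_closedBall_zero_iff]
      exact h.norm_le_of_unit hm.1 hm.2
  have hS : IsCompact (z₀ '' N) := hNc.image (by fun_prop)
  have hℓTm : ∀ m ∈ N, ℓ (T + m) = 1 := fun m hm ↦ by
    rw [map_add, h.time_T, hm.1, add_zero]
  have hSΩ : z₀ '' N ⊆ Ω := by
    rintro _ ⟨m, hm, rfl⟩
    refine ⟨h.mem_center, ?_⟩
    change 1 / 2 < ℓ (U (z₀ m)) ∧ ℓ (U (z₀ m)) < 2 ∧ ‖U (z₀ m)‖ < C₀
    rw [hUz₀]
    refine ⟨?_, ?_, ?_⟩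
    · rw [hℓTm m hm]; norm_num
    · rw [hℓTm m hm]; norm_num
    · have := norm_add_le T m
      have := h.norm_le_of_unit hm.1 hm.2
      linarith
  have hVz₀ : ∀ m ∈ N, (V (z₀ m)).1 = T + m := fun m hm ↦ by
    change (ℓ (U (z₀ m)))⁻¹ • U (z₀ m) = _
    rw [hUz₀, hℓTm m hm, inv_one, one_smul]
  obtain ⟨B, hB, τ, hτ, α, hα⟩ := exists_flow_taylor hΩ hVs hS hSΩ
  have hK := h.K_pos
  refine ⟨2 * C₀, by positivity, B * (1 + K), by positivity, τ, hτ, fun m t ↦ (α (z₀ m) t).1,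
    fun m t ↦ (V (α (z₀ m) t)).1, fun m t ↦ (α (z₀ m) t).2, fun m t ↦ (V (α (z₀ m) t)).2,
    fun m t ↦ ℓ (U (α (z₀ m) t)), fun m hm hm' ↦ ?_⟩
  have hmN : m ∈ N := ⟨hm, hm'⟩
  obtain ⟨h0, ht, hsm⟩ := hα (z₀ m) (mem_image_of_mem _ hmN)
  set z := α (z₀ m) with hz
  set D := Icc (-τ) τ with hD
  have hud : ∀ t ∈ D, UniqueDiffWithinAt ℝ D t := uniqueDiffOn_Icc (by linarith)
  have h0D : (0 : ℝ) ∈ D := ⟨by linarith, hτ.le⟩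
  have d1 : ∀ t ∈ D, HasDerivWithinAt (fun t ↦ (z t).1) (V (z t)).1 D t := fun t htD ↦
    (ht t htD).2.1.fst
  have d2 : ∀ t ∈ D, HasDerivWithinAt (fun t ↦ (z t).2) (V (z t)).2 D t := fun t htD ↦
    (ht t htD).2.1.snd
  have hℓU : ∀ t ∈ D, 0 < ℓ (U (z t)) := fun t htD ↦ by
    have := (ht t htD).1.2.1
    linarith
  have hℓV : ∀ t ∈ D, ℓ (V (z t)).1 = 1 := fun t htD ↦ by
    change ℓ ((ℓ (U (z t)))⁻¹ • U (z t)) = 1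
    rw [map_smul, smul_eq_mul, inv_mul_cancel₀ (hℓU t htD).ne']
  have hVsnd : ∀ t ∈ D, ∀ w, (V (z t)).2 w =
      (2 * ℓ (U (z t)))⁻¹ * fderiv ℝ G (z t).1 w (U (z t)) (U (z t)) := fun t htD w ↦ by
    change ((2 * ℓ (U (z t)))⁻¹ • fderiv ℝ (fun y ↦ G y (U (z t)) (U (z t))) (z t).1) w = _
    rw [smul_apply, smul_eq_mul, h.fderiv_apply_apply (ht t htD).1.1]
  -- Conservation of the Hamiltonian. Differentiating G(U) = p yields the derivative of U paired
  -- with p, which cancels the derivative of p paired with U; the initial value G(T + m, T + m) is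
  -- -1 + 1 = 0.
  have hnull : ∀ t ∈ D, (z t).2 (U (z t)) = 0 := by
    have hd : ∀ t ∈ D, HasDerivWithinAt (fun t ↦ (z t).2 (U (z t))) 0 D t := by
      intro t htD
      have hzt := (ht t htD).1.1
      have dU : HasDerivWithinAt (fun t ↦ U (z t)) _ D t :=
        ((h.contDiffAt_inverse hzt).differentiableAt (by simp)).hasFDerivAt.comp_hasDerivWithinAt t
          (ht t htD).2.1
      set u' := fderiv ℝ U (z t) (V (z t)) with hu'
      have dG : HasDerivWithinAt (fun t ↦ G (z t).1) (fderiv ℝ G (z t).1 (V (z t)).1) D t :=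
        HasFDerivAt.comp_hasDerivWithinAt (l := G) (f := fun t ↦ (z t).1) t (h.hasFDerivAt hzt)
          (d1 t htD)
      have dGU := dG.clm_apply dU
      have d2' := (d2 t htD).congr (f₁ := fun t ↦ G (z t).1 (U (z t)))
        (fun s hs ↦ hGU _ (ht s hs).1.1) (hGU _ hzt)
      have heq := (hud t htD).eq_deriv _ dGU d2'
      have htot := (d2 t htD).clm_apply dU
      refine htot.congr_deriv ?_
      have e1 := hVsnd t htD (U (z t))
      have e2 := congrArg (fun f : E →L[ℝ] ℝ ↦ f (U (z t))) heq
      simp only [add_apply] at e2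
      have e3 : (z t).2 u' = G (z t).1 u' (U (z t)) := by
        rw [← hGU _ hzt, h.symm]
      have e4 : fderiv ℝ G (z t).1 (V (z t)).1 (U (z t)) (U (z t)) =
          (ℓ (U (z t)))⁻¹ * fderiv ℝ G (z t).1 (U (z t)) (U (z t)) (U (z t)) := by
        change fderiv ℝ G (z t).1 ((ℓ (U (z t)))⁻¹ • U (z t)) (U (z t)) (U (z t)) = _
        simp only [map_smul, smul_apply, smul_eq_mul]
      have e5 : (2 * ℓ (U (z t)))⁻¹ = (ℓ (U (z t)))⁻¹ / 2 := by
        rw [mul_inv]; ring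
      rw [e4] at e2
      rw [e5] at e1
      rw [e3]
      linarith
    intro t htD
    have := (convex_Icc (-τ) τ).norm_image_sub_le_of_norm_hasDerivWithin_le hd
      (fun s _ ↦ (norm_zero (E := ℝ)).le) h0D htD
    rw [zero_mul, norm_le_zero_iff, sub_eq_zero] at this
    rw [this, h0, hUz₀]
    change G y₀ (T + m) (T + m) = 0
    simp only [map_add, add_apply, h.unit, h.center_apply_T, h.center_apply_T', hm, hm']
    ring
  refine ⟨⟨fun t htD ↦ (ht t htD).1.1, d1, fun t htD ↦ ?_, hℓV, fun t htD ↦ ?_, fun t htD v ↦ ?_,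
    d2, fun t htD w ↦ ?_, fun t htD ↦ (ht t htD).1.2.1.le, fun t htD ↦ (ht t htD).1.2.2.1.le,
    fun t htD ↦ ?_⟩, congrArg Prod.fst h0, contDiff_fst.comp_contDiffOn hsm, fun t htD ↦ ?_⟩
  · have hd : ∀ t ∈ D, HasDerivWithinAt (fun t ↦ ℓ (z t).1 - t) 0 D t := fun t htD ↦ by
      have := (ℓ.hasFDerivAt.comp_hasDerivWithinAt t (d1 t htD)).sub (hasDerivWithinAt_id t D)
      rwa [hℓV t htD, sub_self] at this
    have := (convex_Icc (-τ) τ).norm_image_sub_le_of_norm_hasDerivWithin_le hd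
      (fun s _ ↦ (norm_zero (E := ℝ)).le) h0D htD
    rw [zero_mul, norm_le_zero_iff, sub_eq_zero, h0, sub_zero] at this
    change _ = ℓ y₀ at this
    linarith
  · change G (z t).1 ((ℓ (U (z t)))⁻¹ • U (z t)) ((ℓ (U (z t)))⁻¹ • U (z t)) = 0
    have := hnull t htD
    rw [← hGU _ (ht t htD).1.1] at this
    simp only [map_smul, smul_apply, this, smul_zero]
  · change _ = ℓ (U (z t)) * G (z t).1 ((ℓ (U (z t)))⁻¹ • U (z t)) v
    rw [map_smul, smul_apply, smul_eq_mul, ← mul_assoc, mul_inv_cancel₀ (hℓU t htD).ne', one_mul,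
      hGU _ (ht t htD).1.1]
  · rw [hVsnd t htD]
    change _ = ℓ (U (z t)) / 2 * fderiv ℝ G (z t).1 w ((ℓ (U (z t)))⁻¹ • U (z t))
      ((ℓ (U (z t)))⁻¹ • U (z t))
    have := (hℓU t htD).ne'
    simp only [map_smul, smul_apply, smul_eq_mul]
    field_simp
  · change ‖(ℓ (U (z t)))⁻¹ • U (z t)‖ ≤ _
    have h1 := (ht t htD).1.2
    rw [norm_smul, Real.norm_eq_abs, abs_of_pos (inv_pos.2 (hℓU t htD))]
    gcongr
    · rw [inv_le_comm₀ (hℓU t htD) two_pos]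
      have := h1.1
      norm_num at this ⊢
      linarith
    · exact h1.2.2.le
  · obtain ⟨-, -, -, k1, k2, k3⟩ := ht t htD
    have hB' : B ≤ B * (1 + K) := by nlinarith
    have e1 : ∀ q : E × (E →L[ℝ] ℝ), ‖q.1‖ ≤ ‖q‖ := fun q ↦ norm_fst_le q
    have hV1 := hVz₀ m hmN
    refine ⟨?_, ?_, fun m' hm1 hm2 ↦ ?_⟩
    · rw [← hV1]
      exact ((e1 _).trans k1).trans (by gcongr)
    · have := (e1 _).trans k2
      rw [Prod.fst_sub, Prod.fst_sub, Prod.smul_fst, hV1] at this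
      exact this.trans (by gcongr)
    · have := (e1 _).trans (k3 (z₀ m') (mem_image_of_mem _ ⟨hm1, hm2⟩))
      rw [Prod.fst_sub, Prod.fst_sub, Prod.fst_sub, Prod.fst_sub, Prod.fst_sub, Prod.smul_fst,
        Prod.smul_fst, hV1, hVz₀ m' ⟨hm1, hm2⟩] at this
      have e2 : ((z t).1 - t • m) - ((α (z₀ m') t).1 - t • m') =
          ((z t).1 - (z₀ m).1 - t • (T + m)) - ((α (z₀ m') t).1 - (z₀ m').1 - t • (T + m')) := by
        simp only [hz₀, smul_add]
        abel
      have e3 : ‖z₀ m - z₀ m'‖ ≤ (1 + K) * ‖m - m'‖ := by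
        have h1 : z₀ m - z₀ m' = (0, G y₀ (m - m')) := by
          simp only [hz₀, map_add, map_sub, Prod.mk_sub_mk, sub_self, add_sub_add_left_eq_sub]
        rw [h1, Prod.norm_def, norm_zero, max_eq_right (norm_nonneg _)]
        refine ((G y₀).le_opNorm _).trans ?_
        have := h.norm_le y₀ h.mem_center
        gcongr
        linarith
      rw [e2]
      refine this.trans ?_
      calc B * ‖z₀ m - z₀ m'‖ * t ^ 2 ≤ B * ((1 + K) * ‖m - m'‖) * t ^ 2 := by gcongr
        _ = _ := by ring

end IsLorentzPatch

/-! ### Points near the light cone of a patch -/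

theorem eventually_mul_lt {b : ℝ} (hb : 0 < b) (C : ℝ) : ∀ᶠ τ in 𝓝[>] (0 : ℝ), τ * C < b := by
  have : Tendsto (fun τ : ℝ ↦ τ * C) (𝓝[>] 0) (𝓝 (0 * C)) :=
    ((continuous_id.mul continuous_const).tendsto 0).mono_left nhdsWithin_le_nhds
  rw [zero_mul] at this
  exact this.eventually (gt_mem_nhds hb)

theorem mul_lt_of_mem_Icc {t τ C b : ℝ} (ht : t ∈ Icc 0 τ) (hb : 0 < b) (h : τ * C < b) :
    t * C < b := by
  rcases le_or_gt C 0 with hC | hC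
  · exact (mul_nonpos_of_nonneg_of_nonpos ht.1 hC).trans_lt hb
  · exact (mul_le_mul_of_nonneg_right ht.2 hC.le).trans_lt h

theorem inv_mul_inv_mul_eq_one {q a : ℝ} (hq : 0 < q) (h : q ^ 2 = a) : q⁻¹ * (q⁻¹ * a) = 1 := by
  subst h
  field_simp

namespace IsLorentzPatch

variable {E : Type*} [NormedAddCommGroup E] [NormedSpace ℝ E] [FiniteDimensional ℝ E]
  {G : E → E →L[ℝ] E →L[ℝ] ℝ} {θ : E → E →L[ℝ] ℝ} {y₀ T : E} {ℓ : E →L[ℝ] ℝ} {r c K : ℝ}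

theorem norm_le_sqrt (h : IsLorentzPatch G θ y₀ T ℓ r c K) {v : E} (hv : ℓ v = 0) :
    √c * ‖v‖ ≤ √(G y₀ v v) := by
  refine Real.le_sqrt_of_sq_le ?_
  rw [mul_pow, Real.sq_sqrt h.c_pos.le]
  exact h.pos y₀ h.mem_center v hv

theorem sq_sqrt_center (h : IsLorentzPatch G θ y₀ T ℓ r c K) {v : E} (hv : ℓ v = 0) :
    √(G y₀ v v) ^ 2 = G y₀ v v := by
  refine Real.sq_sqrt (le_trans ?_ (h.pos y₀ h.mem_center v hv))
  have := h.c_pos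
  positivity

/-- With p, q the two square roots, p² - q² = G(v - w, v + w). Dividing by p + q, which dominates
√c(‖v‖ + ‖w‖), gives the bound. -/
theorem sqrt_sub_sqrt_le (h : IsLorentzPatch G θ y₀ T ℓ r c K) {v w : E} (hv : ℓ v = 0)
    (hw : ℓ w = 0) : |√(G y₀ v v) - √(G y₀ w w)| ≤ K / √c * ‖v - w‖ := by
  have hsc : 0 < √c := Real.sqrt_pos.2 h.c_pos
  have hK := h.K_pos
  have h1 := h.norm_le_sqrt hv
  have h2 := h.norm_le_sqrt hw
  have h3 := h.sq_sqrt_center hv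
  have h4 := h.sq_sqrt_center hw
  set p := √(G y₀ v v)
  set q := √(G y₀ w w)
  have hp : 0 ≤ p := Real.sqrt_nonneg _
  have hq : 0 ≤ q := Real.sqrt_nonneg _
  rcases (add_nonneg hp hq).eq_or_lt with h0 | h0
  · have hp0 : p = 0 := by linarith
    have hq0 : q = 0 := by linarith
    rw [hp0, hq0, sub_zero, abs_zero]
    positivity
  have e1 : (p - q) * (p + q) = G y₀ (v - w) (v + w) := by
    simp only [map_add, map_sub, sub_apply]
    rw [h.symm y₀ w v]
    linear_combination h3 - h4
  have e2 : |p - q| * (p + q) ≤ K * ‖v - w‖ * (‖v‖ + ‖w‖) := by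
    rw [← abs_of_pos h0, ← abs_mul, e1]
    refine (h.apply_le h.mem_center _ _).trans ?_
    gcongr
    exact norm_add_le _ _
  have e3 : ‖v‖ + ‖w‖ ≤ (p + q) / √c := by
    rw [le_div_iff₀ hsc]
    linarith
  have e4 : |p - q| * (p + q) ≤ (K / √c * ‖v - w‖) * (p + q) := by
    refine e2.trans ?_
    calc _ ≤ K * ‖v - w‖ * ((p + q) / √c) := by gcongr
      _ = _ := by ring
  exact le_of_mul_le_mul_right e4 h0

/-- Radial projection to the unit sphere has Lipschitz constant of order 1/ρ at distance ρ from the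
origin. With ρ of order τ this is outweighed by the O(τ²) remainders of the rays. -/
theorem norm_normalize_sub_le (h : IsLorentzPatch G θ y₀ T ℓ r c K) {v w : E} {ρ : ℝ} (hρ : 0 < ρ)
    (hv : ℓ v = 0) (hw : ℓ w = 0) (hvρ : ρ ≤ √(G y₀ v v)) (hw0 : 0 < √(G y₀ w w)) :
    ‖(√(G y₀ v v))⁻¹ • v - (√(G y₀ w w))⁻¹ • w‖ ≤ (1 + K / c) / ρ * ‖v - w‖ := by
  have hsc : 0 < √c := Real.sqrt_pos.2 h.c_pos
  have hK := h.K_pos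
  have hc := h.c_pos
  have h1 := h.norm_le_sqrt hw
  have h2 := h.sqrt_sub_sqrt_le hv hw
  set p := √(G y₀ v v)
  set q := √(G y₀ w w)
  have hp : 0 < p := hρ.trans_le hvρ
  have e1 : p⁻¹ • v - q⁻¹ • w = p⁻¹ • (v - w) - (p⁻¹ * (p - q) * q⁻¹) • w := by
    have : p⁻¹ * (p - q) * q⁻¹ = q⁻¹ - p⁻¹ := by field_simp
    rw [this, smul_sub, sub_smul]
    abel
  have e2 : ‖w‖ ≤ q / √c := by
    rw [le_div_iff₀ hsc]
    linarith
  have e3 : √c * √c = c := Real.mul_self_sqrt hc.le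
  calc _ ≤ ‖p⁻¹ • (v - w)‖ + ‖(p⁻¹ * (p - q) * q⁻¹) • w‖ := by rw [e1]; exact norm_sub_le _ _
    _ = p⁻¹ * ‖v - w‖ + p⁻¹ * |p - q| * q⁻¹ * ‖w‖ := by
      rw [norm_smul, norm_smul, Real.norm_eq_abs, Real.norm_eq_abs, abs_mul, abs_mul,
        abs_of_pos (inv_pos.2 hp), abs_of_pos (inv_pos.2 hw0)]
    _ ≤ p⁻¹ * ‖v - w‖ + p⁻¹ * (K / √c * ‖v - w‖) * q⁻¹ * (q / √c) := by gcongr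
    _ = p⁻¹ * ((1 + K / (√c * √c)) * ‖v - w‖) := by field_simp
    _ ≤ ρ⁻¹ * ((1 + K / (√c * √c)) * ‖v - w‖) := by gcongr
    _ = _ := by rw [e3]; ring

/-- Points well inside the light cone are reached by timelike segments. -/
theorem eventually_segment_timelike (h : IsLorentzPatch G θ y₀ T ℓ r c K) :
    ∀ᶠ τ in 𝓝[>] (0 : ℝ), ∀ w, ℓ w = 0 → √(G y₀ w w) < τ / 2 → ∀ t ∈ Icc 0 τ,
      y₀ + t • (T + τ⁻¹ • w) ∈ Metric.ball y₀ r ∧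
      G (y₀ + t • (T + τ⁻¹ • w)) (T + τ⁻¹ • w) (T + τ⁻¹ • w) < 0 ∧
      θ (y₀ + t • (T + τ⁻¹ • w)) (T + τ⁻¹ • w) < 0 := by
  have hsc : 0 < √c := Real.sqrt_pos.2 h.c_pos
  have hK := h.K_pos
  set b := ‖T‖ + 1 / √c with hb
  have hb0 : 0 < b := by positivity
  filter_upwards [self_mem_nhdsWithin, eventually_mul_lt h.r_pos b,
    eventually_mul_lt (show (0 : ℝ) < 1 / 2 by norm_num) (K * b * b * b)] with τ hτ h1 h2 w hw hwτ t ht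
  have hτ : 0 < τ := hτ
  set u := T + τ⁻¹ • w with hu
  have hub : ‖u‖ ≤ b := by
    have e1 := h.norm_le_sqrt hw
    have e2 : ‖w‖ ≤ τ / √c := by
      rw [le_div_iff₀ hsc]
      linarith
    refine (norm_add_le _ _).trans ?_
    rw [norm_smul, Real.norm_eq_abs, abs_of_pos (inv_pos.2 hτ), hb]
    gcongr
    calc τ⁻¹ * ‖w‖ ≤ τ⁻¹ * (τ / √c) := by gcongr
      _ = 1 / √c := by field_simp
  have htb : ‖t • u‖ ≤ t * b := by
    rw [norm_smul, Real.norm_eq_abs, abs_of_nonneg ht.1]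
    exact mul_le_mul_of_nonneg_left hub ht.1
  have hmem : y₀ + t • u ∈ Metric.ball y₀ r := by
    rw [mem_ball_iff_norm, add_sub_cancel_left]
    exact htb.trans_lt (mul_lt_of_mem_Icc ht h.r_pos h1)
  have hneg : G (y₀ + t • u) u u < 0 := by
    have e1 := (abs_le.1 (h.apply_sub_le h.mem_center hmem u u)).2
    rw [add_sub_cancel_left] at e1
    have e2 : K * ‖t • u‖ * ‖u‖ * ‖u‖ ≤ t * (K * b * b * b) := by
      calc _ ≤ K * (t * b) * b * b := by
            have := ht.1
            gcongr
        _ = _ := by ring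
    have e3 := mul_lt_of_mem_Icc ht (by norm_num) h2
    -- At the centre the value is at most -1 + 1/4, and the variation of the metric along the
    -- segment is below 1/2.
    have e4 : G y₀ u u = -1 + τ⁻¹ ^ 2 * G y₀ w w := by
      simp only [hu, map_add, map_smul, add_apply, smul_apply, smul_eq_mul, h.unit,
        h.center_apply_T, h.center_apply_T', hw]
      ring
    have e5 : τ⁻¹ ^ 2 * G y₀ w w ≤ 1 / 4 := by
      rw [← h.sq_sqrt_center hw, ← mul_pow]
      have : τ⁻¹ * √(G y₀ w w) ≤ 1 / 2 := by
        rw [inv_mul_le_iff₀ hτ]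
        linarith
      have h0 : 0 ≤ τ⁻¹ * √(G y₀ w w) := by positivity
      nlinarith
    linarith
  refine ⟨hmem, hneg, h.future _ hmem _ hneg.le ?_⟩
  rw [hu, map_add, map_smul, hw, h.time_T, smul_zero, add_zero]
  exact one_pos

variable {x x' : E → ℝ → E} {P P' : E → ℝ → E →L[ℝ] ℝ} {κ : E → ℝ → ℝ} {C B τ₀ : ℝ}

theorem norm_ray_sub_le (hR : IsNullRayFamily G y₀ T ℓ r x x' P P' κ C B τ₀) {m : E}
    (hm : ℓ m = 0) (hm' : G y₀ m m = 1) {t : ℝ} (ht : t ∈ Icc 0 τ₀) : ‖x m t - y₀‖ ≤ C * t := by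
  obtain ⟨h1, h2, -⟩ := hR m hm hm'
  have ht' : t ∈ Icc (-τ₀) τ₀ := ⟨by linarith [ht.1, ht.2], ht.2⟩
  have := (convex_Icc (-τ₀) τ₀).norm_image_sub_le_of_norm_hasDerivWithin_le h1.deriv
    h1.norm_deriv_le (x := 0) (y := t) ⟨by linarith [ht.1, ht.2], ht.1.trans ht.2⟩ ht'
  rwa [h2, sub_zero, Real.norm_eq_abs, abs_of_nonneg ht.1] at this

/-- Along the null rays the metric products of the velocity and the direction are controlled. -/
theorem exists_ray_estimate (h : IsLorentzPatch G θ y₀ T ℓ r c K) (hC : 0 < C) (hB : 0 < B)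
    (hR : IsNullRayFamily G y₀ T ℓ r x x' P P' κ C B τ₀) :
    ∃ L > (0 : ℝ), ∀ m, ℓ m = 0 → G y₀ m m = 1 → ∀ t ∈ Icc 0 τ₀, ∀ z ∈ Metric.ball y₀ r,
      ‖z - y₀‖ ≤ (C + (1 / c + 1)) * t →
        |G z (x' m t) m - 1| ≤ L * t ∧ |G z m m - 1| ≤ L * t := by
  have hK := h.K_pos
  have hc := h.c_pos
  set N := 1 / c + 1 with hN
  have hN0 : 0 < N := by positivity
  refine ⟨K * (C + N) * C * N + K * B * N + K * (C + N) * N * N, by positivity,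
    fun m hm hm' t ht z hz hzt ↦ ?_⟩
  obtain ⟨h1, h2, h3, h4⟩ := hR m hm hm'
  have ht' : t ∈ Icc (-τ₀) τ₀ := ⟨by linarith [ht.1, ht.2], ht.2⟩
  have e0 : ‖m‖ ≤ N := h.norm_le_of_unit hm hm'
  have e1 := h.apply_sub_le h.mem_center hz (x' m t) m
  have e2 := h.apply_sub_le h.mem_center hz m m
  have e3 := h.apply_le h.mem_center (x' m t - (T + m)) m
  have e4 := (h4 t ht').1
  have e5 := h1.norm_deriv_le t ht'
  rw [abs_of_nonneg ht.1] at e4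
  have e6 : G y₀ (x' m t - (T + m)) m = G y₀ (x' m t) m - 1 := by
    simp only [map_add, map_sub, add_apply, sub_apply, h.center_apply_T, hm, hm']
    ring
  have ht0 := ht.1
  rw [e6] at e3
  have f1 : K * ‖z - y₀‖ * ‖x' m t‖ * ‖m‖ ≤ K * ((C + N) * t) * C * N := by gcongr
  have f2 : K * ‖z - y₀‖ * ‖m‖ * ‖m‖ ≤ K * ((C + N) * t) * N * N := by gcongr
  have f3 : K * ‖x' m t - (T + m)‖ * ‖m‖ ≤ K * (B * t) * N := by gcongr
  have g1 : 0 ≤ K * (C + N) * C * N * t := by positivity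
  have g2 : 0 ≤ K * B * N * t := by positivity
  have g3 : 0 ≤ K * (C + N) * N * N * t := by positivity
  rw [hm'] at e2
  constructor
  · have := (abs_sub_le (G z (x' m t) m) (G y₀ (x' m t) m) 1)
    linarith
  · linarith

/-- The curves obtained from the null rays by drifting inwards are timelike. -/
theorem eventually_drift_timelike (h : IsLorentzPatch G θ y₀ T ℓ r c K) (hC : 0 < C) (hB : 0 < B)
    (hτ₀ : 0 < τ₀) (hR : IsNullRayFamily G y₀ T ℓ r x x' P P' κ C B τ₀) :
    ∀ᶠ τ in 𝓝[>] (0 : ℝ), ∀ m, ℓ m = 0 → G y₀ m m = 1 → ∀ b, 0 < b → b ≤ 3 / 4 →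
      ∀ t ∈ Icc 0 τ, x m t - (t * b) • m ∈ Metric.ball y₀ r ∧
        G (x m t - (t * b) • m) (x' m t - b • m) (x' m t - b • m) < 0 ∧
        θ (x m t - (t * b) • m) (x' m t - b • m) < 0 := by
  have hK := h.K_pos
  have hc := h.c_pos
  obtain ⟨L, hL, hest⟩ := h.exists_ray_estimate hC hB hR
  set N := 1 / c + 1 with hN
  have hN0 : 0 < N := by positivity
  filter_upwards [self_mem_nhdsWithin, eventually_mul_lt h.r_pos (C + N),
    eventually_mul_lt hτ₀ 1, eventually_mul_lt one_pos 1,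
    eventually_mul_lt one_pos (K * C * C * (N + N * N) + 3 * L)]
    with τ hτ h1 h2 h3 h4 m hm hm' b hb hb' t ht
  have hτ : 0 < τ := hτ
  rw [mul_one] at h2 h3
  have ht₀ : t ∈ Icc 0 τ₀ := ⟨ht.1, ht.2.trans h2.le⟩
  have ht' : t ∈ Icc (-τ₀) τ₀ := ⟨by linarith [ht₀.1, ht₀.2], ht₀.2⟩
  obtain ⟨k1, -, -, k4⟩ := hR m hm hm'
  have e0 : ‖m‖ ≤ N := h.norm_le_of_unit hm hm'
  have e1 := norm_ray_sub_le hR hm hm' ht₀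
  have ht0 := ht.1
  have htb : ‖(t * b) • m‖ ≤ t * b * N := by
    rw [norm_smul, Real.norm_eq_abs, abs_of_nonneg (by positivity)]
    gcongr
  set z := x m t - (t * b) • m with hz
  have hzy : ‖z - y₀‖ ≤ (C + N) * t := by
    have : z - y₀ = (x m t - y₀) - (t * b) • m := by rw [hz]; abel
    rw [this]
    refine (norm_sub_le _ _).trans ?_
    have : t * b * N ≤ t * 1 * N := by gcongr; linarith
    linarith
  have hzb : z ∈ Metric.ball y₀ r := by
    rw [mem_ball_iff_norm]
    refine hzy.trans_lt ?_
    rw [mul_comm]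
    exact mul_lt_of_mem_Icc ht h.r_pos h1
  have hneg : G z (x' m t - b • m) (x' m t - b • m) < 0 := by
    obtain ⟨f1, f2⟩ := hest m hm hm' t ht₀ z hzb hzy
    have f3 := (abs_le.1 (h.taylor_apply_le (k1.mem t ht') hzb (x' m t) (x' m t))).2
    have f4 := (abs_le.1 (h.fderiv_apply_le (k1.mem t ht') (z - x m t) (x' m t) (x' m t))).2
    have f5 := k1.null t ht'
    have f6 := k1.norm_deriv_le t ht'
    have f7 : ‖z - x m t‖ ≤ t * b * N := by
      rw [hz, sub_sub_cancel_left, norm_neg]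
      exact htb
    have f8 : K * ‖z - x m t‖ ^ 2 * ‖x' m t‖ * ‖x' m t‖ ≤ K * (t * b * N * N) * C * C := by
      have : ‖z - x m t‖ ^ 2 ≤ t * b * N * N := by
        have i1 : t * b * N ≤ N := by
          have : t * b ≤ 1 := by nlinarith [ht.2]
          nlinarith
        rw [pow_two]
        gcongr
        exact f7.trans i1
      gcongr
    have f9 : K * ‖z - x m t‖ * ‖x' m t‖ * ‖x' m t‖ ≤ K * (t * b * N) * C * C := by gcongr
    have f10 := mul_lt_of_mem_Icc ht one_pos h4
    have f11 := h.symm z m (x' m t)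
    have f1 := (abs_le.1 f1).1
    have f2 := (abs_le.1 f2).2
    simp only [map_sub, map_smul, sub_apply, smul_apply, smul_eq_mul, f11]
    generalize G z (x' m t) (x' m t) = a1 at *
    generalize G z (x' m t) m = a2 at *
    generalize G z m m = a3 at *
    generalize fderiv ℝ G (x m t) (z - x m t) (x' m t) (x' m t) = a4 at *
    rw [f5] at f3
    -- The drifted point is within t b N of a point where x' is null, so the error in G(x', x')
    -- carries a factor b. The whole expression is then b(-2 + b + O(t)), negative for small t
    -- because b ≤ 3/4.
    have g1 : a1 ≤ b * (t * (K * C * C * (N + N * N))) := by linarith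
    have g2 : b * a2 ≥ b * (1 - L * t) := by gcongr; linarith
    have g3 : b * (b * a3) ≤ b * (3 / 4 * (1 + L * t)) := by
      have hLt : 0 ≤ L * t := by positivity
      have i1 : b * a3 ≤ b * (1 + L * t) := mul_le_mul_of_nonneg_left (by linarith) hb.le
      have i2 : b * (1 + L * t) ≤ 3 / 4 * (1 + L * t) :=
        mul_le_mul_of_nonneg_right hb' (by linarith)
      exact mul_le_mul_of_nonneg_left (i1.trans i2) hb.le
    have g4 : b * (t * (K * C * C * (N + N * N)) - 2 * (1 - L * t) + 3 / 4 * (1 + L * t)) < 0 := by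
      have : 0 ≤ L * t := by positivity
      exact mul_neg_of_pos_of_neg hb (by linarith)
    linarith
  refine ⟨hzb, hneg, h.future _ hzb _ hneg.le ?_⟩
  rw [map_sub, map_smul, hm, k1.time_deriv t ht', smul_zero, sub_zero]
  exact one_pos

/-- The barrier of a null ray is positive at points slightly outside the light cone. -/
theorem eventually_barrier_pos (h : IsLorentzPatch G θ y₀ T ℓ r c K) (hC : 0 < C) (hB : 0 < B)
    (hτ₀ : 0 < τ₀) (hR : IsNullRayFamily G y₀ T ℓ r x x' P P' κ C B τ₀) {k Q : ℝ} (hk : 0 < k) :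
    ∀ᶠ τ in 𝓝[>] (0 : ℝ), ∀ m, ℓ m = 0 → G y₀ m m = 1 → ∀ a, 0 < a → a ≤ Q →
      0 < nullBarrier G y₀ ℓ (x m) (P m) k (x m τ + a • m) := by
  obtain ⟨L, hL, hest⟩ := h.exists_ray_estimate hC hB hR
  have hN0 : 0 ≤ 1 / c + 1 := by
    have := h.c_pos
    positivity
  filter_upwards [self_mem_nhdsWithin, eventually_mul_lt hτ₀ 1,
    eventually_mul_lt (show (0 : ℝ) < 1 / 2 by norm_num) L,
    eventually_mul_lt (show (0 : ℝ) < 1 / 2 by norm_num) (k * Q)] with τ hτ h2 h3 h4 m hm hm' a ha haQ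
  have hτ : 0 < τ := hτ
  rw [mul_one] at h2
  have ht₀ : τ ∈ Icc 0 τ₀ := ⟨hτ.le, h2.le⟩
  have ht' : τ ∈ Icc (-τ₀) τ₀ := ⟨by linarith, h2.le⟩
  obtain ⟨k1, -, -, k4⟩ := hR m hm hm'
  have e1 : ℓ (x m τ + a • m) - ℓ y₀ = τ := by
    rw [map_add, map_smul, hm, smul_zero, add_zero, k1.time τ ht', add_sub_cancel_left]
  have e2 : ‖x m τ - y₀‖ ≤ (C + (1 / c + 1)) * τ := by
    refine (norm_ray_sub_le hR hm hm' ht₀).trans ?_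
    gcongr
    linarith
  have e3 := (abs_le.1 (hest m hm hm' τ ht₀ (x m τ) (k1.mem τ ht') e2).1).1
  have e4 := k1.le_factor τ ht'
  have e5 := k1.conormal τ ht' m
  rw [nullBarrier, e1, add_sub_cancel_left]
  simp only [map_smul, smul_apply, smul_eq_mul, e5, hm']
  -- The barrier equals a(κ G(x', m) - kτa/2). The linear part is at least 1/4 times a because κ ≥
  -- 1/2 and G(x', m) ≥ 1/2, and the correction is smaller because a ≤ Q.
  have e6 : 1 / 4 ≤ κ m τ * G (x m τ) (x' m τ) m := by nlinarith
  have e7 : k / 2 * (τ * a) ≤ τ * (k * Q) / 2 := by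
    have : k / 2 * (τ * a) ≤ k / 2 * (τ * Q) := by gcongr
    linarith
  have : 0 < a * (κ m τ * G (x m τ) (x' m τ) m - k / 2 * (τ * a)) := mul_pos ha (by linarith)
  linarith

/-- Points off the inner light cone lie on the normal line through a null ray. -/
theorem eventually_exists_ray (h : IsLorentzPatch G θ y₀ T ℓ r c K)
    (hB : 0 < B) (hτ₀ : 0 < τ₀) (hR : IsNullRayFamily G y₀ T ℓ r x x' P P' κ C B τ₀) :
    ∀ᶠ τ in 𝓝[>] (0 : ℝ), ∀ w, ℓ w = 0 → τ / 2 ≤ √(G y₀ w w) →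
      ∃ m, ℓ m = 0 ∧ G y₀ m m = 1 ∧ ∃ q, τ / 4 ≤ q ∧ q ≤ √(G y₀ w w) + τ ∧
        y₀ + τ • T + w = x m τ + (q - τ) • m := by
  have : CompleteSpace E := FiniteDimensional.complete ℝ E
  have hK := h.K_pos
  have hc := h.c_pos
  have hsc : 0 < √c := Real.sqrt_pos.2 h.c_pos
  filter_upwards [self_mem_nhdsWithin, eventually_mul_lt hτ₀ 1,
    eventually_mul_lt (show (0 : ℝ) < 1 / 4 by norm_num) (K / √c * B),
    eventually_mul_lt (show (0 : ℝ) < 1 / 2 by norm_num) ((1 + K / c) * 4 * B)]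
    with τ hτ h2 h3 h4 w hw hwτ
  have hτ : 0 < τ := hτ
  rw [mul_one] at h2
  have ht' : τ ∈ Icc (-τ₀) τ₀ := ⟨by linarith, h2.le⟩
  set N : Set E := {m | ℓ m = 0 ∧ G y₀ m m = 1} with hN
  -- The desired identity says v(m) = q m, so m is a fixed point of the normalization Φ of v on the
  -- unit sphere N transverse to T. Here v is w minus the Taylor remainder of the ray, which has
  -- size and Lipschitz constant O(τ²), while √G(v, v) ≥ τ/4; hence Φ is a contraction for small τ.
  set v : E → E := fun m ↦ w - (x m τ - y₀ - τ • (T + m)) with hv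
  have hvℓ : ∀ m ∈ N, ℓ (v m) = 0 := by
    intro m hm
    have := (hR m hm.1 hm.2).1.time τ ht'
    simp only [hv, map_sub, map_smul, map_add, hw, this, h.time_T, hm.1, smul_eq_mul]
    ring
  have hvq : ∀ m ∈ N, |√(G y₀ (v m) (v m)) - √(G y₀ w w)| ≤ τ / 4 := by
    intro m hm
    refine (h.sqrt_sub_sqrt_le (hvℓ m hm) hw).trans ?_
    have e1 : v m - w = -(x m τ - y₀ - τ • (T + m)) := by simp only [hv]; abel
    rw [e1, norm_neg]
    have e2 := ((hR m hm.1 hm.2).2.2.2 τ ht').2.1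
    calc _ ≤ K / √c * (B * τ ^ 2) := by gcongr
      _ = τ * (τ * (K / √c * B)) := by ring
      _ ≤ τ * (1 / 4) := by gcongr
      _ = τ / 4 := by ring
  have hvq' : ∀ m ∈ N, τ / 4 ≤ √(G y₀ (v m) (v m)) := fun m hm ↦ by
    have := (abs_le.1 (hvq m hm)).1
    linarith
  set Φ : E → E := fun m ↦ (√(G y₀ (v m) (v m)))⁻¹ • v m with hΦ
  have hmaps : MapsTo Φ N N := by
    intro m hm
    have e1 := hvq' m hm
    have e2 := h.sq_sqrt_center (hvℓ m hm)
    have e3 : 0 < √(G y₀ (v m) (v m)) := by linarith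
    refine ⟨?_, ?_⟩
    · simp only [hΦ, map_smul, hvℓ m hm, smul_zero]
    · simp only [hΦ, map_smul, smul_apply, smul_eq_mul]
      exact inv_mul_inv_mul_eq_one e3 e2
  have hNcl : IsClosed N := (isClosed_eq ℓ.continuous continuous_const).inter
    (isClosed_eq (by fun_prop) continuous_const)
  have hlip : LipschitzWith (1 / 2) (hmaps.restrict Φ N N) := by
    refine LipschitzWith.of_dist_le_mul fun m m' ↦ ?_
    change dist (Φ m) (Φ m') ≤ _ * dist (m : E) m'
    rw [dist_eq_norm, dist_eq_norm]
    have e1 := h.norm_normalize_sub_le (show 0 < τ / 4 by linarith) (hvℓ m m.2) (hvℓ m' m'.2)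
      (hvq' m m.2) (by have := hvq' m' m'.2; linarith)
    refine e1.trans ?_
    have e2 := ((hR m m.2.1 m.2.2).2.2.2 τ ht').2.2 m' m'.2.1 m'.2.2
    have e3 : v m - v m' = -((x m τ - τ • (m : E)) - (x m' τ - τ • (m' : E))) := by
      simp only [hv, smul_add]
      abel
    rw [e3, norm_neg]
    calc _ ≤ (1 + K / c) / (τ / 4) * (B * ‖(m : E) - m'‖ * τ ^ 2) := by gcongr
      _ = (τ * ((1 + K / c) * 4 * B)) * ‖(m : E) - m'‖ := by field_simp
      _ ≤ (1 / 2) * ‖(m : E) - m'‖ := by gcongr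
      _ = _ := by simp
  have hm₀ : (√(G y₀ w w))⁻¹ • w ∈ N := by
    have e2 := h.sq_sqrt_center hw
    have e3 : 0 < √(G y₀ w w) := by linarith
    refine ⟨by simp only [map_smul, hw, smul_zero], ?_⟩
    simp only [map_smul, smul_apply, smul_eq_mul]
    exact inv_mul_inv_mul_eq_one e3 e2
  obtain ⟨m, hm, hfix, -⟩ := ContractingWith.exists_fixedPoint' hNcl.isComplete hmaps
    (f := Φ) (K := 1 / 2) ⟨by norm_num, hlip⟩ hm₀ (edist_ne_top _ _)
  refine ⟨m, hm.1, hm.2, √(G y₀ (v m) (v m)), hvq' m hm, ?_, ?_⟩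
  · have := (abs_le.1 (hvq m hm)).2
    linarith
  · have e3 : 0 < √(G y₀ (v m) (v m)) := by have := hvq' m hm; linarith
    have e4 : v m = √(G y₀ (v m) (v m)) • m := by
      have : Φ m = m := hfix
      calc v m = √(G y₀ (v m) (v m)) • Φ m := by
            simp only [hΦ, smul_smul, mul_inv_cancel₀ e3.ne', one_smul]
        _ = _ := by rw [this]
    rw [sub_smul, ← e4]
    simp only [hv, smul_add]
    abel

end IsLorentzPatch

/-! ### Null generators -/

theorem IsNullRay.mono {E : Type*} [NormedAddCommGroup E] [NormedSpace ℝ E]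
    {G : E → E →L[ℝ] E →L[ℝ] ℝ} {y₀ : E} {ℓ : E →L[ℝ] ℝ} {r : ℝ} {D D' : Set ℝ} {c c' : ℝ → E}
    {P P' : ℝ → E →L[ℝ] ℝ} {κ : ℝ → ℝ} {C κ₀ κ₁ : ℝ}
    (h : IsNullRay G y₀ ℓ r D c c' P P' κ C κ₀ κ₁) (hD : D' ⊆ D) :
    IsNullRay G y₀ ℓ r D' c c' P P' κ C κ₀ κ₁ :=
  ⟨fun s hs ↦ h.mem s (hD hs), fun s hs ↦ (h.deriv s (hD hs)).mono hD, fun s hs ↦ h.time s (hD hs),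
    fun s hs ↦ h.time_deriv s (hD hs), fun s hs ↦ h.null s (hD hs),
    fun s hs ↦ h.conormal s (hD hs), fun s hs ↦ (h.deriv_conormal s (hD hs)).mono hD,
    fun s hs ↦ h.deriv_conormal_apply s (hD hs), fun s hs ↦ h.le_factor s (hD hs),
    fun s hs ↦ h.factor_le s (hD hs), fun s hs ↦ h.norm_deriv_le s (hD hs)⟩

theorem IsNullRay.continuousAt_nullBarrier {E : Type*} [NormedAddCommGroup E] [NormedSpace ℝ E]
    {G : E → E →L[ℝ] E →L[ℝ] ℝ} {y₀ : E} {ℓ : E →L[ℝ] ℝ} {r : ℝ} {D : Set ℝ} {c c' : ℝ → E}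
    {P P' : ℝ → E →L[ℝ] ℝ} {κ : ℝ → ℝ} {C κ₀ κ₁ : ℝ}
    (h : IsNullRay G y₀ ℓ r D c c' P P' κ C κ₀ κ₁) {z : E} (hz : D ∈ 𝓝 (ℓ z - ℓ y₀)) (k : ℝ) :
    ContinuousAt (nullBarrier G y₀ ℓ c P k) z := by
  have hs : ContinuousAt (fun z ↦ ℓ z - ℓ y₀) z := by fun_prop
  have h1 : ContinuousAt (fun z ↦ P (ℓ z - ℓ y₀)) z :=
    ContinuousAt.comp (x := z) (g := P)
      ((h.deriv_conormal _ (mem_of_mem_nhds hz)).continuousWithinAt.continuousAt hz) hs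
  have h2 : ContinuousAt (fun z ↦ c (ℓ z - ℓ y₀)) z :=
    ContinuousAt.comp (x := z) (g := c)
      ((h.deriv _ (mem_of_mem_nhds hz)).continuousWithinAt.continuousAt hz) hs
  have h3 : ContinuousAt (fun z ↦ z - c (ℓ z - ℓ y₀)) z := continuousAt_id.sub h2
  have h4 : ContinuousAt (fun z ↦ G y₀ (z - c (ℓ z - ℓ y₀))) z :=
    ContinuousAt.comp (x := z) (g := G y₀) (G y₀).continuous.continuousAt h3
  exact (h1.clm_apply h3).sub (continuousAt_const.mul (hs.mul (h4.clm_apply h3)))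

/-- A timelike curve in a patch advances in time at least as fast as in space. -/
theorem IsLorentzPatch.mul_norm_sub_le {E : Type*} [NormedAddCommGroup E] [NormedSpace ℝ E]
    {G : E → E →L[ℝ] E →L[ℝ] ℝ} {θ : E → E →L[ℝ] ℝ} {y₀ T : E} {ℓ : E →L[ℝ] ℝ} {r c K : ℝ}
    (h : IsLorentzPatch G θ y₀ T ℓ r c K) {σ : ℝ → E} {a b : ℝ} (hab : a < b)
    (hσ : ∀ t ∈ Icc a b, σ t ∈ Metric.ball y₀ r)
    (hder : ∀ t ∈ Icc a b, ∃ v, HasDerivWithinAt σ v (Icc a b) t ∧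
      G (σ t) v v < 0 ∧ θ (σ t) v < 0) : c * ‖σ b - σ a‖ ≤ ℓ (σ b - σ a) := by
  choose! v hv hv1 hv2 using hder
  have hIci : ∀ t ∈ Ico a b, HasDerivWithinAt σ (v t) (Ici t) t := fun t ht ↦
    (hv t (Ico_subset_Icc_self ht)).mono_of_mem_nhdsWithin (Icc_mem_nhdsGE_of_mem ht)
  have hcont : ContinuousOn σ (Icc a b) := fun t ht ↦ (hv t ht).continuousWithinAt
  have := image_norm_le_of_norm_deriv_right_le_deriv_boundary' (f := fun t ↦ c • (σ t - σ a))
    (f' := fun t ↦ c • v t) (B := fun t ↦ ℓ (σ t - σ a)) (B' := fun t ↦ ℓ (v t))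
    ((hcont.sub continuousOn_const).const_smul c)
    (fun t ht ↦ ((hIci t ht).sub_const _).const_smul c)
    (by simp) (ℓ.continuous.comp_continuousOn (hcont.sub continuousOn_const))
    (fun t ht ↦ ℓ.hasFDerivAt.comp_hasDerivWithinAt t ((hIci t ht).sub_const _))
    (fun t ht ↦ by
      have ht' := Ico_subset_Icc_self ht
      rw [norm_smul, Real.norm_eq_abs, abs_of_pos h.c_pos]
      exact h.le_time _ (hσ t ht') _ (hv1 t ht').le (hv2 t ht')) (right_mem_Icc.2 hab.le)
  rwa [norm_smul, Real.norm_eq_abs, abs_of_pos h.c_pos] at this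

theorem exists_first_exit {X : Type*} [TopologicalSpace X] {γ : ℝ → X} {a b : ℝ} {W : Set X}
    (hγ : ContinuousOn γ (Icc a b)) (hab : a ≤ b) (hW : IsOpen W) (ha : γ a ∈ W) (hb : γ b ∉ W) :
    ∃ t ∈ Ioc a b, γ t ∉ W ∧ ∀ s ∈ Ico a t, γ s ∈ W := by
  have hcp : IsCompact (Icc a b ∩ γ ⁻¹' Wᶜ) := isCompact_Icc.of_isClosed_subset
    (hγ.preimage_isClosed_of_isClosed isClosed_Icc hW.isClosed_compl) inter_subset_left
  obtain ⟨t, ⟨ht, htW⟩, hmin⟩ := hcp.exists_isLeast ⟨b, right_mem_Icc.2 hab, hb⟩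
  refine ⟨t, ⟨lt_of_le_of_ne ht.1 fun h ↦ htW (h ▸ ha), ht.2⟩, htW, fun s hs ↦ ?_⟩
  by_contra hcon
  exact absurd (hmin ⟨⟨hs.1, hs.2.le.trans ht.2⟩, hcon⟩) (not_le.2 hs.2)

/-! ### Timelike curves crossing a time level, and the null generator through a frontier point. -/

namespace SpacetimeStructure

variable {n : ℕ} {M : Type*} [TopologicalSpace M]
  [ChartedSpace (EuclideanSpace ℝ (Fin (n + 1))) M] [IsManifold (𝓡 (n + 1)) ∞ M]

theorem IsFutureTimelikeCurve.restrict_left {g : SpacetimeStructure n M} {γ : ℝ → M} {a b t : ℝ}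
    (h : g.IsFutureTimelikeCurve γ a b) (ht : t ∈ Ioc a b) : g.IsFutureTimelikeCurve γ a t := by
  induction h with
  | single h => exact .single (h.mono le_rfl ht.1 ht.2)
  | @tail m b' h1 h2 ih =>
    rcases le_or_gt t m with htm | htm
    · exact ih ⟨ht.1, htm⟩
    · exact .tail h1 (h2.mono le_rfl htm ht.2)

theorem IsFutureTimelikeCurve.restrict_right {g : SpacetimeStructure n M} {γ : ℝ → M} {a b t : ℝ}
    (h : g.IsFutureTimelikeCurve γ a b) (ht : t ∈ Ico a b) : g.IsFutureTimelikeCurve γ t b := by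
  induction h with
  | single h => exact .single (h.mono ht.1 ht.2 le_rfl)
  | @tail m b' h1 h2 ih =>
    rcases lt_or_ge t m with htm | htm
    · exact .tail (ih ⟨ht.1, htm⟩) h2
    · exact .single (h2.mono htm ht.2 le_rfl)

/-- A transitive relation that holds along smooth timelike curves of a chart domain holds along
piecewise smooth ones. -/
theorem IsFutureTimelikeCurve.chart_induction {g : SpacetimeStructure n M} (x₀ : M)
    {S : Set (EuclideanSpace ℝ (Fin (n + 1)))}
    {Q : EuclideanSpace ℝ (Fin (n + 1)) → EuclideanSpace ℝ (Fin (n + 1)) → Prop}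
    (htrans : ∀ u v w, Q u v → Q v w → Q u w)
    (hstep : ∀ (σ : ℝ → EuclideanSpace ℝ (Fin (n + 1))) (a b : ℝ), a < b →
      (∀ t ∈ Icc a b, σ t ∈ S) →
      (∀ t ∈ Icc a b, ∃ v, HasDerivWithinAt σ v (Icc a b) t ∧
        g.chartMetric x₀ (σ t) v v < 0 ∧ g.chartTime x₀ (σ t) v < 0) → Q (σ a) (σ b))
    {γ : ℝ → M} {a b : ℝ} (h : g.IsFutureTimelikeCurve γ a b)
    (hS : ∀ t ∈ Icc a b, γ t ∈ (extChartAt (𝓡 (n + 1)) x₀).source ∧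
      extChartAt (𝓡 (n + 1)) x₀ (γ t) ∈ S) :
    Q (extChartAt (𝓡 (n + 1)) x₀ (γ a)) (extChartAt (𝓡 (n + 1)) x₀ (γ b)) := by
  induction h with
  | single h =>
    exact hstep (fun t ↦ extChartAt (𝓡 (n + 1)) x₀ (γ t)) _ _ h.1 (fun t ht ↦ (hS t ht).2)
      fun t ht ↦ h.chart x₀ ht (hS t ht).1
  | @tail m b' h1 h2 ih =>
    have hlt := IsFutureTimelikeCurve.lt h1
    refine htrans _ _ _ (ih fun t ht ↦ hS t ⟨ht.1, ht.2.trans h2.1.le⟩) ?_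
    exact hstep (fun t ↦ extChartAt (𝓡 (n + 1)) x₀ (γ t)) _ _ h2.1
      (fun t ht ↦ (hS t ⟨hlt.le.trans ht.1, ht.2⟩).2)
      fun t ht ↦ h2.chart x₀ ht (hS t ⟨hlt.le.trans ht.1, ht.2⟩).1

/-- A timelike curve that leaves a patch crosses each later level of the time function. -/
theorem exists_mem_level [T2Space M] (g : SpacetimeStructure n M) {A : Set M} {x₀ : M}
    {T : EuclideanSpace ℝ (Fin (n + 1))} {ℓ : EuclideanSpace ℝ (Fin (n + 1)) →L[ℝ] ℝ} {r c K : ℝ}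
    (h : IsLorentzPatch (g.chartMetric x₀) (g.chartTime x₀) (extChartAt (𝓡 (n + 1)) x₀ x₀) T ℓ r c K)
    (hsub : Metric.ball (extChartAt (𝓡 (n + 1)) x₀ x₀) r ⊆ (extChartAt (𝓡 (n + 1)) x₀).target)
    (hA : ∀ q ∈ A, q ∈ (extChartAt (𝓡 (n + 1)) x₀).source →
      extChartAt (𝓡 (n + 1)) x₀ q ∉ Metric.ball (extChartAt (𝓡 (n + 1)) x₀ x₀) r)
    {τ : ℝ} (hτ : τ * (2 / c) < r / 4) {p : M} (hp : p ∈ g.chronPast A)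
    (hps : p ∈ (extChartAt (𝓡 (n + 1)) x₀).source)
    (hpr : ‖extChartAt (𝓡 (n + 1)) x₀ p - extChartAt (𝓡 (n + 1)) x₀ x₀‖ < r / 4)
    (hpτ : |ℓ (extChartAt (𝓡 (n + 1)) x₀ p) - ℓ (extChartAt (𝓡 (n + 1)) x₀ x₀)| < τ) :
    ∃ z, ℓ z - ℓ (extChartAt (𝓡 (n + 1)) x₀ x₀) = τ ∧
      z ∈ Metric.closedBall (extChartAt (𝓡 (n + 1)) x₀ x₀) (r / 2) ∧
      c * ‖z - extChartAt (𝓡 (n + 1)) x₀ p‖ ≤ ℓ (z - extChartAt (𝓡 (n + 1)) x₀ p) ∧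
      (extChartAt (𝓡 (n + 1)) x₀).symm z ∈ g.chronPast A ∧
      ∀ Q : EuclideanSpace ℝ (Fin (n + 1)) → EuclideanSpace ℝ (Fin (n + 1)) → Prop,
        (∀ u v w, Q u v → Q v w → Q u w) →
        (∀ (σ : ℝ → EuclideanSpace ℝ (Fin (n + 1))) (a b : ℝ), a < b →
          (∀ t ∈ Icc a b, σ t ∈ Metric.ball (extChartAt (𝓡 (n + 1)) x₀ x₀) r ∧
            ℓ (σ t) - ℓ (extChartAt (𝓡 (n + 1)) x₀ x₀) ∈ Icc (-τ) τ) →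
          (∀ t ∈ Icc a b, ∃ v, HasDerivWithinAt σ v (Icc a b) t ∧
            g.chartMetric x₀ (σ t) v v < 0 ∧ g.chartTime x₀ (σ t) v < 0) → Q (σ a) (σ b)) →
        Q (extChartAt (𝓡 (n + 1)) x₀ p) z := by
  obtain ⟨q, hq, γ, a, b, hγ, rfl, rfl, -⟩ := hp
  set φ := extChartAt (𝓡 (n + 1)) x₀ with hφ
  set y₀ := φ x₀ with hy₀
  have hc := h.c_pos
  have hr := h.r_pos
  have hτ0 : 0 < τ := (abs_nonneg _).trans_lt hpτ
  have hcont := hγ.isFutureCausalCurve.continuousOn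
  set W : Set M := φ.source ∩ φ ⁻¹' (Metric.ball y₀ r ∩ {y | ℓ y < ℓ y₀ + τ}) with hW
  have hWo : IsOpen W := (continuousOn_extChartAt x₀).isOpen_inter_preimage
    (isOpen_extChartAt_source x₀)
    (Metric.isOpen_ball.inter (isOpen_lt ℓ.continuous continuous_const))
  have haW : γ a ∈ W := by
    refine ⟨hps, ?_, ?_⟩
    · rw [mem_ball_iff_norm]
      linarith
    · have := (abs_lt.1 hpτ).2
      change ℓ (φ (γ a)) < ℓ y₀ + τ
      linarith
  have hbW : γ b ∉ W := fun hb ↦ hA _ hq hb.1 hb.2.1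
  obtain ⟨t₁, ht₁, ht₁W, hlt⟩ := exists_first_exit hcont hγ.lt.le hWo haW hbW
  -- Below the level τ the time function rises by less than 2τ, so the curve moves by at most 2τ/c <
  -- r/4. It therefore stays in the closed half ball and can leave W only through the level itself.
  have hdisp : ∀ t ∈ Icc a b, a < t → (∀ s ∈ Icc a t, γ s ∈ φ.source ∧ φ (γ s) ∈ Metric.ball y₀ r) →
      c * ‖φ (γ t) - φ (γ a)‖ ≤ ℓ (φ (γ t) - φ (γ a)) := by
    intro t ht hat hs
    refine (hγ.restrict_left ⟨hat, ht.2⟩).chart_induction x₀ (S := Metric.ball y₀ r)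
      (Q := fun u v ↦ c * ‖v - u‖ ≤ ℓ (v - u)) (fun u v w huv hvw ↦ ?_)
      (fun σ a b hab hσ hder ↦ h.mul_norm_sub_le hab hσ hder) hs
    have e : w - u = (w - v) + (v - u) := by abel
    rw [e, map_add]
    have := norm_add_le (w - v) (v - u)
    nlinarith
  -- The exit point might a priori lie outside the chart domain. The compact set Z is closed because
  -- M is Hausdorff and contains the curve before the exit, hence also the exit point.
  set Z : Set M := φ.symm '' (Metric.closedBall y₀ (r / 2) ∩ {y | ℓ y ≤ ℓ y₀ + τ}) with hZ
  have hsub2 : Metric.closedBall y₀ (r / 2) ⊆ Metric.ball y₀ r :=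
    Metric.closedBall_subset_ball (by linarith)
  have hZc : IsClosed Z := by
    refine (IsCompact.image_of_continuousOn ?_ ((continuousOn_extChartAt_symm x₀).mono
      ((inter_subset_left.trans hsub2).trans hsub))).isClosed
    exact (isCompact_closedBall y₀ (r / 2)).inter_right
      (isClosed_le ℓ.continuous continuous_const)
  have hZmem : ∀ q ∈ Z, q ∈ φ.source ∧ φ q ∈ Metric.closedBall y₀ (r / 2) ∧ ℓ (φ q) ≤ ℓ y₀ + τ := by
    rintro _ ⟨y, ⟨hy1, hy2⟩, rfl⟩
    have hyt := hsub (hsub2 hy1)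
    refine ⟨φ.map_target hyt, ?_⟩
    rw [φ.right_inv hyt]
    exact ⟨hy1, hy2⟩
  have hIco : ∀ t ∈ Ico a t₁, γ t ∈ Z := by
    intro t ht
    have htW := hlt t ht
    refine ⟨φ (γ t), ⟨?_, le_of_lt (a := ℓ (φ (γ t))) htW.2.2⟩, φ.left_inv htW.1⟩
    rw [mem_closedBall_iff_norm]
    rcases ht.1.eq_or_lt with rfl | hat
    · linarith
    have h1 := hdisp t ⟨ht.1, ht.2.le.trans ht₁.2⟩ hat fun s hs ↦
      ⟨(hlt s ⟨hs.1, hs.2.trans_lt ht.2⟩).1, (hlt s ⟨hs.1, hs.2.trans_lt ht.2⟩).2.1⟩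
    have h2 : ℓ (φ (γ t)) < ℓ y₀ + τ := htW.2.2
    have h3 := (abs_lt.1 hpτ).1
    rw [map_sub] at h1
    have h4 : ‖φ (γ t) - φ (γ a)‖ ≤ τ * (2 / c) := by
      rw [mul_div_assoc', le_div_iff₀ hc]
      linarith
    have h5 : φ (γ t) - y₀ = (φ (γ t) - φ (γ a)) + (φ (γ a) - y₀) := by abel
    rw [h5]
    exact (norm_add_le _ _).trans (by linarith)
  have hIcc : ∀ t ∈ Icc a t₁, γ t ∈ Z := by
    have hcl : IsClosed (Icc a t₁ ∩ γ ⁻¹' Z) :=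
      (hcont.mono (Icc_subset_Icc le_rfl ht₁.2)).preimage_isClosed_of_isClosed isClosed_Icc hZc
    have hsubset : closure (Ico a t₁) ⊆ Icc a t₁ ∩ γ ⁻¹' Z :=
      hcl.closure_subset_iff.2 fun t ht ↦ ⟨Ico_subset_Icc_self ht, hIco t ht⟩
    rw [closure_Ico ht₁.1.ne] at hsubset
    exact fun t ht ↦ (hsubset ht).2
  have ht₁Z := hZmem _ (hIcc t₁ (right_mem_Icc.2 ht₁.1.le))
  have hball : ∀ t ∈ Icc a t₁, γ t ∈ φ.source ∧ φ (γ t) ∈ Metric.ball y₀ r := fun t ht ↦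
    ⟨(hZmem _ (hIcc t ht)).1, hsub2 (hZmem _ (hIcc t ht)).2.1⟩
  have hlevel : ℓ (φ (γ t₁)) - ℓ y₀ = τ := by
    have h1 : ¬ ℓ (φ (γ t₁)) < ℓ y₀ + τ := fun hcon ↦
      ht₁W ⟨ht₁Z.1, hsub2 ht₁Z.2.1, hcon⟩
    have h2 := ht₁Z.2.2
    linarith
  have ht₁b : t₁ < b := lt_of_le_of_ne ht₁.2 fun heq ↦ by
    subst heq
    exact hA _ hq ht₁Z.1 (hsub2 ht₁Z.2.1)
  refine ⟨φ (γ t₁), hlevel, ht₁Z.2.1, hdisp t₁ ⟨ht₁.1.le, ht₁.2⟩ ht₁.1 hball, ?_, ?_⟩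
  · rw [φ.left_inv ht₁Z.1]
    exact ⟨γ b, hq, γ, t₁, b, hγ.restrict_right ⟨ht₁.1.le, ht₁b⟩, rfl, rfl, fun _ _ ↦ mem_univ _⟩
  · intro Q hQ hstep
    refine (hγ.restrict_left ht₁).chart_induction x₀
      (S := {y | y ∈ Metric.ball y₀ r ∧ ℓ y - ℓ y₀ ∈ Icc (-τ) τ}) hQ hstep fun t ht ↦
      ⟨(hball t ht).1, (hball t ht).2, ?_, ?_⟩
    · have h3 := (abs_lt.1 hpτ).1
      rcases ht.1.eq_or_lt with rfl | hat
      · exact h3.le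
      have h1 := hdisp t ⟨ht.1, ht.2.trans ht₁.2⟩ hat fun s hs ↦ hball s ⟨hs.1, hs.2.trans ht.2⟩
      have h2 : 0 ≤ c * ‖φ (γ t) - φ (γ a)‖ := by positivity
      rw [map_sub] at h1
      linarith
    · have := (hZmem _ (hIcc t ht)).2.2
      linarith

end SpacetimeStructure

namespace SpacetimeStructure

variable {n : ℕ} {M : Type*} [TopologicalSpace M]
  [ChartedSpace (EuclideanSpace ℝ (Fin (n + 1))) M] [IsManifold (𝓡 (n + 1)) ∞ M]

theorem tendsto_chart_symm (x₀ : M) {y : EuclideanSpace ℝ (Fin (n + 1))}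
    (hy : y ∈ (extChartAt (𝓡 (n + 1)) x₀).target) {ι : Type*} {l : Filter ι}
    {f : ι → EuclideanSpace ℝ (Fin (n + 1))} (hf : Tendsto f l (𝓝 y)) :
    Tendsto (fun i ↦ (extChartAt (𝓡 (n + 1)) x₀).symm (f i)) l
      (𝓝 ((extChartAt (𝓡 (n + 1)) x₀).symm y)) :=
  ((continuousOn_extChartAt_symm x₀).continuousAt
    ((isOpen_extChartAt_target x₀).mem_nhds hy)).tendsto.comp hf

/-- Near a frontier point of `I⁻(A)` away from `A` the closure of `I⁻(A)` meets every level of the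
time function at a point not above any of the null rays. -/
theorem exists_level_limit [T2Space M] (g : SpacetimeStructure n M) {A : Set M} {x₀ : M}
    {T : EuclideanSpace ℝ (Fin (n + 1))} {ℓ : EuclideanSpace ℝ (Fin (n + 1)) →L[ℝ] ℝ} {r c K : ℝ}
    (h : IsLorentzPatch (g.chartMetric x₀) (g.chartTime x₀) (extChartAt (𝓡 (n + 1)) x₀ x₀) T ℓ r c K)
    (hsub : Metric.ball (extChartAt (𝓡 (n + 1)) x₀ x₀) r ⊆ (extChartAt (𝓡 (n + 1)) x₀).target)
    (hA : ∀ q ∈ A, q ∈ (extChartAt (𝓡 (n + 1)) x₀).source →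
      extChartAt (𝓡 (n + 1)) x₀ q ∉ Metric.ball (extChartAt (𝓡 (n + 1)) x₀ x₀) r)
    {τ : ℝ} (hτ0 : 0 < τ) (hτ : τ * (2 / c) < r / 4) (hx₀ : x₀ ∈ closure (g.chronPast A)) :
    ∃ z, ℓ z - ℓ (extChartAt (𝓡 (n + 1)) x₀ x₀) = τ ∧
      z ∈ Metric.ball (extChartAt (𝓡 (n + 1)) x₀ x₀) r ∧
      c * ‖z - extChartAt (𝓡 (n + 1)) x₀ x₀‖ ≤ τ ∧
      (extChartAt (𝓡 (n + 1)) x₀).symm z ∈ closure (g.chronPast A) ∧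
      ∀ f : EuclideanSpace ℝ (Fin (n + 1)) → ℝ,
        ContinuousAt f z → ContinuousAt f (extChartAt (𝓡 (n + 1)) x₀ x₀) →
        (∀ (σ : ℝ → EuclideanSpace ℝ (Fin (n + 1))) (a b : ℝ), a < b →
          (∀ t ∈ Icc a b, σ t ∈ Metric.ball (extChartAt (𝓡 (n + 1)) x₀ x₀) r ∧
            ℓ (σ t) - ℓ (extChartAt (𝓡 (n + 1)) x₀ x₀) ∈ Icc (-τ) τ) →
          (∀ t ∈ Icc a b, ∃ v, HasDerivWithinAt σ v (Icc a b) t ∧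
            g.chartMetric x₀ (σ t) v v < 0 ∧ g.chartTime x₀ (σ t) v < 0) → f (σ b) < f (σ a)) →
        f z ≤ f (extChartAt (𝓡 (n + 1)) x₀ x₀) := by
  set φ := extChartAt (𝓡 (n + 1)) x₀ with hφ
  set y₀ := φ x₀ with hy₀
  have hr := h.r_pos
  have hdense : ∃ᶠ p in 𝓝 x₀, p ∈ g.chronPast A := mem_closure_iff_frequently.1 hx₀
  have hN : ∀ δ > (0 : ℝ), ∀ᶠ p in 𝓝 x₀, p ∈ φ.source ∧ ‖φ p - y₀‖ < δ ∧ ‖φ p - y₀‖ < r / 4 ∧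
      |ℓ (φ p) - ℓ y₀| < τ := by
    intro δ hδ
    refine chart_mem_nhds x₀ (N := {y | ‖y - y₀‖ < δ ∧ ‖y - y₀‖ < r / 4 ∧ |ℓ y - ℓ y₀| < τ}) ?_
    have h1 : Continuous fun y ↦ ‖y - y₀‖ := by fun_prop
    have h2 : Continuous fun y ↦ |ℓ y - ℓ y₀| := by fun_prop
    refine IsOpen.mem_nhds ?_ ?_
    · exact (isOpen_lt h1 continuous_const).inter
        ((isOpen_lt h1 continuous_const).inter (isOpen_lt h2 continuous_const))
    · refine ⟨?_, ?_, ?_⟩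
      · change ‖y₀ - y₀‖ < δ
        rwa [sub_self, norm_zero]
      · change ‖y₀ - y₀‖ < r / 4
        rw [sub_self, norm_zero]
        linarith
      · change |ℓ y₀ - ℓ y₀| < τ
        rwa [sub_self, abs_zero]
  have hseq : ∀ j : ℕ, ∃ p, p ∈ g.chronPast A ∧ p ∈ φ.source ∧ ‖φ p - y₀‖ < 1 / ((j : ℝ) + 1) ∧
      ‖φ p - y₀‖ < r / 4 ∧ |ℓ (φ p) - ℓ y₀| < τ := fun j ↦
    (hdense.and_eventually (hN _ (by positivity))).exists
  choose p hpA hps hpj hpr hpτ using hseq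
  choose z hz1 hz2 hz3 hz4 hz5 using fun j ↦
    g.exists_mem_level h hsub hA hτ (hpA j) (hps j) (hpr j) (hpτ j)
  have hlim : Tendsto (fun j ↦ φ (p j)) atTop (𝓝 y₀) := by
    rw [tendsto_iff_norm_sub_tendsto_zero]
    exact squeeze_zero (fun j ↦ norm_nonneg _) (fun j ↦ (hpj j).le)
      tendsto_one_div_add_atTop_nhds_zero_nat
  obtain ⟨w, hw, s, hs, hsw⟩ := (isCompact_closedBall y₀ (r / 2)).tendsto_subseq hz2
  have hlim' := hlim.comp hs.tendsto_atTop
  have hwr : w ∈ Metric.ball y₀ r := Metric.closedBall_subset_ball (by linarith) hw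
  have hℓw : ℓ w - ℓ y₀ = τ := by
    have h1 : Tendsto (fun j ↦ ℓ ((z ∘ s) j) - ℓ y₀) atTop (𝓝 (ℓ w - ℓ y₀)) :=
      ((ℓ.continuous.tendsto w).comp hsw).sub_const _
    exact tendsto_nhds_unique h1 (tendsto_const_nhds.congr fun j ↦ (hz1 (s j)).symm)
  refine ⟨w, hℓw, hwr, ?_, ?_, fun f hf hf0 hdec ↦ ?_⟩
  · have h1 := hsw.sub hlim'
    rw [← hℓw, ← map_sub]
    exact le_of_tendsto_of_tendsto ((h1.norm).const_mul c) ((ℓ.continuous.tendsto _).comp h1)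
      (Eventually.of_forall fun j ↦ hz3 (s j))
  · exact mem_closure_of_tendsto (tendsto_chart_symm x₀ (hsub hwr) hsw)
      (Eventually.of_forall fun j ↦ hz4 (s j))
  · refine le_of_tendsto_of_tendsto (hf.tendsto.comp hsw) (hf0.tendsto.comp hlim')
      (Eventually.of_forall fun j ↦ ?_)
    exact (hz5 (s j) (fun u v ↦ f v < f u) (fun u v w huv hvw ↦ hvw.trans huv) hdec).le

/-- From each frontier point of `I⁻(A)` away from `A` starts a null geodesic segment in the
frontier. -/
theorem exists_mem_frontier_causalFutureIn [T2Space M] (g : SpacetimeStructure n M) {A U : Set M}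
    {x₀ : M} (hx₀ : x₀ ∈ frontier (g.chronPast A)) (hx₀A : x₀ ∉ closure A) (hU : IsOpen U)
    (hx₀U : x₀ ∈ U) : ∃ y ∈ frontier (g.chronPast A), y ∈ g.causalFutureIn x₀ U \ {x₀} := by
  obtain ⟨T, ℓ, r', c, K, h', hsub'⟩ := g.exists_patch x₀
  set φ := extChartAt (𝓡 (n + 1)) x₀ with hφ
  set y₀ := φ x₀ with hy₀
  have hφy₀ : φ.symm y₀ = x₀ := extChartAt_to_inv x₀
  have hV : ∀ᶠ y in 𝓝 y₀, φ.symm y ∈ U ∩ (closure A)ᶜ := by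
    have h1 : Tendsto φ.symm (𝓝 y₀) (𝓝 x₀) := by
      have := tendsto_chart_symm x₀ (mem_extChartAt_target x₀) (f := id) (l := 𝓝 y₀) tendsto_id
      rwa [← hφ, ← hy₀, hφy₀] at this
    exact h1 ((hU.inter isClosed_closure.isOpen_compl).mem_nhds ⟨hx₀U, hx₀A⟩)
  obtain ⟨ρ, hρ, hρV⟩ := Metric.eventually_nhds_iff_ball.1 hV
  set r := min r' ρ with hr
  have h := h'.shrink (lt_min h'.r_pos hρ) (min_le_left r' ρ)
  have hsub : Metric.ball y₀ r ⊆ φ.target :=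
    (Metric.ball_subset_ball (min_le_left _ _)).trans hsub'
  have hrV : ∀ y ∈ Metric.ball y₀ r, φ.symm y ∈ U ∩ (closure A)ᶜ := fun y hy ↦
    hρV y (Metric.ball_subset_ball (min_le_right _ _) hy)
  have hA : ∀ q ∈ A, q ∈ φ.source → φ q ∉ Metric.ball y₀ r := fun q hq hqs hqb ↦ by
    have := (hrV _ hqb).2
    rw [φ.left_inv hqs] at this
    exact this (subset_closure hq)
  have hx₀cl := frontier_subset_closure hx₀
  have hx₀F := g.notMem_chronPast_of_mem_frontier hx₀
  obtain ⟨C, hC, B, hB, τ₀, hτ₀, x, x', P, P', κ, hR⟩ := h.exists_null_rays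
  obtain ⟨k, hk, τ₁, hτ₁, hbar⟩ := h.exists_nullBarrier_lt hC.le
    (show (0 : ℝ) < 1 / 2 by norm_num) (show (0 : ℝ) ≤ 2 by norm_num)
  have hc := h.c_pos
  have hK := h.K_pos
  -- A bound for q - τ that does not depend on τ, so that τ can be chosen after it.
  set Q := √(K * (1 / c + ‖T‖) * (1 / c + ‖T‖)) with hQ
  have hsmall : ∀ᶠ τ in 𝓝[>] (0 : ℝ), τ ∈ Ioi (0 : ℝ) := self_mem_nhdsWithin
  obtain ⟨τ, hτ, e1, e2, e3, e4, e5, e6, e7, e8⟩ := (hsmall.and <|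
    (eventually_mul_lt hτ₀ 1).and <| (eventually_mul_lt hτ₁ 1).and <|
    (eventually_mul_lt one_pos 1).and <|
    (eventually_mul_lt (show (0 : ℝ) < r / 4 by linarith [h.r_pos]) (2 / c)).and <|
    h.eventually_segment_timelike.and <| (h.eventually_drift_timelike hC hB hτ₀ hR).and <|
    (h.eventually_barrier_pos hC hB hτ₀ hR (Q := Q) hk).and <|
    h.eventually_exists_ray hB hτ₀ hR).exists
  have hτ : 0 < τ := hτ
  rw [mul_one] at e1 e2 e3
  obtain ⟨z, hz1, hz2, hz3, hz4, hz5⟩ := g.exists_level_limit h hsub hA hτ e4 hx₀cl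
  -- A timelike curve from x₀ to z is impossible: z is in the closure of I⁻(A), so it would put x₀
  -- into the open set I⁻(A).
  have hcontra : ∀ σ : ℝ → EuclideanSpace ℝ (Fin (n + 1)), ContDiffOn ℝ ∞ σ (Icc 0 τ) → σ 0 = y₀ →
      σ τ = z → (∀ t ∈ Icc 0 τ, σ t ∈ Metric.ball y₀ r ∧ ∃ v, HasDerivWithinAt σ v (Icc 0 τ) t ∧
        g.chartMetric x₀ (σ t) v v < 0 ∧ g.chartTime x₀ (σ t) v < 0) → False := by
    intro σ hσ h0 hτz hder
    have := (g.isSmoothFutureTimelike_of_chart x₀ hτ hσ (fun t ht ↦ hsub (hder t ht).1)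
      fun t ht ↦ (hder t ht).2).mem_chronFutureIn
    rw [h0, hτz] at this
    rw [← hφ, hφy₀] at this
    exact hx₀F (g.mem_chronPast_of_mem_closure this hz4)
  set w := z - y₀ - τ • T with hw
  have hℓw : ℓ w = 0 := by
    rw [hw, map_sub, map_sub, map_smul, h.time_T, hz1, smul_eq_mul, mul_one, sub_self]
  have hzw : z = y₀ + τ • T + w := by rw [hw]; abel
  rcases lt_or_ge (√(g.chartMetric x₀ y₀ w w)) (τ / 2) with hlt | hge
  · exfalso
    refine hcontra (fun t ↦ y₀ + t • (T + τ⁻¹ • w)) (by fun_prop) (by simp) ?_ fun t ht ↦ ?_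
    · rw [hzw, smul_add, smul_smul, mul_inv_cancel₀ hτ.ne', one_smul, add_assoc]
    · obtain ⟨f1, f2⟩ := e5 w hℓw hlt t ht
      refine ⟨f1, _, ?_, f2⟩
      have := ((hasDerivAt_id t).smul_const (T + τ⁻¹ • w)).const_add y₀
      simpa using this.hasDerivWithinAt
  obtain ⟨m, hm, hm', q, hq, hq', hqz⟩ := e8 w hℓw hge
  rw [← hzw] at hqz
  obtain ⟨k1, k2, k3, k4⟩ := hR m hm hm'
  have hI : Icc 0 τ ⊆ Icc (-τ₀) τ₀ := Icc_subset_Icc (by linarith) e1.le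
  -- Now z = x m τ + (q - τ)m. For q < τ it is inside the cone, and drifting inwards from the ray at
  -- the constant rate (τ - q)/τ reaches it; the rate is at most 3/4 because q ≥ τ/4. For q = τ it
  -- is on the ray. For q > τ it is outside, where the barrier is positive.
  rcases lt_trichotomy q τ with hlt | heq | hgt
  · exfalso
    have hb1 : 0 < (τ - q) / τ := div_pos (by linarith) hτ
    have hb2 : (τ - q) / τ ≤ 3 / 4 := by
      rw [div_le_iff₀ hτ]
      linarith
    refine hcontra (fun t ↦ x m t - (t * ((τ - q) / τ)) • m)
      ((k3.mono hI).sub (by fun_prop)) (by simp [k2]) ?_ fun t ht ↦ ?_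
    · rw [mul_div_cancel₀ _ hτ.ne', hqz, ← neg_sub τ q, neg_smul, sub_eq_add_neg]
    · obtain ⟨f1, f2⟩ := e6 m hm hm' _ hb1 hb2 t ht
      refine ⟨f1, _, ?_, f2⟩
      have h1 : HasDerivAt (fun t : ℝ ↦ (t * ((τ - q) / τ)) • m) (((τ - q) / τ) • m) t := by
        have := ((hasDerivAt_id t).mul_const ((τ - q) / τ)).smul_const m
        simpa using this
      exact ((k1.deriv t (hI ht)).mono hI).sub h1.hasDerivWithinAt
  · rw [heq, sub_self, zero_smul, add_zero] at hqz
    have hcausal := g.isSmoothFutureCausal_of_chart x₀ hτ (k3.mono hI)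
      (fun t ht ↦ hsub (k1.mem t (hI ht))) fun t ht ↦ by
        refine ⟨x' m t, (k1.deriv t (hI ht)).mono hI, ?_, (k1.null t (hI ht)).le,
          h.future _ (k1.mem t (hI ht)) _ (k1.null t (hI ht)).le ?_⟩
        · intro h0
          have := k1.time_deriv t (hI ht)
          rw [h0, map_zero] at this
          exact zero_ne_one this
        · rw [k1.time_deriv t (hI ht)]
          exact one_pos
    have hmem : φ.symm z ∈ g.causalFutureIn x₀ U := by
      refine Or.inr ⟨_, 0, τ, .single hcausal, ?_, ?_, fun t ht ↦ (hrV _ (k1.mem t (hI ht))).1⟩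
      · change φ.symm (x m 0) = x₀
        rw [k2, hφy₀]
      · change φ.symm (x m τ) = φ.symm z
        rw [hqz]
    refine ⟨φ.symm z, ?_, hmem, ?_⟩
    · rw [(g.isOpen_chronPast A).frontier_eq]
      exact ⟨hz4, fun hzF ↦ hx₀F (g.mem_chronPast_of_causalFutureIn hmem hzF)⟩
    · intro heq'
      have h1 : z = y₀ := by
        rw [← φ.right_inv (hsub hz2), show φ.symm z = x₀ from heq']
      rw [h1, sub_self] at hz1
      linarith
  · exfalso
    have hqQ : q - τ ≤ Q := by
      have hw1 : ‖w‖ ≤ 1 / c + ‖T‖ := by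
        have i1 : ‖z - y₀‖ ≤ τ * (1 / c) := by
          rw [mul_one_div, le_div_iff₀ hc]
          linarith
        have i2 : ‖τ • T‖ = τ * ‖T‖ := by rw [norm_smul, Real.norm_eq_abs, abs_of_pos hτ]
        have i3 := norm_sub_le (z - y₀) (τ • T)
        have i4 : τ * (1 / c) ≤ 1 * (1 / c) := by gcongr
        have i5 : τ * ‖T‖ ≤ 1 * ‖T‖ := by gcongr
        rw [hw]
        linarith
      have : √(g.chartMetric x₀ y₀ w w) ≤ Q := by
        refine Real.sqrt_le_sqrt ?_
        refine (le_abs_self _).trans ((h.apply_le h.mem_center w w).trans ?_)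
        gcongr
      linarith
    have hpos := e7 m hm hm' (q - τ) (by linarith) hqQ
    rw [← hqz] at hpos
    have hle := hz5 (nullBarrier (g.chartMetric x₀) y₀ ℓ (x m) (P m) k)
      (k1.continuousAt_nullBarrier (by
        rw [hz1]
        exact Icc_mem_nhds (by linarith) e1) k)
      (k1.continuousAt_nullBarrier (by
        rw [sub_self]
        exact Icc_mem_nhds (by linarith) hτ₀) k)
      (fun σ a b hab hσ hder ↦ hbar (Icc (-τ) τ) _ _ _ _ _
        (k1.mono (Icc_subset_Icc (by linarith) e1.le))
        (fun s hs ↦ (abs_le.2 hs).trans e2.le) σ a b hab (fun t ht ↦ (hσ t ht).1)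
        (fun t ht ↦ (hσ t ht).2) hder)
    have h0 : nullBarrier (g.chartMetric x₀) y₀ ℓ (x m) (P m) k y₀ = 0 := by
      rw [nullBarrier, sub_self, k2, sub_self, map_zero, map_zero, mul_zero, mul_zero, sub_zero]
    change _ ≤ nullBarrier (g.chartMetric x₀) y₀ ℓ (x m) (P m) k y₀ at hle
    rw [h0] at hle
    linarith

end SpacetimeStructure

namespace SpacetimeStructure

variable {n : ℕ} {M : Type*} [TopologicalSpace M]
  [ChartedSpace (EuclideanSpace ℝ (Fin (n + 1))) M] [IsManifold (𝓡 (n + 1)) ∞ M]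

/-! ### Future lightlike sets and future edges -/

theorem AchronalIn.mono {g : SpacetimeStructure n M} {A U V : Set M} (h : g.AchronalIn A U)
    (hV : V ⊆ U) : g.AchronalIn A V := fun x hx y hy hxy ↦
  h x ⟨hx.1, hV hx.2⟩ y ⟨hy.1, hV hy.2⟩ (g.chronFutureIn_mono hV hxy)

theorem exists_of_notMem_futureEdge {g : SpacetimeStructure n M} {A U : Set M} {x : M}
    (hx : x ∈ closure A) (hxA : x ∉ g.futureEdge A) (hU : IsOpen U) (hxU : x ∈ U) :
    ∃ y ∈ A ∩ U, y ∈ g.causalFutureIn x U \ {x} := by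
  by_contra! hcon
  refine hxA ⟨hx, U, hU, hxU, fun y hy ↦ ?_⟩
  by_contra hne
  exact hcon y ⟨hy.1, g.causalFutureIn_subset hxU hy.2⟩ ⟨hy.2, hne⟩

/-- A point of A is off the future edge exactly when every neighbourhood U contains a point of A in
J⁺(x, U) other than x. The definition of lightlike asks this only for achronal neighbourhoods, but
any U can be intersected with one of those. -/
theorem futureLightlike_iff (g : SpacetimeStructure n M) {A : Set M} (hA : A.Nonempty)
    (hA' : g.LocallyAchronal A) : g.FutureLightlike A ↔ A ∩ g.futureEdge A = ∅ := by
  constructor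
  · intro h
    rw [eq_empty_iff_forall_notMem]
    rintro x ⟨hxA, -, U, hU, hxU, hUx⟩
    obtain ⟨V, hV, hxV, hVA⟩ := hA' x hxA
    obtain ⟨y, hy, hyJ, hyx⟩ := h.exists_future x hxA (V ∩ U) (hV.inter hU) ⟨hxV, hxU⟩
      (hVA.mono inter_subset_left)
    exact hyx (hUx ⟨hy.1, g.causalFutureIn_mono inter_subset_right hyJ⟩)
  · intro h
    refine ⟨hA, hA', fun x hx U hU hxU _ ↦ exists_of_notMem_futureEdge (subset_closure hx) ?_ hU hxU⟩
    exact fun hxe ↦ (h ▸ (⟨hx, hxe⟩ : x ∈ A ∩ g.futureEdge A) : x ∈ (∅ : Set M))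

/-- The new point is sought inside U minus the closed set `closure (g.futureEdge A)`, so it avoids
the edge automatically. At points of `closure A` it comes from A itself, elsewhere from the null
generator. -/
theorem futureLightlike_frontier_diff [T2Space M] (g : SpacetimeStructure n M) {A : Set M}
    (hne : (frontier (g.chronPast A) \ closure (g.futureEdge A)).Nonempty) :
    g.FutureLightlike (frontier (g.chronPast A) \ closure (g.futureEdge A)) := by
  refine ⟨hne, fun x _ ↦ ⟨univ, isOpen_univ, mem_univ x,
    (g.achronal_frontier_chronPast A).mono sdiff_subset⟩, fun x hx U hU hxU _ ↦ ?_⟩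
  have hU' : IsOpen (U \ closure (g.futureEdge A)) := hU.sdiff isClosed_closure
  have hxU' : x ∈ U \ closure (g.futureEdge A) := ⟨hxU, hx.2⟩
  obtain ⟨y, hyF, hyJ, hyx⟩ : ∃ y ∈ frontier (g.chronPast A),
      y ∈ g.causalFutureIn x (U \ closure (g.futureEdge A)) \ {x} := by
    by_cases hxA : x ∈ closure A
    · obtain ⟨y, hy, hyJ⟩ := exists_of_notMem_futureEdge hxA
        (fun hxe ↦ hx.2 (subset_closure hxe)) hU' hxU'
      refine ⟨y, ?_, hyJ⟩
      rw [(g.isOpen_chronPast A).frontier_eq]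
      exact ⟨g.subset_closure_chronPast A hy.1, fun hyF ↦ g.notMem_chronPast_of_mem_frontier hx.1
        (g.mem_chronPast_of_causalFutureIn hyJ.1 hyF)⟩
    · exact g.exists_mem_frontier_causalFutureIn hx.1 hxA hU' hxU'
  have hyU := g.causalFutureIn_subset hxU' hyJ
  exact ⟨y, ⟨⟨hyF, hyU.2⟩, hyU.1⟩, g.causalFutureIn_mono sdiff_subset hyJ, hyx⟩

theorem FutureLightlike.hasFuturePHorizon [T2Space M] {g : SpacetimeStructure n M} {A : Set M}
    (hA : g.FutureLightlike A) (he : g.futureEdge A = ∅)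
    (hne : (frontier (g.chronPast A)).Nonempty) : g.HasFuturePHorizon A := by
  have hdiff : frontier (g.chronPast A) \ closure (g.futureEdge A) = frontier (g.chronPast A) := by
    rw [he, closure_empty, sdiff_empty]
  have := g.futureLightlike_frontier_diff (A := A) (by rwa [hdiff])
  rw [hdiff] at this
  exact ⟨hA, hne, this, isClosed_frontier, g.isC0Hypersurface_frontier_chronPast A⟩

end SpacetimeStructure

/-! ### Geodesics and changes of coordinates -/

/-- The geodesic equation in one coordinate system gives the Euler–Lagrange equation of the energy
in every other one: if the form `G` is the pull-back of `H` by `ψ` and `c` satisfies the geodesic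
equation of `G` at time `t`, then the momentum `H (ĉ') ` of `ĉ = ψ ∘ c` has the derivative
`½ ∂H (ĉ', ĉ')` at `t`. -/
theorem momentum_deriv_apply_of_geodesic {E F : Type*} [NormedAddCommGroup E] [NormedSpace ℝ E]
    [NormedAddCommGroup F] [NormedSpace ℝ F]
    {G : E → E →L[ℝ] E →L[ℝ] ℝ} {G' : E →L[ℝ] E →L[ℝ] E →L[ℝ] ℝ}
    {H : F → F →L[ℝ] F →L[ℝ] ℝ} {H' : F →L[ℝ] F →L[ℝ] F →L[ℝ] ℝ}
    {ψ : E → F} {c c' : ℝ → E} {c'' : E} {D : Set ℝ} {t : ℝ} {P' : F →L[ℝ] ℝ}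
    (ht : t ∈ D) (hD : UniqueDiffWithinAt ℝ D t)
    (hc : HasDerivWithinAt c (c' t) D t) (hc' : HasDerivWithinAt c' c'' D t)
    (hψ : ContDiffAt ℝ 2 ψ (c t)) (hG : HasFDerivAt G G' (c t)) (hH : HasFDerivAt H H' (ψ (c t)))
    (hsymm : ∀ u v, H (ψ (c t)) u v = H (ψ (c t)) v u)
    (hpull : ∀ᶠ y in 𝓝 (c t), ∀ u v, G y u v = H (ψ y) (fderiv ℝ ψ y u) (fderiv ℝ ψ y v))
    (hP : HasDerivWithinAt (fun s ↦ H (ψ (c s)) (fderiv ℝ ψ (c s) (c' s))) P' D t) (w : E)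
    (hgeo : G (c t) c'' w + (1 / 2 : ℝ) *
      (G' (c' t) (c' t) w + G' (c' t) (c' t) w - G' w (c' t) (c' t)) = 0) :
    P' (fderiv ℝ ψ (c t) w) =
      1 / 2 * H' (fderiv ℝ ψ (c t) w) (fderiv ℝ ψ (c t) (c' t)) (fderiv ℝ ψ (c t) (c' t)) := by
  obtain ⟨B, hB⟩ : ∃ B, HasFDerivAt (fderiv ℝ ψ) B (c t) :=
    ⟨_, ((hψ.fderiv_right (m := 1) (by norm_num)).differentiableAt (by simp)).hasFDerivAt⟩
  have hBsymm : ∀ u v, B u v = B v u := by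
    have := hψ.isSymmSndFDerivAt (by simp)
    rwa [IsSymmSndFDerivAt, hB.fderiv] at this
  have hψ' : HasFDerivAt ψ (fderiv ℝ ψ (c t)) (c t) :=
    (hψ.differentiableAt (by simp)).hasFDerivAt
  -- The pull-back identity is differentiated twice: here along the curve with w fixed, then in
  -- direction w with the velocity frozen. The second derivative B of ψ is symmetric, so its
  -- contributions cancel when the two are combined with the geodesic equation.
  have e1 : G' (c' t) (c' t) w + G (c t) c'' w =
      P' (fderiv ℝ ψ (c t) w) + H (ψ (c t)) (fderiv ℝ ψ (c t) (c' t)) (B (c' t) w) := by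
    have hGc := HasFDerivAt.comp_hasDerivWithinAt (l := G) (f := c) t hG hc
    have hBc := HasFDerivAt.comp_hasDerivWithinAt (l := fderiv ℝ ψ) (f := c) t hB hc
    have h1 := (hGc.clm_apply hc').clm_apply (hasDerivWithinAt_const t D w)
    have h2 := hP.clm_apply (hBc.clm_apply (hasDerivWithinAt_const t D w))
    have h3 : (fun s ↦ G (c s) (c' s) w) =ᶠ[𝓝[D] t]
        fun s ↦ H (ψ (c s)) (fderiv ℝ ψ (c s) (c' s)) (fderiv ℝ ψ (c s) w) := by
      filter_upwards [hc.continuousWithinAt.eventually hpull] with s hs using hs _ _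
    have h4 := hD.eq_deriv _ h1 (h2.congr_of_eventuallyEq h3 (h3.self_of_nhdsWithin ht))
    simpa using h4
  have e2 : G' w (c' t) (c' t) = H' (fderiv ℝ ψ (c t) w) (fderiv ℝ ψ (c t) (c' t))
      (fderiv ℝ ψ (c t) (c' t)) +
        2 * H (ψ (c t)) (fderiv ℝ ψ (c t) (c' t)) (B (c' t) w) := by
    have hl : HasDerivAt (fun τ : ℝ ↦ c t + τ • w) w 0 := by
      simpa using ((hasDerivAt_id (0 : ℝ)).smul_const w).const_add (c t)
    have h0 : c t + (0 : ℝ) • w = c t := by simp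
    have hGc := HasFDerivAt.comp_hasDerivAt (l := G) (f := fun τ : ℝ ↦ c t + τ • w) 0
      (by rwa [h0]) hl
    have hψc := HasFDerivAt.comp_hasDerivAt (l := ψ) (f := fun τ : ℝ ↦ c t + τ • w) 0
      (by rwa [h0]) hl
    have hHc := HasFDerivAt.comp_hasDerivAt (l := H) (f := ψ ∘ fun τ : ℝ ↦ c t + τ • w) 0
      (by simpa only [Function.comp, h0] using hH) hψc
    have hBc := (HasFDerivAt.comp_hasDerivAt (l := fderiv ℝ ψ) (f := fun τ : ℝ ↦ c t + τ • w) 0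
      (by rwa [h0]) hl).clm_apply (hasDerivAt_const (0 : ℝ) (c' t))
    have h1 := (hGc.clm_apply (hasDerivAt_const (0 : ℝ) (c' t))).clm_apply
      (hasDerivAt_const (0 : ℝ) (c' t))
    have h2 := (hHc.clm_apply hBc).clm_apply hBc
    have h3 : (fun τ : ℝ ↦ G (c t + τ • w) (c' t) (c' t)) =ᶠ[𝓝 0]
        fun τ ↦ H (ψ (c t + τ • w)) (fderiv ℝ ψ (c t + τ • w) (c' t))
          (fderiv ℝ ψ (c t + τ • w) (c' t)) := by
      have : ContinuousAt (fun τ : ℝ ↦ c t + τ • w) 0 := hl.continuousAt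
      rw [ContinuousAt, h0] at this
      filter_upwards [this.eventually hpull] with s hs using hs _ _
    have h4 := h1.unique (h2.congr_of_eventuallyEq h3)
    simp only [Function.comp, h0, map_zero, add_zero, add_apply] at h4
    rw [h4, hsymm (B w (c' t)), hBsymm w]
    ring
  linarith

namespace SpacetimeStructure

variable {n : ℕ} {M : Type*} [TopologicalSpace M]
  [ChartedSpace (EuclideanSpace ℝ (Fin (n + 1))) M] [IsManifold (𝓡 (n + 1)) ∞ M]

/-- The coordinate change from the preferred chart at `p` to the one at `x₀`. -/
def coordChange (p x₀ : M) (y : EuclideanSpace ℝ (Fin (n + 1))) : EuclideanSpace ℝ (Fin (n + 1)) :=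
  extChartAt (𝓡 (n + 1)) x₀ ((extChartAt (𝓡 (n + 1)) p).symm y)

theorem contDiffAt_coordChange (p x₀ : M) {y : EuclideanSpace ℝ (Fin (n + 1))}
    (hy : y ∈ (extChartAt (𝓡 (n + 1)) p).target)
    (hy' : (extChartAt (𝓡 (n + 1)) p).symm y ∈ (extChartAt (𝓡 (n + 1)) x₀).source) :
    ContDiffAt ℝ ∞ (coordChange p x₀) y := by
  rw [← contMDiffAt_iff_contDiffAt]
  have h1 : ContMDiffAt (𝓡 (n + 1)) 𝓘(ℝ, EuclideanSpace ℝ (Fin (n + 1))) ∞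
      (extChartAt (𝓡 (n + 1)) x₀) ((extChartAt (𝓡 (n + 1)) p).symm y) :=
    contMDiffAt_extChartAt' (by rwa [← extChartAt_source (𝓡 (n + 1)) x₀])
  exact h1.comp y ((contMDiffOn_extChartAt_symm (I := 𝓡 (n + 1)) (n := ∞) p).contMDiffAt
    ((isOpen_extChartAt_target p).mem_nhds hy))

theorem chartFrame_coordChange (p x₀ : M) {y : EuclideanSpace ℝ (Fin (n + 1))}
    (hy : y ∈ (extChartAt (𝓡 (n + 1)) p).target)
    (hy' : (extChartAt (𝓡 (n + 1)) p).symm y ∈ (extChartAt (𝓡 (n + 1)) x₀).source)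
    (u : EuclideanSpace ℝ (Fin (n + 1))) :
    chartFrame p y u = chartFrame x₀ (coordChange p x₀ y) (fderiv ℝ (coordChange p x₀) y u) := by
  have h1 : MDifferentiableAt 𝓘(ℝ, EuclideanSpace ℝ (Fin (n + 1))) (𝓡 (n + 1))
      (extChartAt (𝓡 (n + 1)) x₀).symm (coordChange p x₀ y) :=
    ((contMDiffOn_extChartAt_symm (I := 𝓡 (n + 1)) (n := ∞) x₀).contMDiffAt
      ((isOpen_extChartAt_target x₀).mem_nhds
        ((extChartAt (𝓡 (n + 1)) x₀).map_source hy'))).mdifferentiableAt (by simp)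
  have h2 := ((contDiffAt_coordChange p x₀ hy hy').differentiableAt
    (by simp)).hasFDerivAt.hasMFDerivAt
  have h3 := (HasMFDerivAt.comp y h1.hasMFDerivAt h2).mfderiv
  have hcont : ContinuousAt (extChartAt (𝓡 (n + 1)) p).symm y :=
    (continuousOn_extChartAt_symm p).continuousAt ((isOpen_extChartAt_target p).mem_nhds hy)
  have h4 : (extChartAt (𝓡 (n + 1)) p).symm =ᶠ[𝓝 y]
      (extChartAt (𝓡 (n + 1)) x₀).symm ∘ coordChange p x₀ := by
    filter_upwards [hcont ((isOpen_extChartAt_source x₀).mem_nhds hy')] with z hz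
    exact ((extChartAt (𝓡 (n + 1)) x₀).left_inv hz).symm
  have h5 := h4.mfderiv_eq (I := 𝓘(ℝ, EuclideanSpace ℝ (Fin (n + 1)))) (I' := 𝓡 (n + 1))
  unfold chartFrame
  erw [h5, h3]
  rfl

theorem chartMetric_coordChange (g : SpacetimeStructure n M) (p x₀ : M)
    {y : EuclideanSpace ℝ (Fin (n + 1))} (hy : y ∈ (extChartAt (𝓡 (n + 1)) p).target)
    (hy' : (extChartAt (𝓡 (n + 1)) p).symm y ∈ (extChartAt (𝓡 (n + 1)) x₀).source)
    (u v : EuclideanSpace ℝ (Fin (n + 1))) :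
    g.chartMetric p y u v = g.chartMetric x₀ (coordChange p x₀ y)
      (fderiv ℝ (coordChange p x₀) y u) (fderiv ℝ (coordChange p x₀) y v) := by
  rw [chartMetric_apply, chartMetric_apply, ← chartFrame_coordChange p x₀ hy hy',
    ← chartFrame_coordChange p x₀ hy hy', coordChange, (extChartAt (𝓡 (n + 1)) x₀).left_inv hy']

theorem hasFDerivAt_chartMetric (g : SpacetimeStructure n M) (x₀ : M)
    {y : EuclideanSpace ℝ (Fin (n + 1))} (hy : y ∈ (extChartAt (𝓡 (n + 1)) x₀).target) :
    HasFDerivAt (g.chartMetric x₀) (fderiv ℝ (g.chartMetric x₀) y) y :=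
  (((g.contDiffOn_chartMetric x₀).contDiffAt
    ((isOpen_extChartAt_target x₀).mem_nhds hy)).differentiableAt (by simp)).hasFDerivAt

theorem fderiv_chartMetric_apply_apply (g : SpacetimeStructure n M) (x₀ : M)
    {y : EuclideanSpace ℝ (Fin (n + 1))} (hy : y ∈ (extChartAt (𝓡 (n + 1)) x₀).target)
    (u v w : EuclideanSpace ℝ (Fin (n + 1))) :
    fderiv ℝ (fun z ↦ g.chartMetric x₀ z u v) y w = fderiv ℝ (g.chartMetric x₀) y w u v := by
  have hl : HasDerivAt (fun τ : ℝ ↦ y + τ • w) w 0 := by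
    simpa using ((hasDerivAt_id (0 : ℝ)).smul_const w).const_add y
  have h0 : y + (0 : ℝ) • w = y := by simp
  have h := g.hasFDerivAt_chartMetric x₀ hy
  have h1 := ((HasFDerivAt.comp_hasDerivAt (l := g.chartMetric x₀) (f := fun τ : ℝ ↦ y + τ • w) 0
    (by rwa [h0]) hl).clm_apply (hasDerivAt_const (0 : ℝ) u)).clm_apply (hasDerivAt_const (0 : ℝ) v)
  have hd : DifferentiableAt ℝ (fun z ↦ g.chartMetric x₀ z u v) y := by
    exact (h.differentiableAt.clm_apply (differentiableAt_const u)).clm_apply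
      (differentiableAt_const v)
  have h2 := HasFDerivAt.comp_hasDerivAt (l := fun z ↦ g.chartMetric x₀ z u v)
    (f := fun τ : ℝ ↦ y + τ • w) 0 (by rw [h0]; exact hd.hasFDerivAt) hl
  simpa using h2.unique h1

theorem contDiffWithinAt_extChartAt_comp (x₀ : M) {γ : ℝ → M} {D : Set ℝ} {t : ℝ}
    (hγ : ContMDiffWithinAt 𝓘(ℝ, ℝ) (𝓡 (n + 1)) ∞ γ D t)
    (ht : γ t ∈ (extChartAt (𝓡 (n + 1)) x₀).source) :
    ContDiffWithinAt ℝ ∞ (fun s ↦ extChartAt (𝓡 (n + 1)) x₀ (γ s)) D t := by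
  rw [← contMDiffWithinAt_iff_contDiffWithinAt]
  have h1 : ContMDiffAt (𝓡 (n + 1)) 𝓘(ℝ, EuclideanSpace ℝ (Fin (n + 1))) ∞
      (extChartAt (𝓡 (n + 1)) x₀) (γ t) :=
    contMDiffAt_extChartAt' (by rwa [← extChartAt_source (𝓡 (n + 1)) x₀])
  exact h1.comp_contMDiffWithinAt t hγ

/-- The Euler–Lagrange equation of a geodesic in an arbitrary preferred chart. -/
theorem IsGeodesicOn.exists_momentum_deriv {g : SpacetimeStructure n M} {γ : ℝ → M} {D : Set ℝ}
    (hγ : g.IsGeodesicOn γ D) (hD : UniqueDiffOn ℝ D) (x₀ : M) {t : ℝ} (ht : t ∈ D)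
    (hs : γ t ∈ (extChartAt (𝓡 (n + 1)) x₀).source)
    {c v : ℝ → EuclideanSpace ℝ (Fin (n + 1))}
    (hc : c = fun s ↦ extChartAt (𝓡 (n + 1)) x₀ (γ s)) (hv : v = derivWithin c D) :
    ∃ P', HasDerivWithinAt (fun s ↦ g.chartMetric x₀ (c s) (v s)) P' D t ∧
      ∀ w, P' w = 1 / 2 * fderiv ℝ (g.chartMetric x₀) (c t) w (v t) (v t) := by
  subst hc hv
  have hsm : ∀ x : M, ∀ s ∈ D, γ s ∈ (extChartAt (𝓡 (n + 1)) x).source →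
      ContDiffWithinAt ℝ ∞ (fun s ↦ extChartAt (𝓡 (n + 1)) x (γ s)) D s := fun x s hs hx ↦
    contDiffWithinAt_extChartAt_comp x (hγ.1 s hs) hx
  have hd : ∀ x : M, ∀ s ∈ D, γ s ∈ (extChartAt (𝓡 (n + 1)) x).source →
      HasDerivWithinAt (fun s ↦ extChartAt (𝓡 (n + 1)) x (γ s))
        (derivWithin (fun s ↦ extChartAt (𝓡 (n + 1)) x (γ s)) D s) D s := fun x s hs hx ↦
    ((hsm x s hs hx).differentiableWithinAt (by simp)).hasDerivWithinAt
  have hdd : ∀ x : M, γ t ∈ (extChartAt (𝓡 (n + 1)) x).source →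
      HasDerivWithinAt (derivWithin (fun s ↦ extChartAt (𝓡 (n + 1)) x (γ s)) D)
        (derivWithin (derivWithin (fun s ↦ extChartAt (𝓡 (n + 1)) x (γ s)) D) D t) D t := by
    intro x hx
    have h1 := (hsm x t ht hx).fderivWithin_right (m := 1) hD (by decide) ht
    have h2 := (h1.clm_apply (contDiffWithinAt_const (c := (1 : ℝ)))).differentiableWithinAt
      (by simp)
    exact h2.hasDerivWithinAt
  have hp := mem_extChartAt_source (I := 𝓡 (n + 1)) (γ t)
  have hchange : ∀ s ∈ D, γ s ∈ (extChartAt (𝓡 (n + 1)) (γ t)).source →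
      γ s ∈ (extChartAt (𝓡 (n + 1)) x₀).source →
      derivWithin (fun s ↦ extChartAt (𝓡 (n + 1)) x₀ (γ s)) D s =
        fderiv ℝ (coordChange (γ t) x₀) (extChartAt (𝓡 (n + 1)) (γ t) (γ s))
          (derivWithin (fun s ↦ extChartAt (𝓡 (n + 1)) (γ t) (γ s)) D s) := by
    intro s hs h1 h2
    have h3 := ((contDiffAt_coordChange (γ t) x₀ ((extChartAt (𝓡 (n + 1)) (γ t)).map_source h1)
      (by rwa [(extChartAt (𝓡 (n + 1)) (γ t)).left_inv h1])).differentiableAt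
      (by simp)).hasFDerivAt.comp_hasDerivWithinAt (f := fun s ↦
        extChartAt (𝓡 (n + 1)) (γ t) (γ s)) s (hd (γ t) s hs h1)
    have h4 : (fun s ↦ extChartAt (𝓡 (n + 1)) x₀ (γ s)) =ᶠ[𝓝[D] s]
        coordChange (γ t) x₀ ∘ fun s ↦ extChartAt (𝓡 (n + 1)) (γ t) (γ s) := by
      filter_upwards [(hγ.1 s hs).continuousWithinAt
        ((isOpen_extChartAt_source (γ t)).mem_nhds h1)] with r hr
      rw [Function.comp, coordChange, (extChartAt (𝓡 (n + 1)) (γ t)).left_inv hr]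
    exact (h3.congr_of_eventuallyEq h4 (h4.self_of_nhdsWithin hs)).derivWithin (hD s hs)
  have hy := (extChartAt (𝓡 (n + 1)) (γ t)).map_source hp
  have hback := (extChartAt (𝓡 (n + 1)) (γ t)).left_inv hp
  have hψ := contDiffAt_coordChange (γ t) x₀ hy (by rwa [hback])
  have hψp : coordChange (γ t) x₀ (extChartAt (𝓡 (n + 1)) (γ t) (γ t)) =
      extChartAt (𝓡 (n + 1)) x₀ (γ t) := by
    rw [coordChange, hback]
  have htar := (extChartAt (𝓡 (n + 1)) x₀).map_source hs
  have hcont : ContinuousAt (extChartAt (𝓡 (n + 1)) (γ t)).symm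
      (extChartAt (𝓡 (n + 1)) (γ t) (γ t)) :=
    (continuousOn_extChartAt_symm (γ t)).continuousAt
      ((isOpen_extChartAt_target (γ t)).mem_nhds hy)
  have hpull : ∀ᶠ y in 𝓝 (extChartAt (𝓡 (n + 1)) (γ t) (γ t)), ∀ u v,
      g.chartMetric (γ t) y u v = g.chartMetric x₀ (coordChange (γ t) x₀ y)
        (fderiv ℝ (coordChange (γ t) x₀) y u) (fderiv ℝ (coordChange (γ t) x₀) y v) := by
    filter_upwards [(isOpen_extChartAt_target (γ t)).mem_nhds hy,
      hcont ((isOpen_extChartAt_source x₀).mem_nhds (by rwa [hback]))] with y h1 h2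
    exact g.chartMetric_coordChange (γ t) x₀ h1 h2
  have hγc : ContinuousWithinAt γ D t := (hγ.1 t ht).continuousWithinAt
  have hP : (fun s ↦ g.chartMetric x₀ (extChartAt (𝓡 (n + 1)) x₀ (γ s))
      (derivWithin (fun s ↦ extChartAt (𝓡 (n + 1)) x₀ (γ s)) D s)) =ᶠ[𝓝[D] t]
      fun s ↦ g.chartMetric x₀ (coordChange (γ t) x₀ (extChartAt (𝓡 (n + 1)) (γ t) (γ s)))
        (fderiv ℝ (coordChange (γ t) x₀) (extChartAt (𝓡 (n + 1)) (γ t) (γ s))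
          (derivWithin (fun s ↦ extChartAt (𝓡 (n + 1)) (γ t) (γ s)) D s)) := by
    filter_upwards [hγc ((isOpen_extChartAt_source (γ t)).mem_nhds hp),
      hγc ((isOpen_extChartAt_source x₀).mem_nhds hs), self_mem_nhdsWithin] with s h1 h2 h3
    rw [hchange s h3 h1 h2, coordChange, (extChartAt (𝓡 (n + 1)) (γ t)).left_inv h1]
  obtain ⟨P', hP'⟩ : ∃ P', HasDerivWithinAt (fun s ↦ g.chartMetric x₀
      (extChartAt (𝓡 (n + 1)) x₀ (γ s))
      (derivWithin (fun s ↦ extChartAt (𝓡 (n + 1)) x₀ (γ s)) D s)) P' D t :=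
    ⟨_, (HasFDerivAt.comp_hasDerivWithinAt (l := g.chartMetric x₀)
      (f := fun s ↦ extChartAt (𝓡 (n + 1)) x₀ (γ s)) t (g.hasFDerivAt_chartMetric x₀ htar)
      (hd x₀ t ht hs)).clm_apply (hdd x₀ hs)⟩
  refine ⟨P', hP', fun w ↦ ?_⟩
  -- The geodesic equation is stated in the chart at γ(t), which moves with t. It transfers to the
  -- fixed chart on vectors in the image of the derivative of the coordinate change, and this
  -- derivative is onto.
  obtain ⟨w, rfl⟩ : ∃ w', fderiv ℝ (coordChange (γ t) x₀)
      (extChartAt (𝓡 (n + 1)) (γ t) (γ t)) w' = w := by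
    obtain ⟨w', hw'⟩ := (chartFrame_bijective (γ t) hy).2
      (chartFrame x₀ (extChartAt (𝓡 (n + 1)) x₀ (γ t)) w)
    refine ⟨w', (chartFrame_bijective x₀ htar).1 ?_⟩
    rw [← hw', chartFrame_coordChange (γ t) x₀ hy (by rwa [hback]), hψp]
  have hgeo := hγ.2 t ht w
  simp only [metricInChart_eq, christoffel] at hgeo
  have key := momentum_deriv_apply_of_geodesic (G := g.chartMetric (γ t))
    (H := g.chartMetric x₀) (ψ := coordChange (γ t) x₀)
    (c := fun s ↦ extChartAt (𝓡 (n + 1)) (γ t) (γ s)) ht (hD t ht) (hd (γ t) t ht hp)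
    (hdd (γ t) hp) (hψ.of_le (by decide)) (g.hasFDerivAt_chartMetric (γ t) hy)
    (by rw [hψp]; exact g.hasFDerivAt_chartMetric x₀ htar)
    (g.chartMetric_symm x₀ _) hpull (hP'.congr_of_eventuallyEq hP.symm
      (hP.self_of_nhdsWithin ht).symm) w
    (by simpa only [← fderiv_chartMetric_apply_apply g (γ t) hy] using hgeo)
  rw [key, hchange t ht hp hs]

end SpacetimeStructure

/-! ### Null rays from null geodesics -/

/-- A function on a compact interval with derivative bounded below by a positive constant has a
differentiable inverse. -/
theorem exists_inverse_of_deriv_ge {s s' : ℝ → ℝ} {α β m : ℝ} (hm : 0 < m) (hαβ : α ≤ β)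
    (hs : ∀ t ∈ Icc α β, HasDerivWithinAt s (s' t) (Icc α β) t) (hs' : ∀ t ∈ Icc α β, m ≤ s' t) :
    StrictMonoOn s (Icc α β) ∧ ∃ τ : ℝ → ℝ, (∀ t ∈ Icc α β, τ (s t) = t) ∧
      ∀ x ∈ Icc (s α) (s β), τ x ∈ Icc α β ∧ s (τ x) = x ∧
        HasDerivWithinAt τ (s' (τ x))⁻¹ (Icc (s α) (s β)) x := by
  have hcont : ContinuousOn s (Icc α β) := fun t ht ↦ (hs t ht).continuousWithinAt
  have hint : ∀ t ∈ interior (Icc α β), HasDerivAt s (s' t) t := fun t ht ↦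
    (hs t (interior_subset ht)).hasDerivAt (mem_interior_iff_mem_nhds.1 ht)
  have hle := (convex_Icc α β).mul_sub_le_image_sub_of_le_deriv hcont
    (fun t ht ↦ (hint t ht).differentiableAt.differentiableWithinAt)
    (fun t ht ↦ (hint t ht).deriv ▸ hs' t (interior_subset ht))
  have hmono : StrictMonoOn s (Icc α β) := fun x hx y hy hxy ↦ by
    have := hle x hx y hy hxy.le
    nlinarith
  have hsurj : ∀ x ∈ Icc (s α) (s β), ∃ t ∈ Icc α β, s t = x := fun x hx ↦
    intermediate_value_Icc hαβ hcont hx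
  choose! τ hτ hτs using hsurj
  have hmaps : ∀ t ∈ Icc α β, s t ∈ Icc (s α) (s β) := fun t ht ↦
    ⟨hmono.monotoneOn (left_mem_Icc.2 hαβ) ht ht.1, hmono.monotoneOn ht (right_mem_Icc.2 hαβ) ht.2⟩
  refine ⟨hmono, τ, fun t ht ↦ hmono.injOn (hτ _ (hmaps t ht)) ht (hτs _ (hmaps t ht)),
    fun x hx ↦ ⟨hτ x hx, hτs x hx, ?_⟩⟩
  -- The lower bound on the derivative makes the inverse Lipschitz, hence continuous, which is what
  -- the derivative formula for inverses needs.
  have hlip : ∀ y ∈ Icc (s α) (s β), ∀ z ∈ Icc (s α) (s β), m * |τ y - τ z| ≤ |y - z| := by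
    intro y hy z hz
    wlog h : τ z ≤ τ y generalizing y z
    · rw [abs_sub_comm (τ y), abs_sub_comm y]
      exact this z hz y hy (le_of_not_ge h)
    have h1 := hle _ (hτ z hz) _ (hτ y hy) h
    rw [hτs z hz, hτs y hy] at h1
    rw [abs_of_nonneg (sub_nonneg.2 h)]
    exact h1.trans (le_abs_self _)
  have hτc : ContinuousWithinAt τ (Icc (s α) (s β)) x := by
    rw [Metric.continuousWithinAt_iff]
    intro ε hε
    refine ⟨m * ε, by positivity, fun {y} hy hyx ↦ ?_⟩
    rw [Real.dist_eq] at hyx ⊢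
    exact lt_of_mul_lt_mul_left ((hlip y hy x hx).trans_lt hyx) hm.le
  have h0 : s' (τ x) ≠ 0 := (hm.trans_le (hs' _ (hτ x hx))).ne'
  have hd : HasFDerivWithinAt s
      (ContinuousLinearEquiv.unitsEquivAut ℝ (Units.mk0 (s' (τ x)) h0) : ℝ →L[ℝ] ℝ)
      (Icc α β) (τ x) := hs _ (hτ x hx)
  exact (hd.of_local_left_inverse (tendsto_nhdsWithin_of_tendsto_nhds_of_eventually_within _ hτc
    (eventually_nhdsWithin_of_forall hτ)) hx
      (eventually_nhdsWithin_of_forall hτs)).hasDerivWithinAt.congr_deriv (by simp)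

/-- A null geodesic of a Lorentzian patch, reparametrized by the time function, is a null ray. -/
theorem IsLorentzPatch.exists_isNullRay {E : Type*} [NormedAddCommGroup E] [NormedSpace ℝ E]
    {G : E → E →L[ℝ] E →L[ℝ] ℝ} {θ : E → E →L[ℝ] ℝ} {y₀ T : E} {ℓ : E →L[ℝ] ℝ} {r c K : ℝ}
    (h : IsLorentzPatch G θ y₀ T ℓ r c K) {σ v : ℝ → E} {α β : ℝ} (hαβ : α ≤ β)
    (hmem : ∀ t ∈ Icc α β, σ t ∈ Metric.ball y₀ r)
    (hσ : ∀ t ∈ Icc α β, HasDerivWithinAt σ (v t) (Icc α β) t)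
    (hv : ContinuousOn v (Icc α β)) (hv0 : ∀ t ∈ Icc α β, v t ≠ 0)
    (hnull : ∀ t ∈ Icc α β, G (σ t) (v t) (v t) = 0) (hθ : ∀ t ∈ Icc α β, θ (σ t) (v t) < 0)
    (hP : ∀ t ∈ Icc α β, ∃ P', HasDerivWithinAt (fun t ↦ G (σ t) (v t)) P' (Icc α β) t ∧
      ∀ w, P' w = 1 / 2 * fderiv ℝ G (σ t) w (v t) (v t)) :
    StrictMonoOn (fun t ↦ ℓ (σ t) - ℓ y₀) (Icc α β) ∧
      ∃ (x x' : ℝ → E) (P P' : ℝ → E →L[ℝ] ℝ) (κ : ℝ → ℝ) (C κ₀ κ₁ : ℝ), 0 ≤ C ∧ 0 < κ₀ ∧ 0 ≤ κ₁ ∧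
        IsNullRay G y₀ ℓ r (Icc (ℓ (σ α) - ℓ y₀) (ℓ (σ β) - ℓ y₀)) x x' P P' κ C κ₀ κ₁ ∧
        ∀ t ∈ Icc α β, x (ℓ (σ t) - ℓ y₀) = σ t := by
  have hle : ∀ t ∈ Icc α β, c * ‖v t‖ ≤ ℓ (v t) := fun t ht ↦
    h.le_time _ (hmem t ht) _ (hnull t ht).le (hθ t ht)
  have hpos : ∀ t ∈ Icc α β, 0 < ℓ (v t) := fun t ht ↦
    (mul_pos h.c_pos (norm_pos_iff.2 (hv0 t ht))).trans_le (hle t ht)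
  have hℓv : ContinuousOn (fun t ↦ ℓ (v t)) (Icc α β) := ℓ.continuous.comp_continuousOn hv
  obtain ⟨t₀, ht₀, hmin⟩ := isCompact_Icc.exists_isMinOn (nonempty_Icc.2 hαβ) hℓv
  obtain ⟨t₁, ht₁, hmax⟩ := isCompact_Icc.exists_isMaxOn (nonempty_Icc.2 hαβ) hℓv
  choose! Q hQ hQw using hP
  obtain ⟨hmono, τ, hτs, hτ⟩ := exists_inverse_of_deriv_ge (s := fun t ↦ ℓ (σ t) - ℓ y₀)
    (s' := fun t ↦ ℓ (v t)) (hpos t₀ ht₀) hαβ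
    (fun t ht ↦ (ℓ.hasFDerivAt.comp_hasDerivWithinAt t (hσ t ht)).sub_const _)
    (fun t ht ↦ hmin ht)
  -- The momentum G(σ)(v) of the affine parametrization is kept as conormal. Reparametrizing divides
  -- velocities by ℓ(v), so κ = ℓ(v), with κ₀ and κ₁ its extreme values on the compact interval, and
  -- C = 1/c comes from c‖v‖ ≤ ℓ(v).
  refine ⟨hmono, fun s ↦ σ (τ s), fun s ↦ (ℓ (v (τ s)))⁻¹ • v (τ s),
    fun s ↦ G (σ (τ s)) (v (τ s)), fun s ↦ (ℓ (v (τ s)))⁻¹ • Q (τ s), fun s ↦ ℓ (v (τ s)),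
    c⁻¹, ℓ (v t₀), ℓ (v t₁), inv_nonneg.2 h.c_pos.le, hpos t₀ ht₀, (hpos t₁ ht₁).le,
    ⟨fun s hs ↦ hmem _ (hτ s hs).1, fun s hs ↦ ?_, fun s hs ↦ ?_, fun s hs ↦ ?_, fun s hs ↦ ?_,
      fun s hs w ↦ ?_, fun s hs ↦ ?_, fun s hs w ↦ ?_, fun s hs ↦ hmin (hτ s hs).1,
      fun s hs ↦ hmax (hτ s hs).1, fun s hs ↦ ?_⟩, fun t ht ↦ congrArg σ (hτs t ht)⟩
  all_goals obtain ⟨h1, h2, h3⟩ := hτ s hs; have h4 := (hpos _ h1).ne'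
  · exact (hσ _ h1).scomp s h3 fun x hx ↦ (hτ x hx).1
  · linarith
  · simp [h4]
  · simp [hnull _ h1]
  · simp [h4]
  · exact (hQ _ h1).scomp s h3 fun x hx ↦ (hτ x hx).1
  · simp only [smul_apply, map_smul, hQw _ h1, smul_eq_mul]
    field_simp
  · rw [norm_smul, norm_inv, Real.norm_of_nonneg (hpos _ h1).le, inv_mul_le_iff₀ (hpos _ h1),
      ← div_eq_mul_inv, le_div_iff₀ h.c_pos, mul_comm]
    exact hle _ h1

/-! ### Half-open intervals -/

theorem ordConnected_halfOpenInterval (a : EReal) : (halfOpenInterval a).OrdConnected :=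
  ⟨fun _ hx _ hy _ hz ↦ ⟨hx.1.trans hz.1, (EReal.coe_le_coe_iff.2 hz.2).trans_lt hy.2⟩⟩

theorem exists_gt_mem_halfOpenInterval {a : EReal} {t : ℝ} (ht : t ∈ halfOpenInterval a) {δ : ℝ}
    (hδ : 0 < δ) : ∃ β ∈ halfOpenInterval a, t < β ∧ β < t + δ := by
  obtain ⟨b, h1, h2⟩ := EReal.lt_iff_exists_real_btwn.1 ht.2
  have h1 : t < b := EReal.coe_lt_coe_iff.1 h1
  have h3 : t < min b (t + δ / 2) := lt_min h1 (by linarith)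
  refine ⟨min b (t + δ / 2), ⟨ht.1.trans h3.le, lt_of_le_of_lt ?_ h2⟩, h3,
    (min_le_right _ _).trans_lt (by linarith)⟩
  exact EReal.coe_le_coe_iff.2 (min_le_left _ _)

theorem uniqueDiffOn_halfOpenInterval {a : EReal} (ha : 0 < a) :
    UniqueDiffOn ℝ (halfOpenInterval a) := by
  have h0 : (0 : ℝ) ∈ halfOpenInterval a := ⟨le_rfl, ha⟩
  obtain ⟨β, hβ, h1, -⟩ := exists_gt_mem_halfOpenInterval h0 one_pos
  refine uniqueDiffOn_convex (ordConnected_halfOpenInterval a).convex ?_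
  refine Nonempty.mono (interior_mono ((ordConnected_halfOpenInterval a).out h0 hβ)) ?_
  rw [interior_Icc]
  exact nonempty_Ioo.2 h1

namespace SpacetimeStructure

variable {n : ℕ} {M : Type*} [TopologicalSpace M]
  [ChartedSpace (EuclideanSpace ℝ (Fin (n + 1))) M] [IsManifold (𝓡 (n + 1)) ∞ M]

/-! ### Null geodesics -/

theorem IsFutureNullGeodesicOn.isFutureCausalCurve {g : SpacetimeStructure n M} {η : ℝ → M}
    {D : Set ℝ} (hη : g.IsFutureNullGeodesicOn η D) {s t : ℝ} (hst : s < t) (hD : Icc s t ⊆ D) :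
    g.IsFutureCausalCurve η s t := by
  refine .single ⟨hst, hη.1.1.mono hD, fun r hr ↦ ?_⟩
  rw [futureCausal_iff_model, modelVelocity_subset hD (uniqueDiffOn_Icc hst r hr) hη.1.1 (hD hr),
    ← futureCausal_iff_model]
  exact (hη.2 r (hD hr)).futureCausal

/-- A null geodesic inside a Lorentzian patch, reparametrized by the time function, is a null
ray. -/
theorem IsFutureNullGeodesicOn.exists_isNullRay {g : SpacetimeStructure n M} {η : ℝ → M}
    {D : Set ℝ} (hη : g.IsFutureNullGeodesicOn η D) (hDu : UniqueDiffOn ℝ D) {x₀ : M}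
    {T : EuclideanSpace ℝ (Fin (n + 1))} {ℓ : EuclideanSpace ℝ (Fin (n + 1)) →L[ℝ] ℝ} {r c K : ℝ}
    (h : IsLorentzPatch (g.chartMetric x₀) (g.chartTime x₀) (extChartAt (𝓡 (n + 1)) x₀ x₀) T ℓ r c K)
    {α β : ℝ} (hαβ : α ≤ β) (hD : Icc α β ⊆ D)
    (hmem : ∀ t ∈ Icc α β, η t ∈ (extChartAt (𝓡 (n + 1)) x₀).source ∧
      extChartAt (𝓡 (n + 1)) x₀ (η t) ∈ Metric.ball (extChartAt (𝓡 (n + 1)) x₀ x₀) r) :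
    StrictMonoOn (fun t ↦ ℓ (extChartAt (𝓡 (n + 1)) x₀ (η t)) - ℓ (extChartAt (𝓡 (n + 1)) x₀ x₀))
      (Icc α β) ∧
      ∃ (x x' : ℝ → EuclideanSpace ℝ (Fin (n + 1)))
        (P P' : ℝ → EuclideanSpace ℝ (Fin (n + 1)) →L[ℝ] ℝ) (κ : ℝ → ℝ) (C κ₀ κ₁ : ℝ),
        0 ≤ C ∧ 0 < κ₀ ∧ 0 ≤ κ₁ ∧
        IsNullRay (g.chartMetric x₀) (extChartAt (𝓡 (n + 1)) x₀ x₀) ℓ r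
          (Icc (ℓ (extChartAt (𝓡 (n + 1)) x₀ (η α)) - ℓ (extChartAt (𝓡 (n + 1)) x₀ x₀))
            (ℓ (extChartAt (𝓡 (n + 1)) x₀ (η β)) - ℓ (extChartAt (𝓡 (n + 1)) x₀ x₀)))
          x x' P P' κ C κ₀ κ₁ ∧
        ∀ t ∈ Icc α β, x (ℓ (extChartAt (𝓡 (n + 1)) x₀ (η t)) - ℓ (extChartAt (𝓡 (n + 1)) x₀ x₀)) =
          extChartAt (𝓡 (n + 1)) x₀ (η t) := by
  have hder : ∀ t ∈ Icc α β, HasDerivWithinAt (fun s ↦ extChartAt (𝓡 (n + 1)) x₀ (η s))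
      (derivWithin (fun s ↦ extChartAt (𝓡 (n + 1)) x₀ (η s)) D t) D t := fun t ht ↦
    hasDerivWithinAt_chart x₀ hη.1.1 (hD ht) (hmem t ht).1
  have hnull := fun t (ht : t ∈ Icc α β) ↦ (g.futureNull_velocity_iff x₀ (hDu t (hD ht))
    (hη.1.1 t (hD ht)).continuousWithinAt (hmem t ht).1 (hder t ht)).1 (hη.2 t (hD ht))
  refine h.exists_isNullRay (σ := fun s ↦ extChartAt (𝓡 (n + 1)) x₀ (η s))
    (v := derivWithin (fun s ↦ extChartAt (𝓡 (n + 1)) x₀ (η s)) D) hαβ (fun t ht ↦ (hmem t ht).2)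
    (fun t ht ↦ (hder t ht).mono hD) (fun t ht ↦ ?_) (fun t ht ↦ (hnull t ht).1)
    (fun t ht ↦ (hnull t ht).2.1) (fun t ht ↦ (hnull t ht).2.2) fun t ht ↦ ?_
  · have h1 := (contDiffWithinAt_extChartAt_comp x₀ (hη.1.1 t (hD ht))
      (hmem t ht).1).fderivWithin_right (m := 0) hDu (by decide) (hD ht)
    exact (h1.clm_apply (contDiffWithinAt_const (c := (1 : ℝ)))).continuousWithinAt.mono hD
  · obtain ⟨P', h1, h2⟩ := hη.1.exists_momentum_deriv hDu x₀ (hD ht) (hmem t ht).1 rfl rfl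
    exact ⟨P', h1.mono hD, h2⟩

/-- Near each of its points, a null geodesic on `[0, a)` is a null ray. -/
theorem IsFutureNullGeodesicOn.exists_local_isNullRay {g : SpacetimeStructure n M} {η : ℝ → M}
    {a : EReal} (ha : 0 < a) (hη : g.IsFutureNullGeodesicOn η (halfOpenInterval a)) {t₀ : ℝ}
    (ht₀ : t₀ ∈ halfOpenInterval a) {x₀ : M} (hx₀ : η t₀ = x₀) :
    ∃ T ℓ r c K, ∃ α β : ℝ,
      IsLorentzPatch (g.chartMetric x₀) (g.chartTime x₀) (extChartAt (𝓡 (n + 1)) x₀ x₀) T ℓ r c K ∧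
      α ≤ t₀ ∧ t₀ < β ∧ (α < t₀ ∨ ∀ t ∈ halfOpenInterval a, α ≤ t) ∧
      Icc α β ⊆ halfOpenInterval a ∧
      (∀ t ∈ Icc α β, η t ∈ (extChartAt (𝓡 (n + 1)) x₀).source ∧
        extChartAt (𝓡 (n + 1)) x₀ (η t) ∈ Metric.ball (extChartAt (𝓡 (n + 1)) x₀ x₀) r) ∧
      StrictMonoOn
        (fun t ↦ ℓ (extChartAt (𝓡 (n + 1)) x₀ (η t)) - ℓ (extChartAt (𝓡 (n + 1)) x₀ x₀))
        (Icc α β) ∧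
      ∃ (x x' : ℝ → EuclideanSpace ℝ (Fin (n + 1)))
        (P P' : ℝ → EuclideanSpace ℝ (Fin (n + 1)) →L[ℝ] ℝ) (κ : ℝ → ℝ) (C κ₀ κ₁ : ℝ),
        0 ≤ C ∧ 0 < κ₀ ∧ 0 ≤ κ₁ ∧
        IsNullRay (g.chartMetric x₀) (extChartAt (𝓡 (n + 1)) x₀ x₀) ℓ r
          (Icc (ℓ (extChartAt (𝓡 (n + 1)) x₀ (η α)) - ℓ (extChartAt (𝓡 (n + 1)) x₀ x₀))
            (ℓ (extChartAt (𝓡 (n + 1)) x₀ (η β)) - ℓ (extChartAt (𝓡 (n + 1)) x₀ x₀)))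
          x x' P P' κ C κ₀ κ₁ ∧
        ∀ t ∈ Icc α β, x (ℓ (extChartAt (𝓡 (n + 1)) x₀ (η t)) - ℓ (extChartAt (𝓡 (n + 1)) x₀ x₀)) =
          extChartAt (𝓡 (n + 1)) x₀ (η t) := by
  obtain ⟨T, ℓ, r, c, K, h, -⟩ := g.exists_patch x₀
  have hcont : ContinuousWithinAt η (halfOpenInterval a) t₀ :=
    (hη.1.1 t₀ ht₀).continuousWithinAt
  rw [ContinuousWithinAt, hx₀] at hcont
  have hN := hcont (chart_mem_nhds (n := n) x₀ (Metric.ball_mem_nhds _ h.r_pos))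
  obtain ⟨δ, hδ, hball⟩ := Metric.mem_nhdsWithin_iff.1 hN
  obtain ⟨β, hβD, hβ, hβδ⟩ := exists_gt_mem_halfOpenInterval ht₀ hδ
  have hα : max 0 (t₀ - δ / 2) ≤ t₀ := max_le ht₀.1 (by linarith)
  have hD : Icc (max 0 (t₀ - δ / 2)) β ⊆ halfOpenInterval a :=
    (ordConnected_halfOpenInterval a).out
      ⟨le_max_left _ _, (EReal.coe_le_coe_iff.2 hα).trans_lt ht₀.2⟩ hβD
  have hmem : ∀ t ∈ Icc (max 0 (t₀ - δ / 2)) β, η t ∈ (extChartAt (𝓡 (n + 1)) x₀).source ∧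
      extChartAt (𝓡 (n + 1)) x₀ (η t) ∈ Metric.ball (extChartAt (𝓡 (n + 1)) x₀ x₀) r := by
    intro t ht
    refine hball ⟨?_, hD ht⟩
    have := (le_max_right _ _).trans ht.1
    rw [Metric.mem_ball, Real.dist_eq, abs_lt]
    constructor <;> linarith [ht.2]
  refine ⟨T, ℓ, r, c, K, max 0 (t₀ - δ / 2), β, h, hα, hβ, ?_, hD, hmem,
    hη.exists_isNullRay (uniqueDiffOn_halfOpenInterval ha) h (hα.trans hβ.le) hD hmem⟩
  rcases ht₀.1.eq_or_lt with h0 | h0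
  · refine .inr fun t ht ↦ max_le ht.1 ?_
    linarith [ht.1]
  · exact .inl (max_lt h0 (by linarith))

/-- In a strongly causal spacetime, null geodesics are locally achronal. -/
theorem IsFutureNullGeodesicOn.locallyAchronal {g : SpacetimeStructure n M} {η : ℝ → M}
    {a : EReal} (ha : 0 < a) (hη : g.IsFutureNullGeodesicOn η (halfOpenInterval a))
    (hg : g.StronglyCausal) : g.LocallyAchronal (η '' halfOpenInterval a) := by
  rintro _ ⟨t₀, ht₀, rfl⟩
  obtain ⟨T, ℓ, r, c, K, α, β, h, hα, hβ, hleft, hD, hmem, hmono, x, x', P, P', κ, C, κ₀, κ₁, hC, hκ₀,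
    hκ₁, hray, hx⟩ := hη.exists_local_isNullRay ha ht₀ rfl
  generalize hx₀ : η t₀ = x₀ at *
  obtain ⟨k, -, τ, hτ, hbar⟩ := h.exists_nullBarrier_lt hC hκ₀ hκ₁
  set y₀ := extChartAt (𝓡 (n + 1)) x₀ x₀ with hy₀
  have hJ₀ : t₀ ∈ Icc α β := ⟨hα, hβ.le⟩
  have hJα : α ∈ Icc α β := left_mem_Icc.2 (hα.trans hβ.le)
  have hJβ : β ∈ Icc α β := right_mem_Icc.2 (hα.trans hβ.le)
  have hs₀ : ℓ (extChartAt (𝓡 (n + 1)) x₀ (η t₀)) - ℓ y₀ = 0 := by rw [hx₀, ← hy₀, sub_self]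
  have hsβ : 0 < ℓ (extChartAt (𝓡 (n + 1)) x₀ (η β)) - ℓ y₀ := hs₀ ▸ hmono hJ₀ hJβ hβ
  -- The slab |ℓ - ℓ(y₀)| < ε excludes η(β), and also η(α) unless α is the first parameter of the
  -- geodesic.
  obtain ⟨ε, hε, hετ, hεβ, hεα⟩ : ∃ ε > (0 : ℝ), ε ≤ τ ∧
      ε ≤ ℓ (extChartAt (𝓡 (n + 1)) x₀ (η β)) - ℓ y₀ ∧
      ((∃ t ∈ halfOpenInterval a, t < α) →
        ε ≤ -(ℓ (extChartAt (𝓡 (n + 1)) x₀ (η α)) - ℓ y₀)) := by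
    rcases hleft with hα' | hα'
    · have hsα : ℓ (extChartAt (𝓡 (n + 1)) x₀ (η α)) - ℓ y₀ < 0 := hs₀ ▸ hmono hJα hJ₀ hα'
      exact ⟨min τ (min _ _), lt_min hτ (lt_min hsβ (neg_pos.2 hsα)), min_le_left _ _,
        (min_le_right _ _).trans (min_le_left _ _),
        fun _ ↦ (min_le_right _ _).trans (min_le_right _ _)⟩
    · exact ⟨min τ _, lt_min hτ hsβ, min_le_left _ _, min_le_right _ _,
        fun ⟨t, ht, hlt⟩ ↦ absurd (hα' t ht) (not_le.2 hlt)⟩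
  have hN : {z | z ∈ Metric.ball y₀ r ∧ |ℓ z - ℓ y₀| < ε} ∈ 𝓝 y₀ := by
    have hℓ : Continuous fun z ↦ |ℓ z - ℓ y₀| := by fun_prop
    exact inter_mem (Metric.ball_mem_nhds _ h.r_pos)
      ((isOpen_lt hℓ continuous_const).mem_nhds (by simpa using hε))
  obtain ⟨V, hVsub, hVo, hxV⟩ := mem_nhds_iff.1 (chart_mem_nhds x₀ hN)
  obtain ⟨U, hUo, hxU, hUV, hU⟩ := hg x₀ V hVo hxV
  refine ⟨U, hUo, hxU, ?_⟩
  -- A point of the geodesic in U with parameter outside [α, β] would be joined to η(t₀) by a causal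
  -- segment through η(α) or η(β). Strong causality keeps that segment in V, which excludes these
  -- points.
  have hpar : ∀ t ∈ halfOpenInterval a, η t ∈ U → t ∈ Icc α β := by
    intro t ht htU
    by_contra hcon
    rw [mem_Icc, not_and_or, not_le, not_le] at hcon
    rcases hcon with hlt | hlt
    · have h1 := hVsub (hU η t t₀ (hη.isFutureCausalCurve (hlt.trans_le hα)
        ((ordConnected_halfOpenInterval a).out ht ht₀)) htU (hx₀ ▸ hxU) α ⟨hlt.le, hα⟩)
      have h2 := hεα ⟨t, ht, hlt⟩
      have h3 := (abs_lt.1 h1.2.2).1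
      linarith
    · have h1 := hVsub (hU η t₀ t (hη.isFutureCausalCurve (hβ.trans hlt)
        ((ordConnected_halfOpenInterval a).out ht₀ ht)) (hx₀ ▸ hxU) htU β ⟨hβ.le, hlt.le⟩)
      have h3 := (abs_lt.1 h1.2.2).2
      linarith
  have hzero : ∀ t ∈ Icc α β,
      nullBarrier (g.chartMetric x₀) y₀ ℓ x P k (extChartAt (𝓡 (n + 1)) x₀ (η t)) = 0 := by
    intro t ht
    rw [nullBarrier, hx t ht, sub_self]
    simp
  rintro _ ⟨⟨t₁, ht₁, rfl⟩, h₁U⟩ _ ⟨⟨t₂, ht₂, rfl⟩, h₂U⟩ ⟨γ, p, q, hγ, hγp, hγq, hγU⟩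
  have hJ₁ := hpar t₁ ht₁ h₁U
  have hγV : ∀ t ∈ Icc p q, γ t ∈ (extChartAt (𝓡 (n + 1)) x₀).source ∧
      extChartAt (𝓡 (n + 1)) x₀ (γ t) ∈ Metric.ball y₀ r ∧
        |ℓ (extChartAt (𝓡 (n + 1)) x₀ (γ t)) - ℓ y₀| < ε := fun t ht ↦ hVsub (hUV (hγU t ht))
  -- The time function does not decrease along γ, so γ stays above the level of η(α), where the ray
  -- may begin. The barrier is defined through the ray and needs this range.
  have hlow : ∀ t ∈ Icc p q, ℓ (extChartAt (𝓡 (n + 1)) x₀ (γ p)) ≤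
      ℓ (extChartAt (𝓡 (n + 1)) x₀ (γ t)) := by
    intro t ht
    rcases ht.1.eq_or_lt with rfl | hpt
    · exact le_rfl
    refine (hγ.restrict_left ⟨hpt, ht.2⟩).chart_induction x₀ (S := Metric.ball y₀ r)
      (Q := fun u w ↦ ℓ u ≤ ℓ w) (fun _ _ _ ↦ le_trans) (fun σ a b hab hσ hder ↦ ?_)
      (fun s hs ↦ ⟨(hγV s ⟨hs.1, hs.2.trans ht.2⟩).1, (hγV s ⟨hs.1, hs.2.trans ht.2⟩).2.1⟩)
    have h1 := h.mul_norm_sub_le hab hσ hder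
    have h2 : 0 ≤ c * ‖σ b - σ a‖ := mul_nonneg h.c_pos.le (norm_nonneg _)
    rw [map_sub] at h1
    linarith
  have hlt := hγ.chart_induction x₀
    (S := {z | z ∈ Metric.ball y₀ r ∧ ℓ z - ℓ y₀ ∈
      Icc (ℓ (extChartAt (𝓡 (n + 1)) x₀ (η α)) - ℓ y₀)
        (ℓ (extChartAt (𝓡 (n + 1)) x₀ (η β)) - ℓ y₀) ∩ Icc (-τ) τ})
    (Q := fun u w ↦ nullBarrier (g.chartMetric x₀) y₀ ℓ x P k w <
      nullBarrier (g.chartMetric x₀) y₀ ℓ x P k u) (fun _ _ _ h1 h2 ↦ h2.trans h1)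
    (fun σ a b hab hσ hder ↦ hbar _ x x' P P' κ (hray.mono inter_subset_left)
      (fun s hs ↦ abs_le.2 hs.2) σ a b hab (fun t ht ↦ (hσ t ht).1) (fun t ht ↦ (hσ t ht).2) hder)
    (fun t ht ↦ by
      obtain ⟨h1, h2, h3⟩ := hγV t ht
      have h4 := abs_lt.1 h3
      have h5 := hlow t ht
      have h6 : ℓ (extChartAt (𝓡 (n + 1)) x₀ (η α)) - ℓ y₀ ≤
          ℓ (extChartAt (𝓡 (n + 1)) x₀ (η t₁)) - ℓ y₀ := hmono.monotoneOn hJα hJ₁ hJ₁.1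
      rw [hγp] at h5
      exact ⟨h1, h2, ⟨by linarith, by linarith⟩, by linarith, by linarith⟩)
  -- The barrier vanishes at both ends of γ but strictly decreases along it.
  rw [hγp, hγq, hzero t₁ hJ₁, hzero t₂ (hpar t₂ ht₂ h₂U)] at hlt
  exact hlt.false

/-- In a strongly causal spacetime, the image of a future-inextendible null geodesic is closed. -/
theorem IsFutureNullGeodesicOn.isClosed_image [T2Space M] {g : SpacetimeStructure n M} {η : ℝ → M}
    {a : EReal} (hη : g.IsFutureNullGeodesicOn η (halfOpenInterval a))
    (hg : g.StronglyCausal) (hend : FutureInextendible η a) :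
    IsClosed (η '' halfOpenInterval a) := by
  rw [← closure_subset_iff_isClosed]
  intro p hp
  by_contra hpA
  refine hend ⟨p, fun V hV ↦ ?_⟩
  obtain ⟨V', hV'V, hV'o, hpV'⟩ := mem_nhds_iff.1 hV
  obtain ⟨U, hUo, hpU, -, hU⟩ := hg p V' hV'o hpV'
  obtain ⟨_, h₁U, t₁, ht₁, rfl⟩ := mem_closure_iff.1 hp U hUo hpU
  -- A limit point p off the image avoids each compact initial arc, so the geodesic returns to U
  -- after any time t. Strong causality then traps it in V from t₁ on, so η would converge to p.
  have key : ∀ t ∈ halfOpenInterval a, t₁ ≤ t → η t ∈ V := by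
    intro t ht h1t
    have hK : IsClosed (η '' Icc 0 t) := by
      refine (isCompact_Icc.image_of_continuousOn (hη.1.1.continuousOn.mono ?_)).isClosed
      exact fun s hs ↦ ⟨hs.1, (EReal.coe_le_coe_iff.2 hs.2).trans_lt ht.2⟩
    have hpK : p ∉ η '' Icc 0 t := by
      rintro ⟨s, hs, rfl⟩
      exact hpA ⟨s, ⟨hs.1, (EReal.coe_le_coe_iff.2 hs.2).trans_lt ht.2⟩, rfl⟩
    obtain ⟨_, ⟨h₂U, h₂K⟩, t₂, ht₂, rfl⟩ := mem_closure_iff.1 hp (U ∩ (η '' Icc 0 t)ᶜ)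
      (hUo.inter hK.isOpen_compl) ⟨hpU, hpK⟩
    have h2t : t < t₂ := by
      by_contra hcon
      exact h₂K ⟨t₂, ⟨ht₂.1, not_lt.1 hcon⟩, rfl⟩
    exact hV'V (hU η t₁ t₂ (hη.isFutureCausalCurve (h1t.trans_lt h2t)
      ((ordConnected_halfOpenInterval a).out ht₁ ht₂)) h₁U h₂U t ⟨h1t, h2t.le⟩)
  refine ⟨Ioo (t₁ : EReal) a, Ioo_mem_nhdsLT ht₁.2, fun t ht ↦ ?_⟩
  have h1 : t₁ < t := EReal.coe_lt_coe_iff.1 ht.1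
  exact key t ⟨ht₁.1.trans h1.le, ht.2⟩ h1.le

/-- A null geodesic ray with closed image has no future edge. -/
theorem IsFutureNullGeodesicOn.futureEdge_eq_empty {g : SpacetimeStructure n M} {η : ℝ → M}
    {a : EReal} (ha : 0 < a) (hη : g.IsFutureNullGeodesicOn η (halfOpenInterval a))
    (hcl : IsClosed (η '' halfOpenInterval a)) : g.futureEdge (η '' halfOpenInterval a) = ∅ := by
  refine eq_empty_of_forall_notMem fun p ⟨hp, U, hUo, hpU, hU⟩ ↦ ?_
  rw [hcl.closure_eq] at hp
  obtain ⟨t₀, ht₀, rfl⟩ := hp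
  obtain ⟨T, ℓ, r, c, K, α, β, h, hα, hβ, -, hD, hmem, hmono, -⟩ :=
    hη.exists_local_isNullRay ha ht₀ rfl
  have hcont : ContinuousWithinAt η (halfOpenInterval a) t₀ :=
    (hη.1.1 t₀ ht₀).continuousWithinAt
  obtain ⟨δ, hδ, hball⟩ := Metric.mem_nhdsWithin_iff.1 (hcont (hUo.mem_nhds hpU))
  obtain ⟨t₁, h1, h2⟩ := exists_between (lt_min hβ (lt_add_of_pos_right t₀ hδ))
  have hsub : Icc t₀ t₁ ⊆ halfOpenInterval a := fun t ht ↦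
    hD ⟨hα.trans ht.1, ht.2.trans (h2.le.trans (min_le_left _ _))⟩
  have hJ₁ : t₁ ∈ Icc α β := ⟨hα.trans h1.le, h2.le.trans (min_le_left _ _)⟩
  -- A slightly later point of the geodesic lies in J⁺(p, U), so the edge condition would identify
  -- it with p; the time function ℓ separates the two.
  have h3 : η t₁ = η t₀ := hU ⟨⟨t₁, hD hJ₁, rfl⟩, .inr ⟨η, t₀, t₁, hη.isFutureCausalCurve h1 hsub,
    rfl, rfl, fun t ht ↦ hball ⟨?_, hsub ht⟩⟩⟩
  · have := hmono ⟨hα, hβ.le⟩ hJ₁ h1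
    simp [h3] at this
  · rw [Metric.mem_ball, Real.dist_eq, abs_lt]
    have := h2.trans_le (min_le_right _ _)
    constructor <;> linarith [ht.1, ht.2]

/-- In a strongly causal spacetime, future-inextendible null geodesics have future p-horizons. -/
theorem IsFutureNullGeodesicOn.hasFuturePHorizon [T2Space M] {g : SpacetimeStructure n M}
    {η : ℝ → M} {a : EReal} (ha : 0 < a) (hη : g.IsFutureNullGeodesicOn η (halfOpenInterval a))
    (hg : g.StronglyCausal) (hend : FutureInextendible η a)
    (hne : (frontier (g.chronPast (η '' halfOpenInterval a))).Nonempty) :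
    g.HasFuturePHorizon (η '' halfOpenInterval a) := by
  have he := hη.futureEdge_eq_empty ha (hη.isClosed_image hg hend)
  refine FutureLightlike.hasFuturePHorizon ?_ he hne
  refine (g.futureLightlike_iff ((show (halfOpenInterval a).Nonempty from ⟨0, le_rfl, ha⟩).image η)
    (hη.locallyAchronal ha hg)).2 ?_
  rw [he, inter_empty]

end SpacetimeStructure

end

/-! ### Assembly of the four statements. -/

theorem mainTheorem10 {n : ℕ} (hn : 2 ≤ n) {M : Type*} [TopologicalSpace M]
    [ChartedSpace (EuclideanSpace ℝ (Fin (n + 1))) M] [IsManifold (𝓡 (n + 1)) ∞ M]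
    [T2Space M] [SecondCountableTopology M] [ConnectedSpace M] (g : SpacetimeStructure n M) :
    (∀ A : Set M, A.Nonempty → g.LocallyAchronal A →
      (g.FutureLightlike A ↔ A ∩ g.futureEdge A = ∅)) ∧
    (∀ A : Set M, g.FutureLightlike A →
      (frontier (g.chronPast A) \ closure (g.futureEdge A)).Nonempty →
        g.Achronal (frontier (g.chronPast A) \ closure (g.futureEdge A)) ∧
        g.FutureLightlike (frontier (g.chronPast A) \ closure (g.futureEdge A)) ∧
        IsC0Hypersurface n (frontier (g.chronPast A) \ closure (g.futureEdge A))) ∧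
    (∀ A : Set M, g.FutureLightlike A → g.futureEdge A = ∅ →
      (frontier (g.chronPast A)).Nonempty → g.HasFuturePHorizon A) ∧
    (g.StronglyCausal → ∀ (η : ℝ → M) (a : EReal), 0 < a →
      g.IsFutureNullGeodesicOn η (halfOpenInterval a) → FutureInextendible η a →
      (frontier (g.chronPast (η '' halfOpenInterval a))).Nonempty →
        g.HasFuturePHorizon (η '' halfOpenInterval a)) := by
  exact ⟨fun A hA hA' ↦ g.futureLightlike_iff hA hA', fun A _ hne ↦
    ⟨(g.achronal_frontier_chronPast A).mono sdiff_subset, g.futureLightlike_frontier_diff hne,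
      (g.isC0Hypersurface_frontier_chronPast A).diff_isClosed isClosed_closure⟩,
    fun A hA he hne ↦ hA.hasFuturePHorizon he hne,
    fun hg η a ha hη hend hne ↦ hη.hasFuturePHorizon ha hg hend hne⟩
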